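/- Let $n\ge 1$, $s\in(0,1)$, $p\in(1,\infty)$. Let $\mathbb{H}^n=\mathbb{R}^{2n+1}$ be the Heisenberg group, with points $\xi=(x,y,t)$, $x,y\in\mathbb{R}^n$, $t\in\mathbb R$, group law $\xi\circ\xi'=(x+x',\,y+y',\,t+t'+2\langle y,x'\rangle-2\langle x,y'\rangle)$, dilations $\Phi_\lambda(\xi)=(\lambda x,\lambda y,\lambda^2t)$, homogeneous dimension $Q=2n+2$, Lebesgue measure, standard homogeneous norm $|\xi|_{\mathbb{H}^n}=\big((|x|^2+|y|^2)^2+t^2\big)^{1/4}$ and balls $B_r(\xi)=\{\eta:|\xi^{-1}\circ\eta|_{\mathbb{H}^n}<r\}$. Let $d_{\rm o}:\mathbb{H}^n\to[0,\infty)$ be a homogeneous norm, i.e. a continuous function with $d_{\rm o}(\Phi_\lambda(\xi))=\lambda d_{\rm o}(\xi)$ for all $\lambda>0$, and $d_{\rm o}(\xi)=0$ if and only if $\xi=0$. Let $\Omega\subset\mathbb{H}^n$ be open, and let $f:\mathbb{H}^n\times\mathbb{R}\to\mathbb{R}$ be such that $f(\cdot,x)$ is measurable and belongs to $L^\infty_{\rm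 loc}(\mathbb{H}^n)$ for every $x\in\mathbb R$, $f(\xi,\cdot)$ is continuous for a.e. $\xi$, and for every compact $K\subset\Omega$ there is a constant $C$ with $|f(\xi,x)|\le C$ for every $x\in\mathbb{R}$ and a.e. $\xi\in K$. For $D\subset\mathbb{H}^n$ open, $W^{s,p}(D)$ is the space of all $u\in L^p(D)$ with $\dfrac{|u(\xi)-u(\eta)|}{|\eta^{-1}\circ\xi|_{\mathbb{H}^n}^{Q/p+s}}\in L^p(D\times D)$, and $u\in W^{s,p}_{\rm loc}(\Omega)$ means $u\in W^{s,p}(D)$ for every open $D\Subset\Omega$. Moreover, $L^{p-1}_{sp}(\mathbb{H}^n)$ is the set of all $v\in L^{p-1}_{\rm loc}(\mathbb{H}^n)$ with $\int_{\mathbb{H}^n}|v(\xi)|^{p-1}(1+|\xi|_{\mathbb{H}^n})^{-Q-sp}\,d\xi<\infty$. A measurable function $u:\mathbb{H}^n\to\mathbb{R}$ is a weak supersolution in $\Omega$ if $u\in W^{s,p}_{\rm loc}(\Omega)$, $u_-=\max(-u,0)\in L^{p-1}_{sp}(\mathbb{H}^n)$ and, for every nonnegative $\psi\in C_0^\infty(\Omega)$,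 $$\int_{\mathbb{H}^n}\int_{\mathbb{H}^n}\frac{|u(\xi)-u(\eta)|^{p-2}(u(\xi)-u(\eta))(\psi(\xi)-\psi(\eta))}{d_{\rm o}(\eta^{-1}\circ\xi)^{Q+sp}}\,d\xi\,d\eta\ \ge\ \int_{\mathbb{H}^n}f(\xi,u(\xi))\psi(\xi)\,d\xi,$$ where the double integral, which always exists in $[-\infty,\infty)$, is in particular required to be finite. Theorem. Let $u$ be a weak supersolution in $\Omega$. Then $$u(\xi)=\operatorname*{ess\,lim\,inf}_{\eta\to\xi}u(\eta):=\lim_{r\to0^+}\operatorname*{ess\,inf}_{B_r(\xi)}u\qquad\text{for a.e. }\xi\in\Omega.$$ In particular, $u$ has a lower semicontinuous representative in $\Omega$: there is a lower semicontinuous function $v:\Omega\to(-\infty,+\infty]$ with $u=v$ a.e. in $\Omega$. -/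

import Mathlib

open MeasureTheory Set Filter Topology
open scoped ENNReal ContDiff

noncomputable section

/-- The underlying space `ℝ²ⁿ⁺¹` of the Heisenberg group; points are `ξ = (x, y, t)`.
The topology, the smooth structure and the (Lebesgue) measure are those of `ℝ²ⁿ⁺¹`. -/
abbrev Heis (n : ℕ) : Type :=
  EuclideanSpace ℝ (Fin n) × EuclideanSpace ℝ (Fin n) × ℝ

namespace Heis

variable {n : ℕ}

/-- The group law `ξ ∘ ξ' = (x + x', y + y', t + t' + 2⟨y, x'⟩ - 2⟨x, y'⟩)`. -/
def op (ξ ξ' : Heis n) : Heis n :=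
  (ξ.1 + ξ'.1, ξ.2.1 + ξ'.2.1,
    ξ.2.2 + ξ'.2.2 + 2 * inner ℝ ξ.2.1 ξ'.1 - 2 * inner ℝ ξ.1 ξ'.2.1)

/-- The inverse `ξ⁻¹ = (-x, -y, -t)` for the group law `Heis.op`. -/
def inverse (ξ : Heis n) : Heis n := (-ξ.1, -ξ.2.1, -ξ.2.2)

/-- `Heis.inverse` is an inverse for the group law, with the origin as neutral element. -/
theorem op_inverse (ξ : Heis n) : op ξ (inverse ξ) = 0 := by
  simp [op, inverse, real_inner_comm, Prod.ext_iff]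

/-- The anisotropic dilations `Φ_r(x, y, t) = (r x, r y, r² t)`. -/
def dilation (r : ℝ) (ξ : Heis n) : Heis n := (r • ξ.1, r • ξ.2.1, r ^ 2 * ξ.2.2)

/-- The homogeneous dimension `Q = 2n + 2`. -/
def homDim (n : ℕ) : ℝ := 2 * n + 2

/-- A homogeneous norm on the Heisenberg group. No symmetry and no triangle inequality is
required. -/
structure IsHomogeneousNorm (d : Heis n → ℝ) : Prop where
  continuous : Continuous d
  nonneg : ∀ ξ, 0 ≤ d ξ
  dilation : ∀ r : ℝ, 0 < r → ∀ ξ, d (dilation r ξ) = r * d ξ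
  eq_zero_iff : ∀ ξ, d ξ = 0 ↔ ξ = 0

/-- The standard homogeneous norm `|ξ| = (|z|⁴ + t²)^(1/4)`, where `z = (x, y)`. -/
def hnorm (ξ : Heis n) : ℝ :=
  ((‖ξ.1‖ ^ 2 + ‖ξ.2.1‖ ^ 2) ^ 2 + ξ.2.2 ^ 2) ^ (1 / 4 : ℝ)

/-- The ball `B_r(ξ₀) = {ξ : |ξ₀⁻¹ ∘ ξ| < r}` of the standard homogeneous norm. -/
def hball (ξ₀ : Heis n) (r : ℝ) : Set (Heis n) :=
  {ξ | hnorm (op (inverse ξ₀) ξ) < r}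

/-- `u ∈ W^{s,p}(D)`: `u ∈ L^p(D)` and
`|u(ξ) - u(η)| / |η⁻¹ ∘ ξ|^(Q/p + s) ∈ L^p(D × D)`. -/
def MemFracSobolev (s p : ℝ) (D : Set (Heis n)) (u : Heis n → ℝ) : Prop :=
  MemLp u (ENNReal.ofReal p) (volume.restrict D) ∧
  MemLp (fun z : Heis n × Heis n =>
      |u z.1 - u z.2| / hnorm (op (inverse z.2) z.1) ^ (homDim n / p + s))
    (ENNReal.ofReal p) ((volume.restrict D).prod (volume.restrict D))

/-- `u ∈ W^{s,p}_loc(Ω)`: `u ∈ W^{s,p}(D)` for every open `D ⋐ Ω`. -/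
def MemFracSobolevLoc (s p : ℝ) (Ω : Set (Heis n)) (u : Heis n → ℝ) : Prop :=
  ∀ D : Set (Heis n), IsOpen D → IsCompact (closure D) → closure D ⊆ Ω →
    MemFracSobolev s p D u

/-- `v ∈ L^{p-1}_{sp}(ℍⁿ)`: `v ∈ L^{p-1}_loc(ℍⁿ)` and
`∫ |v(ξ)|^(p-1) / (1 + |ξ|)^(Q + sp) dξ < ∞`. -/
def MemTailSpace (s p : ℝ) (v : Heis n → ℝ) : Prop :=
  (∀ K : Set (Heis n), IsCompact K →
    MemLp v (ENNReal.ofReal (p - 1)) (volume.restrict K)) ∧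
  Integrable (fun ξ : Heis n => |v ξ| ^ (p - 1) / (1 + hnorm ξ) ^ (homDim n + s * p)) volume

/-- The conditions on the datum `f = f(ξ, x)`: it is a Carathéodory function, each `f(·, x)` is
locally essentially bounded, and the bound is uniform in `x` on compact subsets of `Ω`. -/
structure IsDatum (Ω : Set (Heis n)) (f : Heis n → ℝ → ℝ) : Prop where
  measurable : ∀ x : ℝ, AEStronglyMeasurable (fun ξ => f ξ x) (volume : Measure (Heis n))
  continuous : ∀ᵐ ξ ∂(volume : Measure (Heis n)), Continuous (f ξ)
  locBounded : ∀ x : ℝ, ∀ K : Set (Heis n), IsCompact K →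
    ∃ C : ℝ, ∀ᵐ ξ ∂(volume.restrict K), |f ξ x| ≤ C
  uniform : ∀ K : Set (Heis n), IsCompact K → K ⊆ Ω →
    ∃ C : ℝ, ∀ x : ℝ, ∀ᵐ ξ ∂(volume.restrict K), |f ξ x| ≤ C

/-- The integrand
`|u(ξ) - u(η)|^(p-2) (u(ξ) - u(η)) (ψ(ξ) - ψ(η)) / d(η⁻¹ ∘ ξ)^(Q + sp)`
of the weak formulation, at `z = (ξ, η)`. -/
def energyIntegrand (s p : ℝ) (d : Heis n → ℝ) (u ψ : Heis n → ℝ) (z : Heis n × Heis n) : ℝ :=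
  |u z.1 - u z.2| ^ (p - 2) * (u z.1 - u z.2) * (ψ z.1 - ψ z.2)
    / d (op (inverse z.2) z.1) ^ (homDim n + s * p)

/-- `u` is a weak supersolution in `Ω` to `𝓛 u = f`. For `u` in the stated function classes and
`ψ ≥ 0`, the positive part of the integrand is always integrable, so that the double integral is
defined in `[-∞, ∞)`; the inequality includes that it is finite, which is the first conjunct. -/
structure IsWeakSupersolution (s p : ℝ) (d : Heis n → ℝ) (f : Heis n → ℝ → ℝ)
    (Ω : Set (Heis n)) (u : Heis n → ℝ) : Prop where
  measurable : AEStronglyMeasurable u (volume : Measure (Heis n))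
  memLoc : MemFracSobolevLoc s p Ω u
  negPart : MemTailSpace s p (fun ξ => max (-u ξ) 0)
  weak : ∀ ψ : Heis n → ℝ, ContDiff ℝ ∞ ψ → HasCompactSupport ψ → tsupport ψ ⊆ Ω →
    (∀ ξ, 0 ≤ ψ ξ) →
      Integrable (energyIntegrand s p d u ψ)
        ((volume : Measure (Heis n)).prod (volume : Measure (Heis n))) ∧
      ∫ ξ, f ξ (u ξ) * ψ ξ ≤
        ∫ z, energyIntegrand s p d u ψ z
          ∂((volume : Measure (Heis n)).prod (volume : Measure (Heis n)))

/-- `ess liminf_{η → ξ} u(η) = lim_{r → 0⁺} ess inf_{B_r(ξ)} u`, as an extended real number.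
The essential infimum increases as `r` decreases, so the limit is a supremum. -/
def essLiminf (u : Heis n → ℝ) (ξ : Heis n) : EReal :=
  ⨆ (r : ℝ) (_ : 0 < r),
    essInf (fun η => (u η : EReal)) (volume.restrict (hball ξ r))

end Heis

end

/-!
The idea is a De Giorgi iteration for the truncations `(k - u)_+`. By mollifying with left
translations, which preserve the kernel, the weak formulation extends to nonnegative test functions
with compact support and fractional Sobolev regularity, in particular to `(k - u)_+ φ^p` with a
Lipschitz cutoff `φ`. The resulting Caccioppoli inequality needs no Sobolev inequality to be
iterated: the pairs `(ξ, η)` with `u ξ < k ≤ u η` already contribute at least `(k - u ξ) ^ p` times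
the kernel, and by Chebyshev's inequality such `η` fill half of a ball around `ξ` whose radius
shrinks with the `L^p` norm of the truncation at a slightly higher level.

Hence for every `ε > 0` there is a threshold: if the `L^p` mean of `(k - u)_+` over a small ball
`B_r(ξ)` is below it, then `u ≥ k - ε` almost everywhere on `B_{r/2}(ξ)`. At almost every point `ξ`
with `u ξ ≥ k` these means tend to zero along a sequence of radii, by the `L¹` continuity of right
translations, so that `u ≤ ess liminf u` almost everywhere. The reverse inequality and the lower
semicontinuity of the essential lower limit hold for every function.
-/

noncomputable section

/-- The Cauchy–Schwarz inequality for the Hermitian product of `x + iy` and `x' + iy'`. -/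
theorem inner_add_sq_add_inner_sub_sq_le {E : Type*} [NormedAddCommGroup E] [InnerProductSpace ℝ E]
    (x y x' y' : E) :
    (inner ℝ x x' + inner ℝ y y') ^ 2 + (inner ℝ y x' - inner ℝ x y') ^ 2 ≤
      (‖x‖ ^ 2 + ‖y‖ ^ 2) * (‖x'‖ ^ 2 + ‖y'‖ ^ 2) := by
  set A := inner ℝ x x' + inner ℝ y y'
  set B := inner ℝ y x' - inner ℝ x y'
  set v := A • x' - B • y'
  set w := A • y' + B • x'
  have inner_eq : A ^ 2 + B ^ 2 = inner ℝ x v + inner ℝ y w := by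
    simp only [A, B, v, w, inner_add_right, inner_sub_right, inner_smul_right]
    ring
  have norm_eq : ‖v‖ ^ 2 + ‖w‖ ^ 2 = (A ^ 2 + B ^ 2) * (‖x'‖ ^ 2 + ‖y'‖ ^ 2) := by
    simp only [v, w, norm_sub_sq_real, norm_add_sq_real, inner_smul_left, inner_smul_right,
      norm_smul, Real.norm_eq_abs, mul_pow, sq_abs, RCLike.conj_to_real, real_inner_comm x' y']
    ring
  have sq_le : (A ^ 2 + B ^ 2) ^ 2 ≤
      (A ^ 2 + B ^ 2) * ((‖x‖ ^ 2 + ‖y‖ ^ 2) * (‖x'‖ ^ 2 + ‖y'‖ ^ 2)) := by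
    calc (A ^ 2 + B ^ 2) ^ 2 ≤ (‖x‖ * ‖v‖ + ‖y‖ * ‖w‖) ^ 2 := by
          refine pow_le_pow_left₀ (by positivity) ?_ 2
          linarith [real_inner_le_norm x v, real_inner_le_norm y w]
      _ ≤ (‖x‖ ^ 2 + ‖y‖ ^ 2) * (‖v‖ ^ 2 + ‖w‖ ^ 2) := by
          nlinarith [sq_nonneg (‖x‖ * ‖w‖ - ‖y‖ * ‖v‖)]
      _ = _ := by rw [norm_eq]; ring
  rcases (show 0 ≤ A ^ 2 + B ^ 2 by positivity).eq_or_lt with h | h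
  · rw [← h]; positivity
  · exact le_of_mul_le_mul_left (by rwa [← sq]) h

namespace Heis

variable {n : ℕ} {ξ η ζ : Heis n} {r R : ℝ}

/-! ### The group structure -/

instance : Group (Heis n) where
  mul := op
  one := 0
  inv := inverse
  mul_assoc ξ η ζ := by
    change op (op ξ η) ζ = op ξ (op η ζ)
    simp only [op, Prod.mk.injEq, inner_add_left, inner_add_right]
    exact ⟨add_assoc _ _ _, add_assoc _ _ _, by ring⟩
  one_mul ξ := by change op 0 ξ = ξ; simp [op]
  mul_one ξ := by change op ξ 0 = ξ; simp [op]
  inv_mul_cancel ξ := by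
    change op (inverse ξ) ξ = 0
    simp [op, inverse, real_inner_comm, Prod.ext_iff]

theorem one_eq_zero : (1 : Heis n) = 0 := rfl

theorem mul_def (ξ η : Heis n) :
    ξ * η = (ξ.1 + η.1, ξ.2.1 + η.2.1,
      ξ.2.2 + η.2.2 + 2 * inner ℝ ξ.2.1 η.1 - 2 * inner ℝ ξ.1 η.2.1) := rfl

theorem inv_def (ξ : Heis n) : ξ⁻¹ = (-ξ.1, -ξ.2.1, -ξ.2.2) := rfl

theorem contDiff_mul : ContDiff ℝ ∞ (fun z : Heis n × Heis n => z.1 * z.2) := by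
  simp only [mul_def]
  have h₁ : ContDiff ℝ ∞ fun z : Heis n × Heis n => inner ℝ z.1.2.1 z.2.1 :=
    ContDiff.inner ℝ (by fun_prop) (by fun_prop)
  have h₂ : ContDiff ℝ ∞ fun z : Heis n × Heis n => inner ℝ z.1.1 z.2.2.1 :=
    ContDiff.inner ℝ (by fun_prop) (by fun_prop)
  fun_prop

theorem contDiff_inv : ContDiff ℝ ∞ (fun ξ : Heis n => ξ⁻¹) := by
  simp only [inv_def]
  fun_prop

instance : IsTopologicalGroup (Heis n) where
  continuous_mul := contDiff_mul.continuous
  continuous_inv := contDiff_inv.continuous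

/-! ### The standard homogeneous norm -/

/-- The complex number `|z|² + it` attached to `ξ = (z, t)`. Its modulus is `|ξ|²`, which reduces
the triangle inequality for the homogeneous norm to that of `ℂ`. -/
def gauge (ξ : Heis n) : ℂ := ⟨‖ξ.1‖ ^ 2 + ‖ξ.2.1‖ ^ 2, ξ.2.2⟩

/-- The Hermitian product `⟨x, x'⟩ + ⟨y, y'⟩ + i (⟨y, x'⟩ - ⟨x, y'⟩)` of the horizontal parts of
`ξ` and `ξ'`. -/
def hermitian (ξ ξ' : Heis n) : ℂ :=
  ⟨inner ℝ ξ.1 ξ'.1 + inner ℝ ξ.2.1 ξ'.2.1, inner ℝ ξ.2.1 ξ'.1 - inner ℝ ξ.1 ξ'.2.1⟩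

theorem hnorm_nonneg (ξ : Heis n) : 0 ≤ hnorm ξ := by
  unfold hnorm; positivity

theorem norm_gauge (ξ : Heis n) : ‖gauge ξ‖ = hnorm ξ ^ 2 := by
  rw [Complex.norm_def, Complex.normSq_apply, hnorm, Real.sqrt_eq_rpow, ← Real.rpow_mul_natCast
    (by positivity), gauge]
  norm_num [sq]

theorem sq_add_sq_le_hnorm_sq (ξ : Heis n) : ‖ξ.1‖ ^ 2 + ‖ξ.2.1‖ ^ 2 ≤ hnorm ξ ^ 2 :=
  norm_gauge ξ ▸ Complex.re_le_norm (gauge ξ)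

theorem abs_snd_snd_le_hnorm_sq (ξ : Heis n) : |ξ.2.2| ≤ hnorm ξ ^ 2 :=
  norm_gauge ξ ▸ Complex.abs_im_le_norm (gauge ξ)

theorem hnorm_one : hnorm (1 : Heis n) = 0 := by
  simp [hnorm, one_eq_zero]

theorem norm_le_of_hnorm_le (h : hnorm ξ ≤ r) : ‖ξ‖ ≤ max r (r ^ 2) := by
  have hr : 0 ≤ r := (hnorm_nonneg ξ).trans h
  have hsq : hnorm ξ ^ 2 ≤ r ^ 2 := pow_le_pow_left₀ (hnorm_nonneg ξ) h 2
  have hz := (sq_add_sq_le_hnorm_sq ξ).trans hsq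
  rw [Prod.norm_def, Prod.norm_def]
  refine max_le ?_ (max_le ?_ ?_)
  · exact le_max_of_le_left (abs_le_of_sq_le_sq' (by nlinarith [sq_nonneg ‖ξ.2.1‖]) hr).2
  · exact le_max_of_le_left (abs_le_of_sq_le_sq' (by nlinarith [sq_nonneg ‖ξ.1‖]) hr).2
  · exact le_max_of_le_right ((abs_snd_snd_le_hnorm_sq ξ).trans hsq)

theorem hnorm_eq_zero : hnorm ξ = 0 ↔ ξ = 1 := by
  refine ⟨fun h => norm_le_zero_iff.1 ?_, fun h => h ▸ hnorm_one⟩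
  simpa using norm_le_of_hnorm_le h.le

theorem hnorm_pos (h : ξ ≠ 1) : 0 < hnorm ξ :=
  (hnorm_nonneg ξ).lt_of_ne' (hnorm_eq_zero.not.2 h)

theorem hnorm_inv (ξ : Heis n) : hnorm ξ⁻¹ = hnorm ξ := by
  simp [hnorm, inv_def]

@[fun_prop]
theorem continuous_hnorm : Continuous (hnorm : Heis n → ℝ) :=
  Continuous.rpow_const (by fun_prop) fun _ => Or.inr (by norm_num)

@[fun_prop]
theorem measurable_hnorm : Measurable (hnorm : Heis n → ℝ) := continuous_hnorm.measurable

theorem gauge_dilation (r : ℝ) (ξ : Heis n) : gauge (dilation r ξ) = r ^ 2 * gauge ξ := by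
  apply Complex.ext <;>
    simp [gauge, dilation, norm_smul, mul_pow, ← Complex.ofReal_pow, mul_add]

theorem hnorm_dilation (hr : 0 ≤ r) (ξ : Heis n) : hnorm (dilation r ξ) = r * hnorm ξ := by
  rw [← pow_left_inj₀ (hnorm_nonneg _) (mul_nonneg hr (hnorm_nonneg _)) two_ne_zero, mul_pow,
    ← norm_gauge, ← norm_gauge, gauge_dilation]
  simp

theorem norm_hermitian_le (ξ η : Heis n) : ‖hermitian ξ η‖ ≤ hnorm ξ * hnorm η := by
  refine (sq_le_sq₀ (norm_nonneg _) (mul_nonneg (hnorm_nonneg ξ) (hnorm_nonneg η))).1 ?_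
  calc ‖hermitian ξ η‖ ^ 2
      ≤ (‖ξ.1‖ ^ 2 + ‖ξ.2.1‖ ^ 2) * (‖η.1‖ ^ 2 + ‖η.2.1‖ ^ 2) := by
        rw [Complex.sq_norm, Complex.normSq_apply, ← sq, ← sq]
        exact inner_add_sq_add_inner_sub_sq_le _ _ _ _
    _ ≤ hnorm ξ ^ 2 * hnorm η ^ 2 := by
        gcongr <;> exact sq_add_sq_le_hnorm_sq _
    _ = (hnorm ξ * hnorm η) ^ 2 := (mul_pow _ _ _).symm

theorem gauge_mul (ξ η : Heis n) : gauge (ξ * η) = gauge ξ + gauge η + 2 * hermitian ξ η := by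
  apply Complex.ext
  · simp [gauge, hermitian, mul_def, norm_add_sq_real]; ring
  · simp [gauge, hermitian, mul_def]; ring

theorem hnorm_mul_le (ξ η : Heis n) : hnorm (ξ * η) ≤ hnorm ξ + hnorm η := by
  refine (sq_le_sq₀ (hnorm_nonneg _) (add_nonneg (hnorm_nonneg ξ) (hnorm_nonneg η))).1 ?_
  calc hnorm (ξ * η) ^ 2 = ‖gauge ξ + gauge η + 2 * hermitian ξ η‖ := by
        rw [← norm_gauge, gauge_mul]
    _ ≤ ‖gauge ξ‖ + ‖gauge η‖ + ‖2 * hermitian ξ η‖ := norm_add₃_le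
    _ ≤ hnorm ξ ^ 2 + hnorm η ^ 2 + 2 * (hnorm ξ * hnorm η) := by
        rw [norm_gauge, norm_gauge, norm_mul, Complex.norm_ofNat]
        gcongr
        exact norm_hermitian_le ξ η
    _ = (hnorm ξ + hnorm η) ^ 2 := by ring

/-! ### Distance and balls -/

/-- The left-invariant distance `|η⁻¹ ∘ ξ|` of the standard homogeneous norm, whose balls are the
sets `hball`. -/
def hdist (η ξ : Heis n) : ℝ := hnorm (η⁻¹ * ξ)

theorem hdist_nonneg (η ξ : Heis n) : 0 ≤ hdist η ξ := hnorm_nonneg _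

theorem hdist_self (ξ : Heis n) : hdist ξ ξ = 0 := by
  rw [hdist, inv_mul_cancel, hnorm_one]

theorem hdist_comm (η ξ : Heis n) : hdist η ξ = hdist ξ η := by
  rw [hdist, ← hnorm_inv, mul_inv_rev, inv_inv, hdist]

theorem hdist_triangle (ξ η ζ : Heis n) : hdist ξ ζ ≤ hdist ξ η + hdist η ζ := by
  simpa only [hdist, mul_assoc, mul_inv_cancel_left] using hnorm_mul_le (ξ⁻¹ * η) (η⁻¹ * ζ)

theorem hdist_mul_left (ζ η ξ : Heis n) : hdist (ζ * η) (ζ * ξ) = hdist η ξ := by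
  simp only [hdist, mul_inv_rev, mul_assoc, inv_mul_cancel_left]

theorem hdist_one (ξ : Heis n) : hdist 1 ξ = hnorm ξ := by
  rw [hdist, inv_one, one_mul]

theorem hdist_pos (h : η ≠ ξ) : 0 < hdist η ξ :=
  hnorm_pos fun h' => h (inv_mul_eq_one.1 h')

@[fun_prop]
theorem continuous_hdist {X : Type*} [TopologicalSpace X] {f g : X → Heis n} (hf : Continuous f)
    (hg : Continuous g) : Continuous fun x => hdist (f x) (g x) :=
  continuous_hnorm.comp (hf.inv.mul hg)

@[fun_prop]
theorem measurable_hdist {X : Type*} [MeasurableSpace X] {f g : X → Heis n} (hf : Measurable f)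
    (hg : Measurable g) : Measurable fun x => hdist (f x) (g x) :=
  measurable_hnorm.comp (hf.inv.mul hg)

theorem mem_hball : ξ ∈ hball η r ↔ hdist η ξ < r := Iff.rfl

theorem mem_hball_self (hr : 0 < r) : ξ ∈ hball ξ r := by
  rwa [mem_hball, hdist_self]

theorem hball_subset_hball (h : hdist ξ η + r ≤ R) : hball η r ⊆ hball ξ R := fun ζ hζ => by
  rw [mem_hball] at hζ ⊢
  linarith [hdist_triangle ξ η ζ]

theorem hball_mono (h : r ≤ R) : hball ξ r ⊆ hball ξ R :=
  hball_subset_hball (by rwa [hdist_self, zero_add])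

theorem isOpen_hball (ξ : Heis n) (r : ℝ) : IsOpen (hball ξ r) :=
  isOpen_lt (continuous_hdist continuous_const continuous_id) continuous_const

theorem measurableSet_hball (ξ : Heis n) (r : ℝ) : MeasurableSet (hball ξ r) :=
  (isOpen_hball ξ r).measurableSet

theorem hball_mem_nhds (hr : 0 < r) : hball ξ r ∈ 𝓝 ξ :=
  (isOpen_hball ξ r).mem_nhds (mem_hball_self hr)

/-- The closed ball of the standard homogeneous norm, the compact companion of `hball`. -/
def closedHball (ξ₀ : Heis n) (r : ℝ) : Set (Heis n) := {ξ | hdist ξ₀ ξ ≤ r}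

theorem mem_closedHball : ξ ∈ closedHball η r ↔ hdist η ξ ≤ r := Iff.rfl

theorem isCompact_closedHball_one (r : ℝ) : IsCompact (closedHball (1 : Heis n) r) := by
  refine Metric.isCompact_of_isClosed_isBounded
    (isClosed_le (continuous_hdist continuous_const continuous_id) continuous_const) ?_
  refine (Metric.isBounded_closedBall (x := (0 : Heis n)) (r := max r (r ^ 2))).subset
    fun ξ hξ => ?_
  rw [mem_closedHball, hdist_one] at hξ
  simpa using norm_le_of_hnorm_le hξ

theorem isCompact_closedHball (ξ : Heis n) (r : ℝ) : IsCompact (closedHball ξ r) := by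
  have h : closedHball ξ r = (ξ * ·) '' closedHball 1 r := by
    rw [image_mul_left]
    ext η
    rw [mem_preimage, mem_closedHball, mem_closedHball, hdist_one, hdist]
  exact h ▸ (isCompact_closedHball_one r).image (continuous_const_mul ξ)

theorem hball_subset_closedHball (ξ : Heis n) (r : ℝ) : hball ξ r ⊆ closedHball ξ r :=
  fun _ h => (mem_hball.1 h).le

theorem closedHball_mono (h : r ≤ R) : closedHball ξ r ⊆ closedHball ξ R :=
  fun _ hη => (mem_closedHball.1 hη).trans h

theorem closure_hball_subset (ξ : Heis n) (r : ℝ) : closure (hball ξ r) ⊆ closedHball ξ r :=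
  closure_minimal (hball_subset_closedHball ξ r) (isCompact_closedHball ξ r).isClosed

theorem isCompact_closure_hball (ξ : Heis n) (r : ℝ) : IsCompact (closure (hball ξ r)) :=
  (isCompact_closedHball ξ r).of_isClosed_subset isClosed_closure (closure_hball_subset ξ r)

theorem exists_closedHball_one_subset {U : Set (Heis n)} (hU : U ∈ 𝓝 1) :
    ∃ r, 0 < r ∧ closedHball 1 r ⊆ U := by
  obtain ⟨ε, hε, hεU⟩ := Metric.mem_nhds_iff.1 hU
  refine ⟨min 1 (ε / 2), by positivity, fun ξ hξ => hεU (mem_ball_zero_iff.2 ?_)⟩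
  rw [mem_closedHball, hdist_one] at hξ
  have hsq : min 1 (ε / 2) ^ 2 ≤ min 1 (ε / 2) :=
    pow_le_of_le_one (by positivity) (min_le_left _ _) two_ne_zero
  calc ‖ξ‖ ≤ min 1 (ε / 2) := (norm_le_of_hnorm_le hξ).trans (max_le le_rfl hsq)
    _ ≤ ε / 2 := min_le_right _ _
    _ < ε := half_lt_self hε

theorem exists_closedHball_subset {U : Set (Heis n)} (hU : U ∈ 𝓝 ξ) :
    ∃ r, 0 < r ∧ closedHball ξ r ⊆ U := by
  obtain ⟨r, hr, hrU⟩ := exists_closedHball_one_subset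
    ((continuous_const_mul ξ).continuousAt.preimage_mem_nhds (by rwa [mul_one]))
  refine ⟨r, hr, fun η hη => ?_⟩
  simpa using hrU (show ξ⁻¹ * η ∈ closedHball 1 r by rwa [mem_closedHball, hdist_one])

/-! ### Lebesgue measure -/

theorem homDim_pos : 0 < homDim n := by unfold homDim; positivity

theorem measurePreserving_shear (a b : EuclideanSpace ℝ (Fin n))
    {g : EuclideanSpace ℝ (Fin n) → EuclideanSpace ℝ (Fin n) → ℝ}
    (hg : Measurable (Function.uncurry g)) :
    MeasurePreserving (fun ξ : Heis n => (a + ξ.1, b + ξ.2.1, g ξ.1 ξ.2.1 + ξ.2.2))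
      volume volume := by
  refine (measurePreserving_add_left volume a).skew_product
    (g := fun x (q : EuclideanSpace ℝ (Fin n) × ℝ) => (b + q.1, g x q.1 + q.2)) ?_
    (ae_of_all _ fun x => ?_)
  · exact (measurable_const.add (measurable_fst.comp measurable_snd)).prodMk
      ((hg.comp (measurable_fst.prodMk (measurable_fst.comp measurable_snd))).add
        (measurable_snd.comp measurable_snd))
  · have hx : Measurable fun q : EuclideanSpace ℝ (Fin n) × ℝ => g x q.1 + q.2 :=
      (hg.comp (measurable_const.prodMk measurable_fst)).add measurable_snd
    exact ((measurePreserving_add_left volume b).skew_product (g := fun y t => g x y + t) hx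
      (ae_of_all _ fun y => map_add_left_eq_self volume (g x y))).map_eq

instance : (volume : Measure (Heis n)).IsMulLeftInvariant where
  map_mul_left_eq_self ξ := by
    convert (measurePreserving_shear ξ.1 ξ.2.1
      (g := fun x y => ξ.2.2 + 2 * inner ℝ ξ.2.1 x - 2 * inner ℝ ξ.1 y)
      (by fun_prop)).map_eq using 2
    ext1 η
    simp only [mul_def, Prod.mk.injEq, true_and]
    ring

instance : (volume : Measure (Heis n)).IsMulRightInvariant where
  map_mul_right_eq_self ξ := by
    convert (measurePreserving_shear ξ.1 ξ.2.1
      (g := fun x y => ξ.2.2 + 2 * inner ℝ y ξ.1 - 2 * inner ℝ x ξ.2.1)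
      (by fun_prop)).map_eq using 2
    ext1 η
    simp only [mul_def, Prod.mk.injEq, add_comm, true_and]
    ring

instance : NullSingletonClass (volume : Measure (Heis n)) :=
  Measure.volume_eq_prod (EuclideanSpace ℝ (Fin n)) (EuclideanSpace ℝ (Fin n) × ℝ) ▸
    Measure.volume_eq_prod (EuclideanSpace ℝ (Fin n)) ℝ ▸ inferInstance

@[fun_prop]
theorem measurable_dilation (r : ℝ) : Measurable (dilation r : Heis n → Heis n) := by
  unfold dilation; fun_prop

theorem map_dilation_volume (hr : 0 < r) :
    Measure.map (dilation r) (volume : Measure (Heis n))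
      = ENNReal.ofReal (r ^ (-homDim n)) • volume := by
  have dilation_eq : (dilation r : Heis n → Heis n)
      = Prod.map (r • ·) (Prod.map (r • ·) ((r ^ 2) • ·)) := rfl
  have hpow : r ^ homDim n = r ^ (2 * n + 2) := by
    rw [← Real.rpow_natCast]; congr 1; simp [homDim]
  rw [dilation_eq, Measure.volume_eq_prod, Measure.volume_eq_prod,
    ← Measure.map_prod_map _ _ (by fun_prop) (by fun_prop),
    ← Measure.map_prod_map _ _ (by fun_prop) (by fun_prop),
    Measure.map_addHaar_smul _ hr.ne', Measure.map_addHaar_smul _ (pow_ne_zero 2 hr.ne')]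
  simp only [Measure.prod_smul_left, Measure.prod_smul_right, smul_smul]
  congr 1
  rw [← ENNReal.ofReal_mul (by positivity), ← ENNReal.ofReal_mul (by positivity),
    Real.rpow_neg hr.le, hpow, finrank_euclideanSpace, Fintype.card_fin, Module.finrank_self,
    abs_of_pos (by positivity), abs_of_pos (by positivity)]
  congr 1
  field_simp
  ring

theorem lintegral_dilation (hr : 0 < r) {F : Heis n → ℝ≥0∞} (hF : Measurable F) :
    ∫⁻ ξ, F (dilation r ξ) = ENNReal.ofReal (r ^ (-homDim n)) * ∫⁻ ξ, F ξ := by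
  rw [← lintegral_map hF (measurable_dilation r), map_dilation_volume hr, lintegral_smul_measure,
    smul_eq_mul]

theorem preimage_mul_left_hball (ξ η : Heis n) (r : ℝ) :
    (ξ * ·) ⁻¹' hball (ξ * η) r = hball η r := by
  ext ζ
  rw [mem_preimage, mem_hball, hdist_mul_left, mem_hball]

theorem preimage_dilation_hball_one (hr : 0 < r) :
    dilation r⁻¹ ⁻¹' hball (1 : Heis n) 1 = hball 1 r := by
  ext ξ
  rw [mem_preimage, mem_hball, mem_hball, hdist_one, hdist_one, hnorm_dilation (inv_pos.2 hr).le,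
    inv_mul_lt_iff₀ hr, mul_one]

theorem volume_hball_eq_volume_hball_one (ξ : Heis n) (r : ℝ) :
    volume (hball ξ r) = volume (hball (1 : Heis n) r) := by
  rw [← measure_preimage_mul volume ξ, ← preimage_mul_left_hball ξ 1, mul_one]

theorem volume_hball (ξ : Heis n) (hr : 0 < r) :
    volume (hball ξ r) = ENNReal.ofReal (r ^ homDim n) * volume (hball (1 : Heis n) 1) := by
  calc volume (hball ξ r) = volume (hball (1 : Heis n) r) := volume_hball_eq_volume_hball_one ξ r
    _ = Measure.map (dilation r⁻¹) volume (hball (1 : Heis n) 1) := by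
        rw [Measure.map_apply (measurable_dilation _) (measurableSet_hball _ _),
          preimage_dilation_hball_one hr]
    _ = ENNReal.ofReal (r ^ homDim n) * volume (hball (1 : Heis n) 1) := by
        rw [map_dilation_volume (inv_pos.2 hr), Measure.smul_apply, smul_eq_mul,
          Real.inv_rpow hr.le, Real.rpow_neg hr.le, inv_inv]

theorem volume_hball_lt_top (ξ : Heis n) (r : ℝ) : volume (hball ξ r) < ⊤ :=
  (measure_mono (hball_subset_closedHball ξ r)).trans_lt (isCompact_closedHball ξ r).measure_lt_top

theorem volume_hball_pos (ξ : Heis n) (hr : 0 < r) : 0 < volume (hball ξ r) :=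
  (isOpen_hball ξ r).measure_pos _ ⟨ξ, mem_hball_self hr⟩

end Heis
end

noncomputable section

namespace Heis

variable {n : ℕ} {s p q r L : ℝ}

/-! ### The singular kernel -/

/-- The closed dyadic annulus `r ≤ |h| ≤ 2r`. -/
def annulus (n : ℕ) (r : ℝ) : Set (Heis n) := {h | r ≤ hnorm h ∧ hnorm h ≤ 2 * r}

theorem measurableSet_annulus (r : ℝ) : MeasurableSet (annulus n r) :=
  (measurableSet_le measurable_const measurable_hnorm).inter
    (measurableSet_le measurable_hnorm measurable_const)

theorem volume_annulus_lt_top (r : ℝ) : volume (annulus n r) < ⊤ := by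
  refine (measure_mono fun h hh => ?_).trans_lt
    (isCompact_closedHball (1 : Heis n) (2 * r)).measure_lt_top
  rw [mem_closedHball, hdist_one]
  exact hh.2

theorem preimage_dilation_annulus (hr : 0 < r) :
    dilation r⁻¹ ⁻¹' annulus n 1 = annulus n r := by
  ext h
  simp only [annulus, mem_preimage, mem_ofPred_eq, hnorm_dilation (inv_pos.2 hr).le,
    ← div_eq_inv_mul, le_div_iff₀ hr, div_le_iff₀ hr, one_mul, mul_one]

theorem lintegral_annulus_hnorm_rpow (q : ℝ) (hr : 0 < r) :
    ∫⁻ h in annulus n r, ENNReal.ofReal (hnorm h ^ q)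
      = ENNReal.ofReal (r ^ (homDim n + q))
        * ∫⁻ h in annulus n 1, ENNReal.ofReal (hnorm h ^ q) := by
  have hr' := inv_pos.2 hr
  have scale : ∀ h : Heis n, ENNReal.ofReal (hnorm h ^ q)
      = ENNReal.ofReal (r ^ q) * ENNReal.ofReal (hnorm (dilation r⁻¹ h) ^ q) := fun h => by
    rw [hnorm_dilation hr'.le, ← ENNReal.ofReal_mul (by positivity),
      ← Real.mul_rpow hr.le (mul_nonneg hr'.le (hnorm_nonneg h)), mul_inv_cancel_left₀ hr.ne']
  calc ∫⁻ h in annulus n r, ENNReal.ofReal (hnorm h ^ q)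
      = ∫⁻ h, ENNReal.ofReal (r ^ q) * (annulus n 1).indicator
          (fun h => ENNReal.ofReal (hnorm h ^ q)) (dilation r⁻¹ h) := by
        rw [← lintegral_indicator (measurableSet_annulus r), ← preimage_dilation_annulus hr]
        refine lintegral_congr fun h => ?_
        by_cases hh : dilation r⁻¹ h ∈ annulus n 1
        · rw [indicator_of_mem (mem_preimage.2 hh), indicator_of_mem hh, scale]
        · rw [indicator_of_notMem (mt mem_preimage.1 hh), indicator_of_notMem hh, mul_zero]
    _ = _ := by
        have hF : Measurable ((annulus n 1).indicator fun h => ENNReal.ofReal (hnorm h ^ q)) :=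
          Measurable.indicator (by fun_prop) (measurableSet_annulus 1)
        rw [lintegral_const_mul _ (by fun_prop), lintegral_dilation hr' hF,
          lintegral_indicator (measurableSet_annulus 1), ← mul_assoc,
          ← ENNReal.ofReal_mul (by positivity), Real.inv_rpow hr.le, Real.rpow_neg hr.le, inv_inv,
          ← Real.rpow_add hr, add_comm q]

theorem lintegral_annulus_one_hnorm_rpow_lt_top (q : ℝ) :
    ∫⁻ h in annulus n 1, ENNReal.ofReal (hnorm h ^ q) < ⊤ := by
  have bound : ∀ h ∈ annulus n 1, hnorm h ^ q ≤ 2 ^ |q| := fun h ⟨h1, h2⟩ =>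
    (Real.rpow_le_rpow_of_exponent_le h1 (le_abs_self q)).trans
      (Real.rpow_le_rpow (hnorm_nonneg h) (by rwa [mul_one] at h2) (abs_nonneg q))
  refine (setLIntegral_mono' (measurableSet_annulus 1)
    fun h hh => ENNReal.ofReal_le_ofReal (bound h hh)).trans_lt ?_
  rw [setLIntegral_const]
  exact ENNReal.mul_lt_top ENNReal.ofReal_lt_top (volume_annulus_lt_top 1)

theorem lintegral_iUnion_annulus_hnorm_rpow_lt_top {b : ℝ} (hb : 0 < b)
    (hq : b ^ (homDim n + q) < 1) :
    ∫⁻ h in ⋃ j : ℕ, annulus n (b ^ j), ENNReal.ofReal (hnorm h ^ q) < ⊤ := by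
  refine (lintegral_iUnion_le _ _).trans_lt ?_
  have geometric : ∀ j : ℕ, ENNReal.ofReal ((b ^ j) ^ (homDim n + q))
      = ENNReal.ofReal (b ^ (homDim n + q)) ^ j := fun j => by
    rw [← ENNReal.ofReal_pow (by positivity), ← Real.rpow_natCast, ← Real.rpow_mul hb.le,
      mul_comm, Real.rpow_mul hb.le, Real.rpow_natCast]
  simp_rw [lintegral_annulus_hnorm_rpow q (pow_pos hb _), geometric]
  rw [ENNReal.tsum_mul_right, ENNReal.tsum_geometric]
  refine ENNReal.mul_lt_top (ENNReal.inv_lt_top.2 (tsub_pos_of_lt ?_))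
    (lintegral_annulus_one_hnorm_rpow_lt_top q)
  rwa [← ENNReal.ofReal_one, ENNReal.ofReal_lt_ofReal_iff one_pos]

theorem lintegral_hnorm_rpow_compl_hball_lt_top (hq : q < -homDim n) :
    ∫⁻ h in (hball (1 : Heis n) 1)ᶜ, ENNReal.ofReal (hnorm h ^ q) < ⊤ := by
  refine (lintegral_mono_set fun h hh => ?_).trans_lt
    (lintegral_iUnion_annulus_hnorm_rpow_lt_top two_pos
      (Real.rpow_lt_one_of_one_lt_of_neg one_lt_two (by linarith)))
  rw [mem_compl_iff, mem_hball, hdist_one, not_lt] at hh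
  obtain ⟨j, hj, hj'⟩ := exists_nat_pow_near hh one_lt_two
  exact mem_iUnion.2 ⟨j, hj, by rw [← pow_succ']; exact hj'.le⟩

theorem lintegral_hnorm_rpow_hball_lt_top (hq : -homDim n < q) :
    ∫⁻ h in hball (1 : Heis n) 1, ENNReal.ofReal (hnorm h ^ q) < ⊤ := by
  have half_pos : (0 : ℝ) < 2⁻¹ := by norm_num
  have sub : hball (1 : Heis n) 1 \ {1} ⊆ ⋃ j : ℕ, annulus n (2⁻¹ ^ j) := fun h hh => by
    have hh1 : hnorm h < 1 := by simpa only [mem_hball, hdist_one] using hh.1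
    obtain ⟨j, hj, hj'⟩ := exists_nat_pow_near_of_lt_one (hnorm_pos hh.2) hh1.le half_pos
      (by norm_num)
    refine mem_iUnion.2 ⟨j + 1, hj.le, hj'.trans_eq ?_⟩
    rw [pow_succ']; ring
  rw [← setLIntegral_congr (sdiff_null_ae_eq_self (measure_singleton (1 : Heis n)))]
  exact (lintegral_mono_set sub).trans_lt (lintegral_iUnion_annulus_hnorm_rpow_lt_top half_pos
    (Real.rpow_lt_one half_pos.le (by norm_num) (by linarith)))

/-- The kernel `min(1, L|h|)^p |h|^(-(Q + sp))`, which governs the fractional energy of a bounded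
function of Lipschitz constant `L`. -/
def cutKernel (s p L : ℝ) (h : Heis n) : ℝ≥0∞ :=
  ENNReal.ofReal (min 1 (L * hnorm h) ^ p * hnorm h ^ (-(homDim n + s * p)))

@[fun_prop]
theorem measurable_cutKernel (s p L : ℝ) : Measurable (cutKernel s p L : Heis n → ℝ≥0∞) := by
  unfold cutKernel
  fun_prop

theorem lintegral_cutKernel_one_lt_top (hs : 0 < s) (hs1 : s < 1) (hp : 0 < p) :
    ∫⁻ h : Heis n, cutKernel s p 1 h < ⊤ := by
  rw [← lintegral_add_compl _ (measurableSet_hball 1 1)]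
  refine ENNReal.add_lt_top.2 ⟨?_, ?_⟩
  · refine (setLIntegral_mono' (measurableSet_hball 1 1) fun h _ => ENNReal.ofReal_le_ofReal
      ?_).trans_lt (lintegral_hnorm_rpow_hball_lt_top (n := n)
        (q := p - (homDim n + s * p)) (by nlinarith))
    rcases (hnorm_nonneg h).eq_or_lt with h0 | h0
    · rw [← h0, mul_zero, min_eq_right zero_le_one, Real.zero_rpow hp.ne', zero_mul]
      exact Real.rpow_nonneg le_rfl _
    · rw [sub_eq_add_neg, Real.rpow_add h0, one_mul]
      gcongr
      exact min_le_right _ _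
  · refine (setLIntegral_mono' (measurableSet_hball 1 1).compl fun h _ =>
      ENNReal.ofReal_le_ofReal ?_).trans_lt (lintegral_hnorm_rpow_compl_hball_lt_top (n := n)
        (q := -(homDim n + s * p)) (by nlinarith))
    have h0 := hnorm_nonneg h
    exact mul_le_of_le_one_left (by positivity)
      (Real.rpow_le_one (by positivity) (min_le_left _ _) hp.le)

theorem lintegral_cutKernel (s p : ℝ) (hL : 0 < L) :
    ∫⁻ h : Heis n, cutKernel s p L h
      = ENNReal.ofReal (L ^ (s * p)) * ∫⁻ h : Heis n, cutKernel s p 1 h := by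
  have scale : ∀ h : Heis n, cutKernel s p L h
      = ENNReal.ofReal (L ^ (homDim n + s * p)) * cutKernel s p 1 (dilation L h) := fun h => by
    have cancel : L ^ (homDim n + s * p) * L ^ (-(homDim n + s * p)) = 1 := by
      rw [← Real.rpow_add hL, add_neg_cancel, Real.rpow_zero]
    unfold cutKernel
    rw [hnorm_dilation hL.le, ← ENNReal.ofReal_mul (by positivity), one_mul,
      Real.mul_rpow hL.le (hnorm_nonneg h), mul_left_comm, ← mul_assoc (L ^ _) (L ^ _), cancel,
      one_mul]
  simp_rw [scale]
  rw [lintegral_const_mul _ (by fun_prop), lintegral_dilation hL (by fun_prop), ← mul_assoc,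
    ← ENNReal.ofReal_mul (by positivity), ← Real.rpow_add hL]
  congr 3
  ring

/-- The singular kernel `|η⁻¹ ∘ ξ|^(-q)`. At `ξ = η` its value is the junk value of `0 ^ (-q)`;
the diagonal is a null set. -/
def kern (q : ℝ) (ξ η : Heis n) : ℝ≥0∞ := ENNReal.ofReal (hdist η ξ ^ (-q))

theorem kern_comm (q : ℝ) (ξ η : Heis n) : kern q ξ η = kern q η ξ := by
  unfold kern
  rw [hdist_comm]

@[fun_prop]
theorem measurable_kern {X : Type*} [MeasurableSpace X] {q : ℝ} {f g : X → Heis n}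
    (hf : Measurable f) (hg : Measurable g) : Measurable fun x => kern q (f x) (g x) := by
  unfold kern
  fun_prop

theorem lintegral_kern_compl_hball_le (s p : ℝ) (ξ : Heis n) (hr : 0 < r) :
    ∫⁻ η in (hball ξ r)ᶜ, kern (homDim n + s * p) η ξ
      ≤ ENNReal.ofReal (r ^ (-(s * p))) * ∫⁻ h : Heis n, cutKernel s p 1 h := by
  calc ∫⁻ η in (hball ξ r)ᶜ, kern (homDim n + s * p) η ξ
      ≤ ∫⁻ η in (hball ξ r)ᶜ, cutKernel s p r⁻¹ (ξ⁻¹ * η) := by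
        refine setLIntegral_mono' (measurableSet_hball ξ r).compl fun η hη => ?_
        have far : 1 ≤ r⁻¹ * hnorm (ξ⁻¹ * η) := by
          rw [← div_eq_inv_mul, one_le_div hr]
          exact not_lt.1 hη
        unfold cutKernel kern
        rw [min_eq_left far, Real.one_rpow, one_mul, hdist]
    _ ≤ ∫⁻ η, cutKernel s p r⁻¹ (ξ⁻¹ * η) := setLIntegral_le_lintegral _ _
    _ = _ := by
        rw [lintegral_mul_left_eq_self (fun η => cutKernel s p r⁻¹ η),
          lintegral_cutKernel s p (inv_pos.2 hr), Real.inv_rpow hr.le, Real.rpow_neg hr.le]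

/-! ### Functions comparable with the standard homogeneous norm -/

/-- `d` is a measurable function on the Heisenberg group comparable with the standard homogeneous
norm. This is the only property of a homogeneous norm that the kernel `d ^ (-(Q + sp))` needs. -/
structure IsComparable (d : Heis n → ℝ) : Prop where
  measurable : Measurable d
  exists_le : ∃ c, 0 < c ∧ ∀ h, c * hnorm h ≤ d h
  exists_ge : ∃ C, 0 < C ∧ ∀ h, d h ≤ C * hnorm h

theorem isCompact_unit_hnorm : IsCompact {h : Heis n | hnorm h = 1} :=
  (isCompact_closedHball (1 : Heis n) 1).of_isClosed_subset
    (isClosed_eq continuous_hnorm continuous_const) fun h hh => by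
      rw [mem_closedHball, hdist_one]; exact le_of_eq hh

theorem IsHomogeneousNorm.exists_unit_eq_mul {d : Heis n → ℝ} (hd : IsHomogeneousNorm d)
    {h : Heis n} (hh : h ≠ 1) : ∃ e, hnorm e = 1 ∧ d h = d e * hnorm h := by
  have hpos := hnorm_pos hh
  refine ⟨Heis.dilation (hnorm h)⁻¹ h, ?_, ?_⟩
  · rw [hnorm_dilation (inv_pos.2 hpos).le, inv_mul_cancel₀ hpos.ne']
  · rw [hd.dilation _ (inv_pos.2 hpos), mul_comm, mul_inv_cancel_left₀ hpos.ne']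

theorem IsHomogeneousNorm.isComparable {d : Heis n → ℝ} (hd : IsHomogeneousNorm d) :
    IsComparable d := by
  have unit_nonempty : {h : Heis n | hnorm h = 1}.Nonempty := ⟨(0, 0, 1), by simp [hnorm]⟩
  have d_one : d 1 = 0 := (hd.eq_zero_iff 1).2 rfl
  have d_pos : ∀ h : Heis n, hnorm h = 1 → 0 < d h := fun h hh =>
    (hd.nonneg h).lt_of_ne' fun h0 => by
      rw [(hd.eq_zero_iff h).1 h0, ← one_eq_zero, hnorm_one] at hh
      exact zero_ne_one hh
  obtain ⟨a, ha, hmin⟩ := isCompact_unit_hnorm.exists_isMinOn unit_nonempty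
    hd.continuous.continuousOn
  obtain ⟨b, hb, hmax⟩ := isCompact_unit_hnorm.exists_isMaxOn unit_nonempty
    hd.continuous.continuousOn
  refine ⟨hd.continuous.measurable, ⟨d a, d_pos a ha, fun h => ?_⟩,
    ⟨d b, d_pos b hb, fun h => ?_⟩⟩ <;>
  rcases eq_or_ne h 1 with rfl | hh
  · rw [hnorm_one, mul_zero, d_one]
  · obtain ⟨e, he, h_eq⟩ := hd.exists_unit_eq_mul hh
    exact h_eq ▸ mul_le_mul_of_nonneg_right (hmin he) (hnorm_nonneg h)
  · rw [hnorm_one, mul_zero, d_one]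
  · obtain ⟨e, he, h_eq⟩ := hd.exists_unit_eq_mul hh
    exact h_eq ▸ mul_le_mul_of_nonneg_right (hmax he) (hnorm_nonneg h)

end Heis
end

noncomputable section

/-! ### Averages over measure preserving actions -/

section Average

variable {G X ι E : Type*} [NormedAddCommGroup E]

theorem lintegral_enorm_rpow_eq_eLpNorm_rpow [MeasurableSpace X] {μ : Measure X} {p : ℝ}
    (hp : 0 < p) (f : X → E) :
    ∫⁻ x, ‖f x‖ₑ ^ p ∂μ = eLpNorm f (ENNReal.ofReal p) μ ^ p := by
  rw [eLpNorm_eq_lintegral_rpow_enorm_toReal (by simpa using hp) ENNReal.ofReal_ne_top,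
    ENNReal.toReal_ofReal hp.le, ← ENNReal.rpow_mul, one_div, inv_mul_cancel₀ hp.ne',
    ENNReal.rpow_one]

theorem integrable_of_lintegral_enorm_rpow_lt_top [MeasurableSpace G] {ν : Measure G}
    [IsFiniteMeasure ν] {f : G → E} (hf : AEStronglyMeasurable f ν) {p : ℝ} (hp : 1 ≤ p)
    (h : ∫⁻ g, ‖f g‖ₑ ^ p ∂ν < ⊤) : Integrable f ν := by
  have hp0 : 0 < p := by linarith
  rw [lintegral_enorm_rpow_eq_eLpNorm_rpow hp0, ENNReal.rpow_lt_top_iff_of_pos hp0] at h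
  exact MemLp.integrable (by simpa using hp) ⟨hf, h⟩

theorem enorm_integral_rpow_le [NormedSpace ℝ E] [MeasurableSpace G] {ν : Measure G}
    [IsProbabilityMeasure ν] {f : G → E} (hf : AEStronglyMeasurable f ν) {p : ℝ} (hp : 1 ≤ p) :
    ‖∫ g, f g ∂ν‖ₑ ^ p ≤ ∫⁻ g, ‖f g‖ₑ ^ p ∂ν := by
  rw [lintegral_enorm_rpow_eq_eLpNorm_rpow (by linarith)]
  gcongr
  calc ‖∫ g, f g ∂ν‖ₑ ≤ eLpNorm f 1 ν := by
        rw [eLpNorm_one_eq_lintegral_enorm]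
        exact enorm_integral_le_lintegral_enorm _
    _ ≤ eLpNorm f (ENNReal.ofReal p) ν :=
        eLpNorm_le_eLpNorm_of_exponent_le (by simpa using hp) hf

theorem tendsto_eLpNorm_comp_sub [TopologicalSpace G] [TopologicalSpace X] [MeasurableSpace X]
    [BorelSpace X] [R1Space X] {μ : Measure X} [μ.InnerRegularCompactLTTop]
    [IsLocallyFiniteMeasure μ] {τ : G → X → X} (hτ : Continuous (Function.uncurry τ))
    (hmp : ∀ g, MeasurePreserving (τ g) μ μ) {g₀ : G} (h₀ : ∀ x, τ g₀ x = x)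
    {q : ℝ≥0∞} (hq : 1 ≤ q) (hq' : q ≠ ⊤) {F : X → E} (hF : MemLp F q μ) :
    Tendsto (fun g => eLpNorm (fun x => F (τ g x) - F x) q μ) (𝓝 g₀) (𝓝 0) := by
  have : Fact (1 ≤ q) := ⟨hq⟩
  let T : C(G, C(X, X)) := ContinuousMap.curry ⟨Function.uncurry τ, hτ⟩
  have hT : ∀ g, MeasurePreserving (T g) μ μ := hmp
  have tendsto_Lp := (tendsto_const_nhds (x := hF.toLp F) (f := 𝓝 g₀)).compMeasurePreservingLp
    (T.continuous.tendsto g₀) hT (hT g₀) hq'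
  rw [tendsto_iff_edist_tendsto_0] at tendsto_Lp
  refine tendsto_Lp.congr fun g => ?_
  rw [Lp.edist_def]
  refine eLpNorm_congr_ae ?_
  filter_upwards [Lp.coeFn_compMeasurePreserving (hF.toLp F) (hT g),
    Lp.coeFn_compMeasurePreserving (hF.toLp F) (hT g₀),
    (hT g).quasiMeasurePreserving.ae_eq_comp hF.coeFn_toLp,
    (hT g₀).quasiMeasurePreserving.ae_eq_comp hF.coeFn_toLp] with x h1 h2 h3 h4
  rw [Pi.sub_apply, h1, h2, h3, h4]
  exact congrArg (fun y => F (τ g x) - F y) (h₀ x)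

theorem eLpNorm_integral_comp_sub_rpow_le [NormedSpace ℝ E] [CompleteSpace E] [MeasurableSpace G]
    [MeasurableSpace X] {μ : Measure X} [SFinite μ] {τ : G → X → X}
    (hτ : Measurable (Function.uncurry τ)) (hmp : ∀ g, MeasurePreserving (τ g) μ μ)
    {p : ℝ} (hp : 1 ≤ p) {F : X → E} (hFm : StronglyMeasurable F)
    (hF : MemLp F (ENNReal.ofReal p) μ) (ν : Measure G) [IsProbabilityMeasure ν] :
    eLpNorm (fun x => ∫ g, F (τ g x) ∂ν - F x) (ENNReal.ofReal p) μ ^ p ≤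
      ∫⁻ g, eLpNorm (fun x => F (τ g x) - F x) (ENNReal.ofReal p) μ ^ p ∂ν := by
  have hp0 : 0 < p := by linarith
  have hFτ : StronglyMeasurable fun z : X × G => F (τ z.2 z.1) :=
    hFm.comp_measurable (hτ.comp measurable_swap)
  have hFτx : ∀ x, StronglyMeasurable fun g => F (τ g x) := fun x =>
    hFτ.comp_measurable measurable_prodMk_left
  have finite : ∫⁻ x, ∫⁻ g, ‖F (τ g x)‖ₑ ^ p ∂ν ∂μ < ⊤ := by
    have inner : ∀ g, ∫⁻ x, ‖F (τ g x)‖ₑ ^ p ∂μ = eLpNorm F (ENNReal.ofReal p) μ ^ p := fun g =>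
      ((hmp g).lintegral_comp (f := fun x => ‖F x‖ₑ ^ p) (hFm.enorm.pow_const p)).trans
        (lintegral_enorm_rpow_eq_eLpNorm_rpow hp0 F)
    rw [lintegral_lintegral_swap (f := fun x g => ‖F (τ g x)‖ₑ ^ p)
      (hFτ.enorm.pow_const p).aemeasurable]
    simp_rw [inner, lintegral_const, measure_univ, mul_one]
    exact ENNReal.rpow_lt_top_of_nonneg hp0.le hF.2.ne
  have hdiff : StronglyMeasurable fun z : X × G => F (τ z.2 z.1) - F z.1 :=
    hFτ.sub (hFm.comp_measurable measurable_fst)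
  simp_rw [← lintegral_enorm_rpow_eq_eLpNorm_rpow hp0]
  rw [← lintegral_lintegral_swap (f := fun x g => ‖F (τ g x) - F x‖ₑ ^ p)
    (hdiff.enorm.pow_const p).aemeasurable]
  refine lintegral_mono_ae ?_
  filter_upwards [ae_lt_top (hFτ.enorm.pow_const p).lintegral_prod_right'
    finite.ne] with x hx
  have integrable_orbit : Integrable (fun g => F (τ g x)) ν :=
    integrable_of_lintegral_enorm_rpow_lt_top (hFτx x).aestronglyMeasurable hp hx
  have integral_diff : ∫ g, F (τ g x) ∂ν - F x = ∫ g, (F (τ g x) - F x) ∂ν := by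
    rw [integral_sub integrable_orbit (integrable_const _), integral_const, probReal_univ,
      one_smul]
  rw [integral_diff]
  exact enorm_integral_rpow_le ((hFτx x).sub stronglyMeasurable_const).aestronglyMeasurable hp

theorem tendsto_eLpNorm_average_sub [NormedSpace ℝ E] [CompleteSpace E] [TopologicalSpace G]
    [MeasurableSpace G] [TopologicalSpace X] [MeasurableSpace X] [BorelSpace X] [R1Space X]
    {μ : Measure X} [μ.InnerRegularCompactLTTop] [IsLocallyFiniteMeasure μ] [SFinite μ]
    {τ : G → X → X} (hτ : Continuous (Function.uncurry τ)) (hτm : Measurable (Function.uncurry τ))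
    (hmp : ∀ g, MeasurePreserving (τ g) μ μ) {g₀ : G} (h₀ : ∀ x, τ g₀ x = x)
    {p : ℝ} (hp : 1 ≤ p) {F : X → E} (hFm : StronglyMeasurable F)
    (hF : MemLp F (ENNReal.ofReal p) μ) {l : Filter ι} {ν : ι → Measure G}
    [∀ i, IsProbabilityMeasure (ν i)] (hν : ∀ N ∈ 𝓝 g₀, ∀ᶠ i in l, ∀ᵐ g ∂(ν i), g ∈ N) :
    Tendsto (fun i => eLpNorm (fun x => ∫ g, F (τ g x) ∂(ν i) - F x) (ENNReal.ofReal p) μ) l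
      (𝓝 0) := by
  have hp0 : 0 < p := by linarith
  have small := tendsto_eLpNorm_comp_sub hτ hmp h₀ (by simpa using hp) ENNReal.ofReal_ne_top hF
  rw [ENNReal.tendsto_nhds_zero] at small ⊢
  intro ε hε
  filter_upwards [hν _ (small ε hε)] with i hi
  refine (ENNReal.rpow_le_rpow_iff hp0).1 ?_
  calc eLpNorm (fun x => ∫ g, F (τ g x) ∂(ν i) - F x) (ENNReal.ofReal p) μ ^ p
      ≤ ∫⁻ g, eLpNorm (fun x => F (τ g x) - F x) (ENNReal.ofReal p) μ ^ p ∂(ν i) :=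
        eLpNorm_integral_comp_sub_rpow_le hτm hmp hp hFm hF (ν i)
    _ ≤ ∫⁻ _, ε ^ p ∂(ν i) :=
        lintegral_mono_ae (hi.mono fun g hg => ENNReal.rpow_le_rpow hg hp0.le)
    _ = ε ^ p := by rw [lintegral_const, measure_univ, mul_one]

end Average

/-! ### Elementary inequalities -/

section Elementary

variable {p a b a₁ a₂ w₁ w₂ : ℝ}

theorem rpow_sub_rpow_le_mul_sub (ha : 0 ≤ a) (hab : a ≤ b) (hp : 1 ≤ p) :
    b ^ p - a ^ p ≤ p * b ^ (p - 1) * (b - a) := by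
  rcases (ha.trans hab).eq_or_lt with rfl | hb
  · simp [le_antisymm hab ha]
  have bernoulli := one_add_mul_self_le_rpow_one_add (s := a / b - 1)
    (by linarith [div_nonneg ha hb.le]) hp
  rw [add_sub_cancel, Real.div_rpow ha hb.le, le_div_iff₀ (by positivity)] at bernoulli
  rw [Real.rpow_sub_one hb.ne']
  have expand : (1 + p * (a / b - 1)) * b ^ p = b ^ p - p * (b ^ p / b) * (b - a) := by
    field_simp
    ring
  linarith

theorem mul_sub_le_of_mul_rpow_le (hp : 1 ≤ p) (hw₁ : 0 < w₁) (ha₁ : 0 ≤ a₁) (ha₂ : 0 < a₂)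
    (h : w₁ * a₁ ^ p ≤ w₂ * a₂ ^ p) : a₂ * (w₁ - w₂) ≤ p * w₁ * (a₂ - a₁) := by
  have bernoulli := one_add_mul_self_le_rpow_one_add (s := a₁ / a₂ - 1)
    (by linarith [div_nonneg ha₁ ha₂.le]) hp
  rw [add_sub_cancel, Real.div_rpow ha₁ ha₂.le] at bernoulli
  have ratio : a₁ ^ p / a₂ ^ p ≤ w₂ / w₁ := by
    rw [div_le_div_iff₀ (by positivity) hw₁]
    linarith
  have scaled : (1 + p * (a₁ / a₂ - 1)) * (a₂ * w₁) ≤ w₂ / w₁ * (a₂ * w₁) :=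
    mul_le_mul_of_nonneg_right (bernoulli.trans ratio) (by positivity)
  have lhs_eq : (1 + p * (a₁ / a₂ - 1)) * (a₂ * w₁) = a₂ * w₁ - p * w₁ * (a₂ - a₁) := by
    field_simp
    ring
  have rhs_eq : w₂ / w₁ * (a₂ * w₁) = a₂ * w₂ := by field_simp
  linarith

/-- This absorbs the cutoff in the Caccioppoli inequality: the weight `a₂ ^ p` may be traded for
`a₁ ^ p` at the cost of the `p`-th power of the increment. -/
theorem sub_rpow_mul_sub_le (hp : 1 < p) (hw₂ : 0 ≤ w₂) (hw : w₂ ≤ w₁) (ha₁ : 0 ≤ a₁)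
    (ha₂ : 0 ≤ a₂) :
    (w₁ - w₂) ^ (p - 1) * (w₂ * a₂ ^ p - w₁ * a₁ ^ p) ≤ p ^ p * (w₁ ^ p * |a₂ - a₁| ^ p) := by
  have hp0 : 0 < p := by linarith
  have hw₁ : 0 ≤ w₁ := hw₂.trans hw
  rcases le_or_gt (w₂ * a₂ ^ p) (w₁ * a₁ ^ p) with h | h
  · exact (mul_nonpos_of_nonneg_of_nonpos (Real.rpow_nonneg (by linarith) _) (by linarith)).trans
      (by positivity)
  rcases hw.eq_or_lt with rfl | hw'
  · rw [sub_self, Real.zero_rpow (by linarith), zero_mul]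
    positivity
  have hw₁' : 0 < w₁ := hw₂.trans_lt hw'
  have haa : a₁ < a₂ := lt_of_not_ge fun hle => h.not_ge
    (mul_le_mul hw (Real.rpow_le_rpow ha₂ hle hp0.le) (by positivity) hw₁)
  have ha₂' : 0 < a₂ := ha₁.trans_lt haa
  have hD : 0 < a₂ - a₁ := sub_pos.2 haa
  have hX : 0 < w₁ - w₂ := sub_pos.2 hw'
  have increment : w₂ * a₂ ^ p - w₁ * a₁ ^ p ≤ w₁ * (p * a₂ ^ (p - 1) * (a₂ - a₁)) := by
    have hw₁₂ : w₂ * a₂ ^ p ≤ w₁ * a₂ ^ p := by gcongr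
    nlinarith [rpow_sub_rpow_le_mul_sub ha₁ haa.le hp.le]
  rw [abs_of_pos hD]
  calc (w₁ - w₂) ^ (p - 1) * (w₂ * a₂ ^ p - w₁ * a₁ ^ p)
      ≤ (w₁ - w₂) ^ (p - 1) * (w₁ * (p * a₂ ^ (p - 1) * (a₂ - a₁))) := by gcongr
    _ = p * w₁ * (a₂ - a₁) * (a₂ * (w₁ - w₂)) ^ (p - 1) := by
        rw [Real.mul_rpow ha₂ hX.le]; ring
    _ ≤ p * w₁ * (a₂ - a₁) * (p * w₁ * (a₂ - a₁)) ^ (p - 1) := by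
        refine mul_le_mul_of_nonneg_left (Real.rpow_le_rpow (by positivity)
          (mul_sub_le_of_mul_rpow_le hp.le hw₁' ha₁ ha₂' h.le) (by linarith)) (by positivity)
    _ = (p * w₁ * (a₂ - a₁)) ^ p := by
        rw [Real.rpow_sub_one (by positivity)]; field_simp
    _ = p ^ p * (w₁ ^ p * (a₂ - a₁) ^ p) := by
        rw [Real.mul_rpow (by positivity) hD.le, Real.mul_rpow hp0.le hw₁, mul_assoc]

end Elementary

end

noncomputable section

namespace Heis

variable {n : ℕ}

instance : SigmaFinite ((volume : Measure (Heis n)).prod (volume : Measure (Heis n))) :=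
  Measure.prod.instSigmaFinite

instance :
    ((volume : Measure (Heis n)).prod (volume : Measure (Heis n))).InnerRegularCompactLTTop :=
  (Measure.Regular.of_sigmaCompactSpace_of_isLocallyFiniteMeasure _).instInnerRegularCompactLTTop

/-! ### Mollification by left translations -/

/-- The average of the left translates of `ψ` against the weight `ρ`. Left translations are used
because they preserve the kernel `|η⁻¹ ∘ ξ|`. -/
def mollify (ρ ψ : Heis n → ℝ) (ξ : Heis n) : ℝ := ∫ ζ, ρ ζ * ψ (ζ * ξ)

theorem mollify_eq_integral_mul_inv (ρ ψ : Heis n → ℝ) (ξ : Heis n) :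
    mollify ρ ψ ξ = ∫ ζ, ψ ζ * ρ (ζ * ξ⁻¹) := by
  unfold mollify
  rw [← integral_mul_right_eq_self _ ξ⁻¹]
  simp_rw [inv_mul_cancel_right, mul_comm]

open scoped Convolution in
theorem contDiff_mollify {ρ ψ : Heis n → ℝ} (hρ : ContDiff ℝ ∞ ρ) (hρc : HasCompactSupport ρ)
    (hψ : Integrable ψ) : ContDiff ℝ ∞ (mollify ρ ψ) := by
  rw [contDiff_iff_contDiffAt]
  intro ξ₀
  -- With `g ξ x = ρ((-x) ∘ ξ⁻¹)`, the mollification at `ξ` is a Euclidean convolution at `0`.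
  let g : Heis n → Heis n → ℝ := fun ξ x => ρ (-x * ξ⁻¹)
  have mollify_eq : (fun ξ => (ψ ⋆[ContinuousLinearMap.mul ℝ ℝ, volume] g ξ) (0 : Heis n))
      = mollify ρ ψ := by
    ext ξ
    simp [mollify_eq_integral_mul_inv, convolution, g]
  have compact : IsCompact ((fun z : Heis n × Heis n => -(z.1 * z.2)) ''
      (tsupport ρ ×ˢ closedHball ξ₀ 1)) :=
    (hρc.isCompact.prod (isCompact_closedHball ξ₀ 1)).image continuous_mul.neg
  have contDiffOn : ContDiffOn ℝ ∞
      (fun ξ => (ψ ⋆[ContinuousLinearMap.mul ℝ ℝ, volume] g ξ) (0 : Heis n)) (hball ξ₀ 1) := by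
    refine contDiffOn_convolution_right_with_param_comp (n := (⊤ : ℕ∞)) _ contDiffOn_const
      (isOpen_hball ξ₀ 1) compact (fun ξ x hξ hx => ?_) hψ.locallyIntegrable
      (hρ.comp (contDiff_mul.comp
        (contDiff_snd.neg.prodMk (contDiff_inv.comp contDiff_fst)))).contDiffOn
    by_contra hne
    exact hx ⟨(-x * ξ⁻¹, ξ), ⟨subset_tsupport ρ hne, hball_subset_closedHball _ _ hξ⟩,
      by simp only [inv_mul_cancel_right, neg_neg]⟩
  rw [mollify_eq] at contDiffOn
  exact contDiffOn.contDiffAt (hball_mem_nhds one_pos)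

theorem mollify_nonneg {ρ ψ : Heis n → ℝ} (hρ : ∀ ζ, 0 ≤ ρ ζ) (hψ : ∀ ξ, 0 ≤ ψ ξ) (ξ : Heis n) :
    0 ≤ mollify ρ ψ ξ :=
  integral_nonneg fun ζ => mul_nonneg (hρ ζ) (hψ _)

/-- A sequence of smooth bumps shrinking to the neutral element. -/
def bumpSeq (n : ℕ) (i : ℕ) : ContDiffBump (0 : Heis n) where
  rIn := 1 / (i + 1) / 2
  rOut := 1 / (i + 1)
  rIn_pos := by positivity
  rIn_lt_rOut := half_lt_self (by positivity)

/-- The bumps `bumpSeq` normalized to have integral one. -/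
def mollifier (n : ℕ) (i : ℕ) : Heis n → ℝ := (bumpSeq n i).normed volume

/-- The probability measure with density `mollifier`. -/
def mollMeasure (n : ℕ) (i : ℕ) : Measure (Heis n) :=
  volume.withDensity fun ζ => ENNReal.ofReal (mollifier n i ζ)

theorem mollifier_nonneg (i : ℕ) (ζ : Heis n) : 0 ≤ mollifier n i ζ :=
  (bumpSeq n i).nonneg_normed ζ

theorem contDiff_mollifier (i : ℕ) : ContDiff ℝ ∞ (mollifier n i) :=
  (bumpSeq n i).contDiff_normed

theorem hasCompactSupport_mollifier (i : ℕ) : HasCompactSupport (mollifier n i) :=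
  (bumpSeq n i).hasCompactSupport_normed

theorem measurable_mollifier (i : ℕ) : Measurable (mollifier n i) :=
  (contDiff_mollifier i).continuous.measurable

instance (i : ℕ) : IsProbabilityMeasure (mollMeasure n i) where
  measure_univ := by
    have integrable : Integrable (mollifier n i) := (bumpSeq n i).integrable_normed
    have integral_eq_one : ∫ ζ, mollifier n i ζ = 1 := (bumpSeq n i).integral_normed
    rw [mollMeasure, withDensity_apply _ MeasurableSet.univ, setLIntegral_univ,
      ← ofReal_integral_eq_lintegral_ofReal integrable (ae_of_all _ (mollifier_nonneg i)),
      integral_eq_one, ENNReal.ofReal_one]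

theorem eventually_mollifier_eq_zero {U : Set (Heis n)} (hU : U ∈ 𝓝 (1 : Heis n)) :
    ∀ᶠ i in atTop, ∀ ζ, ζ ∉ U → mollifier n i ζ = 0 := by
  obtain ⟨ε, hε, ball_subset⟩ := Metric.mem_nhds_iff.1 hU
  filter_upwards [(tendsto_one_div_add_atTop_nhds_zero_nat (𝕜 := ℝ)).eventually_lt_const hε]
    with i hi ζ hζ
  by_contra hne
  have mem_support : ζ ∈ Function.support ((bumpSeq n i).normed volume) := hne
  rw [(bumpSeq n i).support_normed_eq] at mem_support
  exact hζ (ball_subset (Metric.ball_subset_ball hi.le mem_support))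

theorem eventually_ae_mollMeasure_mem {U : Set (Heis n)} (hU : U ∈ 𝓝 (1 : Heis n)) :
    ∀ᶠ i in atTop, ∀ᵐ ζ ∂(mollMeasure n i), ζ ∈ U := by
  filter_upwards [eventually_mollifier_eq_zero hU] with i hi
  rw [mollMeasure, ae_withDensity_iff (measurable_mollifier i).ennreal_ofReal]
  refine ae_of_all _ fun ζ => not_imp_comm.1 fun hζ => ?_
  rw [hi ζ hζ, ENNReal.ofReal_zero]

theorem integral_mollMeasure (i : ℕ) (F : Heis n → ℝ) :
    ∫ ζ, F ζ ∂(mollMeasure n i) = ∫ ζ, mollifier n i ζ * F ζ := by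
  rw [mollMeasure, integral_withDensity_eq_integral_toReal_smul
    (measurable_mollifier i).ennreal_ofReal (ae_of_all _ fun _ => ENNReal.ofReal_lt_top)]
  simp only [ENNReal.toReal_ofReal (mollifier_nonneg i _), smul_eq_mul]

theorem integrable_mollifier_mul {ψ : Heis n → ℝ} (hψ : Integrable ψ) (i : ℕ) :
    Integrable fun ζ => mollifier n i ζ * ψ ζ := by
  obtain ⟨C, hC⟩ := (contDiff_mollifier (n := n) i).continuous.bounded_above_of_compact_support
    (hasCompactSupport_mollifier i)
  exact hψ.bdd_mul (measurable_mollifier i).aestronglyMeasurable (ae_of_all _ hC)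

theorem mollify_sub_mollify {ψ : Heis n → ℝ} (hψ : Integrable ψ) (i : ℕ) (ξ η : Heis n) :
    mollify (mollifier n i) ψ ξ - mollify (mollifier n i) ψ η
      = ∫ ζ, (ψ (ζ * ξ) - ψ (ζ * η)) ∂(mollMeasure n i) := by
  rw [integral_mollMeasure, mollify, mollify, ← integral_sub
    (integrable_mollifier_mul (hψ.comp_mul_right ξ) i)
    (integrable_mollifier_mul (hψ.comp_mul_right η) i)]
  simp_rw [mul_sub]

theorem tendsto_eLpNorm_mollify_sub {p : ℝ} (hp : 1 ≤ p) {ψ : Heis n → ℝ} (hψm : Measurable ψ)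
    (hψ : MemLp ψ (ENNReal.ofReal p)) :
    Tendsto (fun i => eLpNorm (fun ξ => mollify (mollifier n i) ψ ξ - ψ ξ)
      (ENNReal.ofReal p) volume) atTop (𝓝 0) := by
  simpa only [integral_mollMeasure, mollify] using tendsto_eLpNorm_average_sub
    (μ := (volume : Measure (Heis n))) (τ := fun ζ ξ => ζ * ξ) continuous_mul measurable_mul
    (measurePreserving_mul_left volume) one_mul hp hψm.stronglyMeasurable hψ
    fun _ hU => eventually_ae_mollMeasure_mem hU

/-- The difference quotient `(ψ(ξ) - ψ(η)) |η⁻¹ ∘ ξ|^(-α)` of order `α`, whose `L^p` norm is the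
fractional Sobolev seminorm when `α = Q/p + s`. -/
def diffQuot (α : ℝ) (ψ : Heis n → ℝ) (z : Heis n × Heis n) : ℝ :=
  (ψ z.1 - ψ z.2) * hdist z.2 z.1 ^ (-α)

theorem measurable_diffQuot (α : ℝ) {ψ : Heis n → ℝ} (hψ : Measurable ψ) :
    Measurable (diffQuot α ψ) := by
  unfold diffQuot
  fun_prop

theorem diffQuot_mollify {ψ : Heis n → ℝ} (hψ : Integrable ψ) (α : ℝ) (i : ℕ)
    (z : Heis n × Heis n) :
    diffQuot α (mollify (mollifier n i) ψ) z
      = ∫ ζ, diffQuot α ψ (ζ * z.1, ζ * z.2) ∂(mollMeasure n i) := by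
  simp only [diffQuot, hdist_mul_left]
  rw [mollify_sub_mollify hψ, integral_mul_const]

theorem tendsto_eLpNorm_diffQuot_mollify_sub {p α : ℝ} (hp : 1 ≤ p) {ψ : Heis n → ℝ}
    (hψm : Measurable ψ) (hψi : Integrable ψ)
    (hψ : MemLp (diffQuot α ψ) (ENNReal.ofReal p) (volume.prod volume)) :
    Tendsto (fun i => eLpNorm (fun z => diffQuot α (mollify (mollifier n i) ψ) z - diffQuot α ψ z)
      (ENNReal.ofReal p) (volume.prod volume)) atTop (𝓝 0) := by
  simpa only [diffQuot_mollify hψi] using tendsto_eLpNorm_average_sub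
    (μ := (volume : Measure (Heis n)).prod volume)
    (τ := fun (ζ : Heis n) z => (ζ * z.1, ζ * z.2)) (g₀ := 1)
    (by unfold Function.uncurry; fun_prop) (by unfold Function.uncurry; fun_prop)
    (fun ζ => (measurePreserving_mul_left volume ζ).prod (measurePreserving_mul_left volume ζ))
    (fun z => by simp only [one_mul]) hp (measurable_diffQuot α hψm).stronglyMeasurable hψ
    fun _ hU => eventually_ae_mollMeasure_mem hU

theorem exists_compact_mollify_eq_zero {K U : Set (Heis n)} (hK : IsCompact K) (hU : IsOpen U)
    (hKU : K ⊆ U) :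
    ∃ K', IsCompact K' ∧ K ⊆ interior K' ∧ K' ⊆ U ∧ ∀ ψ : Heis n → ℝ, (∀ ξ, ξ ∉ K → ψ ξ = 0) →
      ∀ᶠ i in atTop, ∀ ξ, ξ ∉ K' → mollify (mollifier n i) ψ ξ = 0 := by
  obtain ⟨K', hK', hKK', hK'U⟩ := exists_compact_between hK hU hKU
  refine ⟨K', hK', hKK', hK'U, fun ψ hψ => ?_⟩
  have translate_mem : ∀ᶠ ζ in 𝓝 (1 : Heis n), ∀ ξ ∈ K, ζ⁻¹ * ξ ∈ interior K' := by
    refine hK.eventually_forall_of_forall_eventually fun ξ hξ => ?_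
    have cont : Continuous fun z : Heis n × Heis n => z.1⁻¹ * z.2 := by fun_prop
    refine cont.continuousAt.eventually_mem (isOpen_interior.mem_nhds ?_)
    simpa only [inv_one, one_mul] using hKK' hξ
  filter_upwards [eventually_mollifier_eq_zero translate_mem] with i hi ξ hξ
  refine integral_eq_zero_of_ae (ae_of_all _ fun ζ => ?_)
  by_cases hζ : ζ * ξ ∈ K
  · have vanish : mollifier n i ζ = 0 := hi ζ fun hmem => hξ <| interior_subset <| by
      simpa only [inv_mul_cancel_left] using hmem _ hζ
    simp [vanish]
  · simp [hψ _ hζ]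

end Heis
end

noncomputable section

theorem lintegral_enorm_rpow_sub_one_mul_le {X : Type*} [MeasurableSpace X] {μ : Measure X} {p : ℝ}
    (hp : 1 < p) {a b : X → ℝ} (ha : AEMeasurable a μ) (hb : AEMeasurable b μ) :
    ∫⁻ x, ‖a x‖ₑ ^ (p - 1) * ‖b x‖ₑ ∂μ ≤
      eLpNorm a (ENNReal.ofReal p) μ ^ (p - 1) * eLpNorm b (ENNReal.ofReal p) μ := by
  have hp0 : 0 < p := by linarith
  have conj : p.HolderConjugate (p / (p - 1)) := Real.HolderConjugate.conjExponent hp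
  have holder := ENNReal.lintegral_mul_rpow_le_lintegral_rpow_mul_lintegral_rpow conj
    hb.enorm ha.enorm
  have exponent : p * (1 / (p / (p - 1))) = p - 1 := by field_simp
  simp only [lintegral_enorm_rpow_eq_eLpNorm_rpow hp0, ← ENNReal.rpow_mul, exponent,
    mul_one_div_cancel hp0.ne', ENNReal.rpow_one] at holder
  simpa only [mul_comm] using holder

namespace Heis

variable {n : ℕ} {s p q : ℝ} {u v : Heis n → ℝ}

/-- The weight `(1 + |η|)^(-q)`, which for `q = Q + sp` defines the tail space. -/
def tailWeight (q : ℝ) (η : Heis n) : ℝ≥0∞ := ENNReal.ofReal ((1 + hnorm η) ^ (-q))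

@[fun_prop]
theorem measurable_tailWeight (q : ℝ) : Measurable (tailWeight q : Heis n → ℝ≥0∞) := by
  unfold tailWeight
  fun_prop

theorem lintegral_tailWeight_lt_top (hs : 0 < s) (hs1 : s < 1) (hp : 0 < p) :
    ∫⁻ η : Heis n, tailWeight (homDim n + s * p) η < ⊤ := by
  have hq : 0 < homDim n + s * p := add_pos homDim_pos (mul_pos hs hp)
  rw [← lintegral_add_compl _ (measurableSet_hball 1 1)]
  refine ENNReal.add_lt_top.2 ⟨?_, ?_⟩
  · calc ∫⁻ η in hball 1 1, tailWeight (homDim n + s * p) η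
        ≤ ∫⁻ _ in hball (1 : Heis n) 1, 1 := by
          refine lintegral_mono fun η => ENNReal.ofReal_le_one.2 ?_
          exact Real.rpow_le_one_of_one_le_of_nonpos (by linarith [hnorm_nonneg η]) (by linarith)
      _ < ⊤ := by simpa using volume_hball_lt_top (n := n) 1 1
  · calc ∫⁻ η in (hball 1 1)ᶜ, tailWeight (homDim n + s * p) η
        ≤ ∫⁻ η in (hball (1 : Heis n) 1)ᶜ, kern (homDim n + s * p) η 1 := by
          refine setLIntegral_mono' (measurableSet_hball 1 1).compl fun η hη => ?_
          have far : 1 ≤ hdist 1 η := not_lt.1 hη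
          refine ENNReal.ofReal_le_ofReal
            (Real.rpow_le_rpow_of_nonpos (by linarith) ?_ (by linarith))
          rw [hdist_one]
          linarith
      _ ≤ _ := lintegral_kern_compl_hball_le s p 1 one_pos
      _ < ⊤ := ENNReal.mul_lt_top ENNReal.ofReal_lt_top (lintegral_cutKernel_one_lt_top hs hs1 hp)

theorem MemTailSpace.lintegral_rpow_mul_tailWeight_lt_top (hv : MemTailSpace s p v) (hs : 0 < s)
    (hs1 : s < 1) (hp : 1 < p) {c : ℝ≥0∞} (hc : c ≠ ⊤) :
    ∫⁻ η, (c + ‖v η‖ₑ) ^ (p - 1) * tailWeight (homDim n + s * p) η < ⊤ := by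
  have hp1 : 0 ≤ p - 1 := by linarith
  have weighted : ∀ η, ENNReal.ofReal (|v η| ^ (p - 1) / (1 + hnorm η) ^ (homDim n + s * p))
      = ‖v η‖ₑ ^ (p - 1) * tailWeight (homDim n + s * p) η := fun η => by
    have := hnorm_nonneg η
    rw [div_eq_mul_inv, ← Real.rpow_neg (by positivity), ENNReal.ofReal_mul (by positivity),
      ← ENNReal.ofReal_rpow_of_nonneg (abs_nonneg _) hp1, Real.enorm_eq_ofReal_abs, tailWeight]
  have integrable := hv.2.lintegral_lt_top
  simp only [weighted] at integrable
  set A : ℝ≥0∞ := ENNReal.LpAddConst (ENNReal.ofReal (p - 1))⁻¹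
  have hA : A < ⊤ := ENNReal.LpAddConst_lt_top _
  calc ∫⁻ η, (c + ‖v η‖ₑ) ^ (p - 1) * tailWeight (homDim n + s * p) η
      ≤ ∫⁻ η, A * (c ^ (p - 1) * tailWeight (homDim n + s * p) η
          + ‖v η‖ₑ ^ (p - 1) * tailWeight (homDim n + s * p) η) := by
        refine lintegral_mono fun η => ?_
        rw [← add_mul, ← mul_assoc]
        gcongr
        exact ENNReal.rpow_add_le_mul_rpow_add_rpow' _ _ hp1
    _ = A * (c ^ (p - 1) * (∫⁻ η : Heis n, tailWeight (homDim n + s * p) η)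
          + ∫⁻ η, ‖v η‖ₑ ^ (p - 1) * tailWeight (homDim n + s * p) η) := by
        rw [lintegral_const_mul' _ _ hA.ne, lintegral_add_left (by fun_prop),
          lintegral_const_mul _ (by fun_prop)]
    _ < ⊤ := ENNReal.mul_lt_top hA (ENNReal.add_lt_top.2 ⟨ENNReal.mul_lt_top
          (ENNReal.rpow_lt_top_of_nonneg hp1 hc)
          (lintegral_tailWeight_lt_top hs hs1 (by linarith)), integrable⟩)

theorem exists_kern_le_tailWeight (hq : 0 ≤ q) {K U : Set (Heis n)} (hK : IsCompact K)
    (hU : IsOpen U) (hKU : K ⊆ U) :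
    ∃ C : ℝ≥0∞, C ≠ ⊤ ∧ ∀ ξ ∈ K, ∀ η, η ∉ U → kern q ξ η ≤ C * tailWeight q η := by
  have translate_mem : ∀ᶠ ζ in 𝓝 (1 : Heis n), ∀ ξ ∈ K, ξ * ζ ∈ U := by
    refine hK.eventually_forall_of_forall_eventually fun ξ hξ => ?_
    have cont : Continuous fun z : Heis n × Heis n => z.2 * z.1 := by fun_prop
    refine cont.continuousAt.eventually_mem (hU.mem_nhds ?_)
    simpa using hKU hξ
  obtain ⟨δ, hδ, ball_subset⟩ := exists_closedHball_one_subset translate_mem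
  obtain ⟨R, hR⟩ := (hK.image continuous_hnorm).bddAbove
  refine ⟨ENNReal.ofReal (((1 + |R|) / δ + 1) ^ q), ENNReal.ofReal_ne_top, fun ξ hξ η hη => ?_⟩
  have far : δ ≤ hdist ξ η := by
    by_contra! near
    refine hη ?_
    have := ball_subset (mem_closedHball.2 ((hdist_one (ξ⁻¹ * η)).trans_le near.le)) ξ hξ
    simpa using this
  have hnorm_le : hnorm ξ ≤ |R| := (hR (mem_image_of_mem _ hξ)).trans (le_abs_self R)
  have triangle : hnorm η ≤ hnorm ξ + hdist ξ η := by
    simpa [hdist] using hnorm_mul_le ξ (ξ⁻¹ * η)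
  have scale : 1 + |R| ≤ (1 + |R|) / δ * hdist ξ η := by
    rw [div_mul_eq_mul_div, le_div_iff₀ hδ]
    gcongr
  have hη0 := hnorm_nonneg η
  have hd0 : 0 < hdist ξ η := hδ.trans_le far
  rw [kern_comm, kern, tailWeight, ← ENNReal.ofReal_mul (by positivity)]
  refine ENNReal.ofReal_le_ofReal ?_
  rw [Real.rpow_neg hd0.le, Real.rpow_neg (by positivity), ← div_eq_mul_inv,
    le_div_iff₀ (by positivity), inv_mul_le_iff₀ (by positivity), mul_comm,
    ← Real.mul_rpow (by positivity) hd0.le]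
  exact Real.rpow_le_rpow (by positivity) (by linarith) hq

end Heis

end

noncomputable section

theorem lintegral_ofReal_le_add_eLpNorm_sub {X : Type*} [MeasurableSpace X] {μ : Measure X} {p : ℝ}
    (hp : 1 ≤ p) {f g : X → ℝ} (hf : Measurable f) (hg : Measurable g) {K : Set X}
    (hfK : ∀ x, x ∉ K → f x = 0) (hgK : ∀ x, x ∉ K → g x = 0) :
    ∫⁻ x, ENNReal.ofReal (f x) ∂μ ≤ ∫⁻ x, ENNReal.ofReal (g x) ∂μ
      + μ K ^ (1 - 1 / p) * eLpNorm (fun x => f x - g x) (ENNReal.ofReal p) μ := by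
  calc ∫⁻ x, ENNReal.ofReal (f x) ∂μ
      ≤ ∫⁻ x, (ENNReal.ofReal (g x) + ‖f x - g x‖ₑ) ∂μ := lintegral_mono fun x => by
        refine (ENNReal.ofReal_le_ofReal (add_sub_cancel (g x) (f x)).ge).trans
          (ENNReal.ofReal_add_le.trans ?_)
        gcongr
        exact Real.ofReal_le_enorm _
    _ = ∫⁻ x, ENNReal.ofReal (g x) ∂μ + ∫⁻ x in K, ‖f x - g x‖ₑ ∂μ := by
        rw [lintegral_add_left (by fun_prop), setLIntegral_eq_of_support_subset]
        intro x hx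
        by_contra hxK
        simp [hfK x hxK, hgK x hxK] at hx
    _ ≤ _ := by
        gcongr
        rw [mul_comm, ← eLpNorm_one_eq_lintegral_enorm]
        refine (eLpNorm_le_eLpNorm_mul_rpow_measure_univ (q := ENNReal.ofReal p)
          (by simpa using hp) (by fun_prop)).trans ?_
        gcongr
        · exact Measure.restrict_le_self
        · simp [ENNReal.toReal_ofReal (by linarith : 0 ≤ p)]

namespace Heis

variable {n : ℕ} {s p q : ℝ} {u ψ ψ' χ : Heis n → ℝ} {d : Heis n → ℝ}

/-! ### The energy of a pair of functions -/

/-- The nonlinearity `t ↦ |t|^(p-2) t` of the fractional `p`-Laplacian. -/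
def flux (p t : ℝ) : ℝ := |t| ^ (p - 2) * t

@[fun_prop]
theorem measurable_flux (p : ℝ) : Measurable (flux p) := by
  unfold flux
  fun_prop

theorem flux_neg (p t : ℝ) : flux p (-t) = -flux p t := by
  rw [flux, flux, abs_neg, mul_neg]

theorem flux_of_nonneg (hp : 1 < p) {t : ℝ} (ht : 0 ≤ t) : flux p t = t ^ (p - 1) := by
  rcases ht.eq_or_lt with rfl | ht
  · rw [flux, mul_zero, Real.zero_rpow (by linarith)]
  · rw [flux, abs_of_pos ht, ← Real.rpow_add_one ht.ne']
    congr 1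
    ring

theorem flux_nonpos (hp : 1 < p) {t : ℝ} (ht : t ≤ 0) : flux p t ≤ 0 := by
  rw [← neg_neg t, flux_neg, flux_of_nonneg hp (by linarith)]
  exact neg_nonpos.2 (Real.rpow_nonneg (by linarith) _)

theorem ofReal_flux (hp : 1 < p) (t : ℝ) :
    ENNReal.ofReal (flux p t) = ENNReal.ofReal t ^ (p - 1) := by
  rcases le_total 0 t with ht | ht
  · rw [flux_of_nonneg hp ht, ENNReal.ofReal_rpow_of_nonneg ht (by linarith)]
  · rw [ENNReal.ofReal_of_nonpos ht, ENNReal.ofReal_of_nonpos (flux_nonpos hp ht),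
      ENNReal.zero_rpow_of_pos (by linarith)]

theorem enorm_flux (hp : 1 < p) (t : ℝ) : ‖flux p t‖ₑ = ‖t‖ₑ ^ (p - 1) := by
  have abs_flux : |flux p t| = |t| ^ (p - 1) := by
    rw [← flux_of_nonneg hp (abs_nonneg t), flux, flux, abs_mul, abs_abs,
      abs_of_nonneg (Real.rpow_nonneg (abs_nonneg t) _)]
  rw [Real.enorm_eq_ofReal_abs, Real.enorm_eq_ofReal_abs, abs_flux,
    ENNReal.ofReal_rpow_of_nonneg (abs_nonneg t) (by linarith)]

/-- The kernel `d(η⁻¹ ∘ ξ)^(-q)` of the weak formulation. -/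
def dkern (d : Heis n → ℝ) (q : ℝ) (ξ η : Heis n) : ℝ := (d (η⁻¹ * ξ) ^ q)⁻¹

theorem IsComparable.nonneg (hd : IsComparable d) (h : Heis n) : 0 ≤ d h := by
  obtain ⟨c, hc, hcd⟩ := hd.exists_le
  exact (mul_nonneg hc.le (hnorm_nonneg h)).trans (hcd h)

theorem IsComparable.eq_zero_of_hnorm_eq_zero (hd : IsComparable d) {h : Heis n}
    (hh : hnorm h = 0) : d h = 0 := by
  obtain ⟨C, -, hCd⟩ := hd.exists_ge
  exact le_antisymm (by simpa [hh] using hCd h) (hd.nonneg h)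

theorem IsComparable.dkern_nonneg (hd : IsComparable d) (q : ℝ) (ξ η : Heis n) :
    0 ≤ dkern d q ξ η :=
  inv_nonneg.2 (Real.rpow_nonneg (hd.nonneg _) q)

theorem IsComparable.measurable_dkern (hd : IsComparable d) (q : ℝ) :
    Measurable fun z : Heis n × Heis n => dkern d q z.1 z.2 :=
  ((hd.measurable.comp (by fun_prop)).pow_const q).inv

theorem IsComparable.exists_ofReal_dkern_le (hd : IsComparable d) (hq : 0 < q) :
    ∃ C : ℝ, 0 < C ∧ ∀ ξ η, ENNReal.ofReal (dkern d q ξ η) ≤ ENNReal.ofReal C * kern q ξ η := by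
  obtain ⟨c, hc, hcd⟩ := hd.exists_le
  refine ⟨c ^ (-q), by positivity, fun ξ η => ?_⟩
  rw [kern, ← ENNReal.ofReal_mul (by positivity), ← Real.mul_rpow hc.le (hdist_nonneg _ _), dkern,
    ← Real.rpow_neg (hd.nonneg _)]
  refine ENNReal.ofReal_le_ofReal ?_
  rcases (hdist_nonneg η ξ).eq_or_lt with h0 | h0
  · rw [hd.eq_zero_of_hnorm_eq_zero h0.symm, ← h0, mul_zero]
  · exact Real.rpow_le_rpow_of_nonpos (mul_pos hc h0) (hcd _) (by linarith)

theorem IsComparable.exists_le_ofReal_dkern (hd : IsComparable d) (hq : 0 < q) :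
    ∃ c : ℝ, 0 < c ∧ ∀ ξ η, ENNReal.ofReal c * kern q ξ η ≤ ENNReal.ofReal (dkern d q ξ η) := by
  obtain ⟨C, hC, hCd⟩ := hd.exists_ge
  refine ⟨C ^ (-q), by positivity, fun ξ η => ?_⟩
  rw [kern, ← ENNReal.ofReal_mul (by positivity), ← Real.mul_rpow hC.le (hdist_nonneg _ _), dkern,
    ← Real.rpow_neg (hd.nonneg _)]
  refine ENNReal.ofReal_le_ofReal ?_
  rcases (hdist_nonneg η ξ).eq_or_lt with h0 | h0
  · rw [hd.eq_zero_of_hnorm_eq_zero h0.symm, ← h0, mul_zero]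
  · obtain ⟨c, hc, hcd⟩ := hd.exists_le
    exact Real.rpow_le_rpow_of_nonpos ((mul_pos hc h0).trans_le (hcd _)) (hCd _) (by linarith)

theorem energyIntegrand_eq (s p : ℝ) (d u ψ : Heis n → ℝ) (z : Heis n × Heis n) :
    energyIntegrand s p d u ψ z
      = flux p (u z.1 - u z.2) * (ψ z.1 - ψ z.2) * dkern d (homDim n + s * p) z.1 z.2 :=
  div_eq_mul_inv _ _

theorem IsComparable.measurable_energyIntegrand (hd : IsComparable d) (hu : Measurable u)
    (hψ : Measurable ψ) : Measurable (energyIntegrand s p d u ψ) := by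
  have := hd.measurable_dkern (homDim n + s * p)
  simp only [funext (energyIntegrand_eq s p d u ψ)]
  fun_prop

theorem IsComparable.ofReal_energyIntegrand (hd : IsComparable d) (z : Heis n × Heis n) :
    ENNReal.ofReal (energyIntegrand s p d u ψ z)
      = ENNReal.ofReal (flux p (u z.1 - u z.2) * (ψ z.1 - ψ z.2))
        * ENNReal.ofReal (dkern d (homDim n + s * p) z.1 z.2) := by
  rw [energyIntegrand_eq, ENNReal.ofReal_mul' (hd.dkern_nonneg _ _ _)]

theorem IsComparable.ofReal_neg_energyIntegrand (hd : IsComparable d) (z : Heis n × Heis n) :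
    ENNReal.ofReal (-energyIntegrand s p d u ψ z)
      = ENNReal.ofReal (-(flux p (u z.1 - u z.2) * (ψ z.1 - ψ z.2)))
        * ENNReal.ofReal (dkern d (homDim n + s * p) z.1 z.2) := by
  rw [energyIntegrand_eq, ← neg_mul, ENNReal.ofReal_mul' (hd.dkern_nonneg _ _ _)]

theorem ofReal_flux_mul_le (hp : 1 < p) (t w w' : ℝ) :
    ENNReal.ofReal (flux p t * w')
      ≤ ENNReal.ofReal (flux p t * w) + ‖t‖ₑ ^ (p - 1) * ‖w' - w‖ₑ := by
  rw [← enorm_flux hp, ← enorm_mul]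
  calc ENNReal.ofReal (flux p t * w')
      = ENNReal.ofReal (flux p t * w + flux p t * (w' - w)) := by ring_nf
    _ ≤ _ := ENNReal.ofReal_add_le.trans (by gcongr; exact Real.ofReal_le_enorm _)

theorem ofReal_flux_mul_le_of_nonneg (hp : 1 < p) (t : ℝ) {w w' : ℝ} (hw : 0 ≤ w) (hw' : 0 ≤ w') :
    ENNReal.ofReal (flux p t * w')
      ≤ ENNReal.ofReal (flux p t * w) + ENNReal.ofReal t ^ (p - 1) * ‖w' - w‖ₑ := by
  rw [ENNReal.ofReal_mul' hw, ENNReal.ofReal_mul' hw', ← ofReal_flux hp, ← mul_add]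
  gcongr
  calc ENNReal.ofReal w' = ENNReal.ofReal (w + (w' - w)) := by ring_nf
    _ ≤ _ := ENNReal.ofReal_add_le.trans (by gcongr; exact Real.ofReal_le_enorm _)

/-- The change of the energy density at a pair of interior points when the test function changes
by `χ`. -/
def innerError (p q : ℝ) (u χ : Heis n → ℝ) (z : Heis n × Heis n) : ℝ≥0∞ :=
  ‖u z.1 - u z.2‖ₑ ^ (p - 1) * ‖χ z.1 - χ z.2‖ₑ * kern q z.1 z.2

/-- The change of the positive part of the energy density at an interior point `z.1` and an exterior
point `z.2`, where the test functions vanish. -/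
def outerError (p q : ℝ) (u χ : Heis n → ℝ) (z : Heis n × Heis n) : ℝ≥0∞ :=
  ENNReal.ofReal (u z.1 - u z.2) ^ (p - 1) * ‖χ z.1‖ₑ * kern q z.1 z.2

theorem measurable_innerError (p q : ℝ) (hu : Measurable u) (hχ : Measurable χ) :
    Measurable (innerError p q u χ) := by
  unfold innerError
  fun_prop

theorem measurable_outerError (p q : ℝ) (hu : Measurable u) (hχ : Measurable χ) :
    Measurable (outerError p q u χ) := by
  unfold outerError
  fun_prop

theorem IsComparable.ofReal_energyIntegrand_le_innerError (hd : IsComparable d) (hp : 1 < p)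
    {C : ℝ≥0∞} (hC : ∀ ξ η, ENNReal.ofReal (dkern d (homDim n + s * p) ξ η)
      ≤ C * kern (homDim n + s * p) ξ η) (ψ ψ' : Heis n → ℝ) (z : Heis n × Heis n) :
    ENNReal.ofReal (energyIntegrand s p d u ψ' z) ≤ ENNReal.ofReal (energyIntegrand s p d u ψ z)
      + C * innerError p (homDim n + s * p) u (ψ' - ψ) z := by
  rw [hd.ofReal_energyIntegrand, hd.ofReal_energyIntegrand, innerError, mul_left_comm,
    Pi.sub_apply, Pi.sub_apply, sub_sub_sub_comm]
  refine (mul_le_mul_left (ofReal_flux_mul_le hp _ (ψ z.1 - ψ z.2) _) _).trans ?_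
  rw [add_mul]
  gcongr
  exact hC _ _

theorem IsComparable.ofReal_energyIntegrand_le_outerError (hd : IsComparable d) (hp : 1 < p)
    {C : ℝ≥0∞} (hC : ∀ ξ η, ENNReal.ofReal (dkern d (homDim n + s * p) ξ η)
      ≤ C * kern (homDim n + s * p) ξ η) {z : Heis n × Heis n} (hψ : 0 ≤ ψ z.1) (hψ' : 0 ≤ ψ' z.1)
    (hψz : ψ z.2 = 0) (hψz' : ψ' z.2 = 0) :
    ENNReal.ofReal (energyIntegrand s p d u ψ' z) ≤ ENNReal.ofReal (energyIntegrand s p d u ψ z)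
      + C * outerError p (homDim n + s * p) u (ψ' - ψ) z := by
  rw [hd.ofReal_energyIntegrand, hd.ofReal_energyIntegrand, outerError, mul_left_comm, hψz, hψz',
    sub_zero, sub_zero, Pi.sub_apply]
  refine (mul_le_mul_left (ofReal_flux_mul_le_of_nonneg hp _ hψ hψ') _).trans ?_
  rw [add_mul]
  gcongr
  exact hC _ _

theorem IsComparable.ofReal_energyIntegrand_le_outerError_swap (hd : IsComparable d) (hp : 1 < p)
    {C : ℝ≥0∞} (hC : ∀ ξ η, ENNReal.ofReal (dkern d (homDim n + s * p) ξ η)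
      ≤ C * kern (homDim n + s * p) ξ η) {z : Heis n × Heis n} (hψ : 0 ≤ ψ z.2) (hψ' : 0 ≤ ψ' z.2)
    (hψz : ψ z.1 = 0) (hψz' : ψ' z.1 = 0) :
    ENNReal.ofReal (energyIntegrand s p d u ψ' z) ≤ ENNReal.ofReal (energyIntegrand s p d u ψ z)
      + C * outerError p (homDim n + s * p) u (ψ' - ψ) z.swap := by
  rw [hd.ofReal_energyIntegrand, hd.ofReal_energyIntegrand, outerError, mul_left_comm, hψz, hψz',
    zero_sub, zero_sub, mul_neg, mul_neg, ← neg_mul, ← neg_mul, ← flux_neg, neg_sub, Pi.sub_apply,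
    Prod.fst_swap, Prod.snd_swap, kern_comm]
  refine (mul_le_mul_left (ofReal_flux_mul_le_of_nonneg hp _ hψ hψ') _).trans ?_
  rw [add_mul]
  gcongr
  exact hC _ _

theorem IsComparable.ofReal_energyIntegrand_le_add_errors (hd : IsComparable d) (hp : 1 < p)
    {C : ℝ≥0∞} (hC : ∀ ξ η, ENNReal.ofReal (dkern d (homDim n + s * p) ξ η)
      ≤ C * kern (homDim n + s * p) ξ η) (hψ : ∀ ξ, 0 ≤ ψ ξ) (hψ' : ∀ ξ, 0 ≤ ψ' ξ)
    {K U : Set (Heis n)} (hKU : K ⊆ U) (hψK : ∀ ξ, ξ ∉ K → ψ ξ = 0)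
    (hψK' : ∀ ξ, ξ ∉ K → ψ' ξ = 0) (z : Heis n × Heis n) :
    ENNReal.ofReal (energyIntegrand s p d u ψ' z) ≤ ENNReal.ofReal (energyIntegrand s p d u ψ z)
      + C * ((U ×ˢ U).indicator (innerError p (homDim n + s * p) u (ψ' - ψ)) z
        + ((K ×ˢ Uᶜ).indicator (outerError p (homDim n + s * p) u (ψ' - ψ)) z
        + (K ×ˢ Uᶜ).indicator (outerError p (homDim n + s * p) u (ψ' - ψ)) z.swap)) := by
  have eq_zero_of_notMem (h₁ : z.1 ∉ K) (h₂ : z.2 ∉ K) : energyIntegrand s p d u ψ' z = 0 := by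
    rw [energyIntegrand, hψK' _ h₁, hψK' _ h₂, sub_zero, mul_zero, zero_div]
  by_cases h₁ : z.1 ∈ U <;> by_cases h₂ : z.2 ∈ U
  · rw [indicator_of_mem (show z ∈ U ×ˢ U from ⟨h₁, h₂⟩)]
    refine (hd.ofReal_energyIntegrand_le_innerError hp hC ψ ψ' z).trans ?_
    gcongr
    exact le_self_add
  · have h₂K : z.2 ∉ K := fun h => h₂ (hKU h)
    by_cases h₁K : z.1 ∈ K
    · rw [indicator_of_mem (show z ∈ K ×ˢ Uᶜ from ⟨h₁K, h₂⟩)]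
      refine (hd.ofReal_energyIntegrand_le_outerError hp hC (hψ _) (hψ' _) (hψK _ h₂K)
        (hψK' _ h₂K)).trans ?_
      gcongr
      exact le_add_left le_self_add
    · simp [eq_zero_of_notMem h₁K h₂K]
  · have h₁K : z.1 ∉ K := fun h => h₁ (hKU h)
    by_cases h₂K : z.2 ∈ K
    · rw [indicator_of_mem (show z.swap ∈ K ×ˢ Uᶜ from ⟨h₂K, h₁⟩)]
      refine (hd.ofReal_energyIntegrand_le_outerError_swap hp hC (hψ _) (hψ' _) (hψK _ h₁K)
        (hψK' _ h₁K)).trans ?_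
      gcongr
      exact le_add_left le_add_self
    · simp [eq_zero_of_notMem h₁K h₂K]
  · simp [eq_zero_of_notMem (fun h => h₁ (hKU h)) (fun h => h₂ (hKU h))]

end Heis

end

noncomputable section

theorem integrable_of_memLp_of_isCompact {X : Type*} [TopologicalSpace X] [MeasurableSpace X]
    {μ : Measure X} [IsFiniteMeasureOnCompacts μ] {p : ℝ} (hp : 1 ≤ p) {g : X → ℝ} {K : Set X}
    (hK : IsCompact K) (hgK : ∀ x, x ∉ K → g x = 0) (hg : MemLp g (ENNReal.ofReal p) μ) :
    Integrable g μ := by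
  have : IsFiniteMeasure (μ.restrict K) := ⟨by simpa using hK.measure_lt_top⟩
  refine (integrableOn_iff_integrable_of_support_subset
    (fun x hx => by_contra fun h => hx (hgK x h))).1 ?_
  exact (hg.restrict K).integrable (by simpa using hp)

namespace Heis

variable {n : ℕ} {s p : ℝ} {u ψ ψ' χ : Heis n → ℝ} {d : Heis n → ℝ} {f : Heis n → ℝ → ℝ}
  {Ω U K : Set (Heis n)}

/-! ### Test functions of fractional Sobolev regularity -/

theorem MemFracSobolev.memLp_diffQuot (h : MemFracSobolev s p U u) (hu : Measurable u) :
    MemLp (diffQuot (homDim n / p + s) u) (ENNReal.ofReal p)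
      ((volume.restrict U).prod (volume.restrict U)) := by
  refine h.2.congr_norm (measurable_diffQuot _ hu).aestronglyMeasurable (ae_of_all _ fun z => ?_)
  rw [diffQuot, Real.rpow_neg (hdist_nonneg _ _), norm_div, norm_mul, norm_inv, norm_abs_eq_norm,
    div_eq_mul_inv]
  rfl

theorem enorm_diffQuot (α : ℝ) (ψ : Heis n → ℝ) (z : Heis n × Heis n) :
    ‖diffQuot α ψ z‖ₑ = ‖ψ z.1 - ψ z.2‖ₑ * kern α z.1 z.2 := by
  rw [diffQuot, enorm_mul, kern, Real.enorm_of_nonneg (Real.rpow_nonneg (hdist_nonneg _ _) _)]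

theorem diffQuot_sub (α : ℝ) (ψ ψ' : Heis n → ℝ) :
    diffQuot α (ψ - ψ') = diffQuot α ψ - diffQuot α ψ' := by
  ext z
  simp only [diffQuot, Pi.sub_apply]
  ring

theorem kern_rpow {α r : ℝ} (hr : 0 ≤ r) (ξ η : Heis n) : kern α ξ η ^ r = kern (α * r) ξ η := by
  rw [kern, kern, ENNReal.ofReal_rpow_of_nonneg (Real.rpow_nonneg (hdist_nonneg _ _) _) hr,
    ← Real.rpow_mul (hdist_nonneg _ _), neg_mul]

theorem innerError_eq (hp : 1 < p) (u χ : Heis n → ℝ) (z : Heis n × Heis n) :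
    innerError p (homDim n + s * p) u χ z = ‖diffQuot (homDim n / p + s) u z‖ₑ ^ (p - 1)
      * ‖diffQuot (homDim n / p + s) χ z‖ₑ := by
  have kern_eq : kern (homDim n + s * p) z.1 z.2 = kern (homDim n / p + s) z.1 z.2 ^ (p - 1)
      * kern (homDim n / p + s) z.1 z.2 := by
    calc kern (homDim n + s * p) z.1 z.2 = kern (homDim n / p + s) z.1 z.2 ^ ((p - 1) + 1) := by
          rw [sub_add_cancel, kern_rpow (by linarith), add_mul, div_mul_cancel₀ _ (by linarith)]
      _ = _ := by
          rw [ENNReal.rpow_add_of_nonneg _ _ (by linarith) zero_le_one, ENNReal.rpow_one]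
  rw [innerError, enorm_diffQuot, enorm_diffQuot, ENNReal.mul_rpow_of_nonneg _ _ (by linarith),
    kern_eq]
  ring

theorem lintegral_innerError_le (hp : 1 < p) (hu : Measurable u) (hχ : Measurable χ)
    (U : Set (Heis n)) :
    ∫⁻ z in U ×ˢ U, innerError p (homDim n + s * p) u χ z ∂(volume.prod volume)
      ≤ eLpNorm (diffQuot (homDim n / p + s) u) (ENNReal.ofReal p)
          ((volume.restrict U).prod (volume.restrict U)) ^ (p - 1)
        * eLpNorm (diffQuot (homDim n / p + s) χ) (ENNReal.ofReal p) (volume.prod volume) := by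
  rw [Measure.prod_restrict]
  simp only [innerError_eq hp]
  refine (lintegral_enorm_rpow_sub_one_mul_le hp (measurable_diffQuot _ hu).aemeasurable
    (measurable_diffQuot _ hχ).aemeasurable).trans ?_
  gcongr
  exact Measure.restrict_le_self

theorem ofReal_sub_le_enorm_mul (a b : ℝ) :
    ENNReal.ofReal (a - b) ≤ ‖|a| + 1‖ₑ * (1 + ‖max (-b) 0‖ₑ) := by
  have h₁ := le_abs_self a
  have h₂ := le_max_left (-b) 0
  have h₃ := le_max_right (-b) 0
  rw [Real.enorm_of_nonneg (by positivity), Real.enorm_of_nonneg h₃, ← ENNReal.ofReal_one,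
    ← ENNReal.ofReal_add zero_le_one h₃, ← ENNReal.ofReal_mul (by positivity)]
  exact ENNReal.ofReal_le_ofReal (by nlinarith [abs_nonneg a])

theorem outerError_le (hp : 1 ≤ p) {q : ℝ} {z : Heis n × Heis n} {k : ℝ≥0∞}
    (hk : kern q z.1 z.2 ≤ k) : outerError p q u χ z
      ≤ (‖|u z.1| + 1‖ₑ ^ (p - 1) * ‖χ z.1‖ₑ) * ((1 + ‖max (-u z.2) 0‖ₑ) ^ (p - 1) * k) := by
  have hp' : 0 ≤ p - 1 := by linarith
  calc outerError p q u χ z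
      ≤ (‖|u z.1| + 1‖ₑ * (1 + ‖max (-u z.2) 0‖ₑ)) ^ (p - 1) * ‖χ z.1‖ₑ * k := by
        unfold outerError
        gcongr
        exact ofReal_sub_le_enorm_mul _ _
    _ = _ := by
        rw [ENNReal.mul_rpow_of_nonneg _ _ hp']
        ring

theorem memLp_abs_add_one (hUc : IsCompact (closure U))
    (hu : MemLp u (ENNReal.ofReal p) (volume.restrict U)) :
    MemLp (fun ξ => |u ξ| + 1) (ENNReal.ofReal p) (volume.restrict U) := by
  have : IsFiniteMeasure (volume.restrict U) :=
    ⟨by simpa using (measure_mono subset_closure).trans_lt hUc.measure_lt_top⟩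
  exact hu.abs.add (memLp_const 1)

theorem exists_lintegral_outerError_le (hs : 0 < s) (hs1 : s < 1) (hp : 1 < p) (hu : Measurable u)
    (huU : MemLp u (ENNReal.ofReal p) (volume.restrict U))
    (hut : MemTailSpace s p fun ξ => max (-u ξ) 0) (hU : IsOpen U) (hUc : IsCompact (closure U))
    (hK : IsCompact K) (hKU : K ⊆ U) :
    ∃ A : ℝ≥0∞, A ≠ ⊤ ∧ ∀ χ : Heis n → ℝ, Measurable χ →
      ∫⁻ z in K ×ˢ Uᶜ, outerError p (homDim n + s * p) u χ z ∂(volume.prod volume)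
        ≤ A * eLpNorm χ (ENNReal.ofReal p) volume := by
  have hQ := homDim_pos (n := n)
  obtain ⟨C, hC, hker⟩ :=
    exists_kern_le_tailWeight (q := homDim n + s * p) (by positivity) hK hU hKU
  have hT := hut.lintegral_rpow_mul_tailWeight_lt_top hs hs1 hp (c := 1) ENNReal.one_ne_top
  set T := ∫⁻ η, (1 + ‖max (-u η) 0‖ₑ) ^ (p - 1) * tailWeight (homDim n + s * p) η
  set M := eLpNorm (fun ξ => |u ξ| + 1) (ENNReal.ofReal p) (volume.restrict U) ^ (p - 1)
  refine ⟨M * (T * C), ENNReal.mul_ne_top (ENNReal.rpow_ne_top_of_nonneg (by linarith)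
    (memLp_abs_add_one hUc huU).2.ne) (ENNReal.mul_ne_top hT.ne hC), fun χ hχ => ?_⟩
  calc ∫⁻ z in K ×ˢ Uᶜ, outerError p (homDim n + s * p) u χ z ∂(volume.prod volume)
      ≤ ∫⁻ z in K ×ˢ Uᶜ, (‖|u z.1| + 1‖ₑ ^ (p - 1) * ‖χ z.1‖ₑ)
          * ((1 + ‖max (-u z.2) 0‖ₑ) ^ (p - 1) * (C * tailWeight (homDim n + s * p) z.2))
          ∂(volume.prod volume) :=
        setLIntegral_mono' (hK.measurableSet.prod hU.measurableSet.compl) fun z hz =>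
          outerError_le hp.le (hker _ hz.1 _ hz.2)
    _ = (∫⁻ ξ in K, ‖|u ξ| + 1‖ₑ ^ (p - 1) * ‖χ ξ‖ₑ) * ∫⁻ η in Uᶜ,
          (1 + ‖max (-u η) 0‖ₑ) ^ (p - 1) * (C * tailWeight (homDim n + s * p) η) := by
        rw [← Measure.prod_restrict]
        exact lintegral_prod_mul (f := fun ξ => ‖|u ξ| + 1‖ₑ ^ (p - 1) * ‖χ ξ‖ₑ)
          (g := fun η => (1 + ‖max (-u η) 0‖ₑ) ^ (p - 1) * (C * tailWeight (homDim n + s * p) η))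
          (by fun_prop) (by fun_prop)
    _ ≤ (M * eLpNorm χ (ENNReal.ofReal p) volume) * (T * C) := by
        gcongr
        · refine (lintegral_mono_set hKU).trans ((lintegral_enorm_rpow_sub_one_mul_le hp
            (by fun_prop) (by fun_prop)).trans ?_)
          gcongr
          exact Measure.restrict_le_self
        · simp only [mul_left_comm _ C]
          rw [lintegral_const_mul _ (by fun_prop), mul_comm]
          gcongr
          exact setLIntegral_le_lintegral _ _
    _ = _ := by ring

theorem IsComparable.exists_lintegral_energyIntegrand_le (hd : IsComparable d) (hs : 0 < s)
    (hs1 : s < 1) (hp : 1 < p) (hu : Measurable u) (huU : MemFracSobolev s p U u)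
    (hut : MemTailSpace s p fun ξ => max (-u ξ) 0) (hU : IsOpen U) (hUc : IsCompact (closure U))
    (hK : IsCompact K) (hKU : K ⊆ U) :
    ∃ A : ℝ≥0∞, A ≠ ⊤ ∧ ∀ ψ ψ' : Heis n → ℝ, Measurable ψ → Measurable ψ' → (∀ ξ, 0 ≤ ψ ξ) →
      (∀ ξ, 0 ≤ ψ' ξ) → (∀ ξ, ξ ∉ K → ψ ξ = 0) → (∀ ξ, ξ ∉ K → ψ' ξ = 0) →
      ∫⁻ z, ENNReal.ofReal (energyIntegrand s p d u ψ' z) ∂(volume.prod volume)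
        ≤ ∫⁻ z, ENNReal.ofReal (energyIntegrand s p d u ψ z) ∂(volume.prod volume)
          + A * (eLpNorm (diffQuot (homDim n / p + s) ψ' - diffQuot (homDim n / p + s) ψ)
              (ENNReal.ofReal p) (volume.prod volume)
            + eLpNorm (ψ' - ψ) (ENNReal.ofReal p) volume) := by
  have hQ := homDim_pos (n := n)
  obtain ⟨C, -, hC⟩ := hd.exists_ofReal_dkern_le (q := homDim n + s * p) (by positivity)
  obtain ⟨A, hA, houter⟩ := exists_lintegral_outerError_le hs hs1 hp hu huU.1 hut hU hUc hK hKU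
  set B := eLpNorm (diffQuot (homDim n / p + s) u) (ENNReal.ofReal p)
    ((volume.restrict U).prod (volume.restrict U)) ^ (p - 1)
  have hB : B ≠ ⊤ := ENNReal.rpow_ne_top_of_nonneg (by linarith) (huU.memLp_diffQuot hu).2.ne
  refine ⟨ENNReal.ofReal C * (B + (A + A)), by finiteness,
    fun ψ ψ' hψm hψm' hψ hψ' hψK hψK' => ?_⟩
  have hinner := measurable_innerError p (homDim n + s * p) hu (hψm'.sub hψm)
  have houterm := measurable_outerError p (homDim n + s * p) hu (hψm'.sub hψm)
  have hUU : MeasurableSet (U ×ˢ U) := hU.measurableSet.prod hU.measurableSet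
  have hKU' : MeasurableSet (K ×ˢ Uᶜ) := hK.measurableSet.prod hU.measurableSet.compl
  refine (lintegral_mono
    (hd.ofReal_energyIntegrand_le_add_errors hp hC hψ hψ' hKU hψK hψK')).trans ?_
  rw [lintegral_add_left (hd.measurable_energyIntegrand hu hψm).ennreal_ofReal,
    lintegral_const_mul' _ _ ENNReal.ofReal_ne_top, lintegral_add_left (hinner.indicator hUU),
    lintegral_add_left (houterm.indicator hKU'), lintegral_prod_swap, lintegral_indicator hUU,
    lintegral_indicator hKU', ← diffQuot_sub, mul_assoc]
  gcongr
  set a := eLpNorm (ψ' - ψ) (ENNReal.ofReal p) volume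
  set b := eLpNorm (diffQuot (homDim n / p + s) (ψ' - ψ)) (ENNReal.ofReal p) (volume.prod volume)
  calc _ ≤ B * b + (A * a + A * a) := by
        gcongr
        exacts [lintegral_innerError_le hp hu (hψm'.sub hψm) U, houter _ (hψm'.sub hψm),
          houter _ (hψm'.sub hψm)]
    _ ≤ B * (b + a) + (A * (b + a) + A * (b + a)) := by
        gcongr <;> simp
    _ = (B + (A + A)) * (b + a) := by ring

theorem IsWeakSupersolution.lintegral_neg_energy_le_of_contDiff
    (hu : IsWeakSupersolution s p d f Ω u) (hU : MeasurableSet U) {F : ℝ}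
    (hF : ∀ᵐ ξ ∂(volume.restrict U), |f ξ (u ξ)| ≤ F) (hψ : ContDiff ℝ ∞ ψ)
    (hψc : HasCompactSupport ψ) (hψΩ : tsupport ψ ⊆ Ω) (hψ0 : ∀ ξ, 0 ≤ ψ ξ)
    (hψU : ∀ ξ, ξ ∉ U → ψ ξ = 0) :
    ∫⁻ z, ENNReal.ofReal (-energyIntegrand s p d u ψ z) ∂(volume.prod volume) ≤
      ∫⁻ z, ENNReal.ofReal (energyIntegrand s p d u ψ z) ∂(volume.prod volume)
        + ENNReal.ofReal F * ∫⁻ ξ, ENNReal.ofReal (ψ ξ) := by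
  obtain ⟨hE, hle⟩ := hu.weak ψ hψ hψc hψΩ hψ0
  have hψi : Integrable ψ := hψ.continuous.integrable_of_hasCompactSupport hψc
  have neg_le_integral : -(F * ∫ ξ, ψ ξ) ≤ ∫ ξ, f ξ (u ξ) * ψ ξ := by
    rw [← integral_const_mul]
    refine (abs_le.1 ((Real.norm_eq_abs _).symm.trans_le
      (norm_integral_le_of_norm_le (hψi.const_mul F) ?_))).1
    filter_upwards [(ae_restrict_iff' hU).1 hF] with ξ hξ
    by_cases h : ξ ∈ U
    · rw [norm_mul, Real.norm_eq_abs, Real.norm_of_nonneg (hψ0 ξ)]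
      exact mul_le_mul_of_nonneg_right (hξ h) (hψ0 ξ)
    · simp [hψU ξ h]
  rw [integral_eq_lintegral_pos_part_sub_lintegral_neg_part hE] at hle
  have hneg : ∫⁻ z, ENNReal.ofReal (-energyIntegrand s p d u ψ z) ∂(volume.prod volume) ≠ ⊤ :=
    hE.neg.lintegral_lt_top.ne
  rw [← ofReal_integral_eq_lintegral_ofReal hψi (ae_of_all _ hψ0),
    ← ENNReal.ofReal_mul' (integral_nonneg hψ0), ← ENNReal.ofReal_toReal hE.lintegral_lt_top.ne,
    ← ENNReal.ofReal_toReal hneg]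
  refine (ENNReal.ofReal_le_ofReal ?_).trans ENNReal.ofReal_add_le
  linarith

theorem IsComparable.lintegral_neg_energyIntegrand_le_of_tendsto (hd : IsComparable d) (hp : 0 < p)
    (hu : Measurable u) {φ : ℕ → Heis n → ℝ} (hφ : ∀ i, Measurable (φ i)) (hψ : Measurable ψ)
    (hφψ : Tendsto (fun i => eLpNorm (φ i - ψ) (ENNReal.ofReal p) volume) atTop (𝓝 0))
    {G : ℕ → ℝ≥0∞} {L : ℝ≥0∞} (hG : ∀ᶠ i in atTop,
      ∫⁻ z, ENNReal.ofReal (-energyIntegrand s p d u (φ i) z) ∂(volume.prod volume) ≤ G i)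
    (hGL : Tendsto G atTop (𝓝 L)) :
    ∫⁻ z, ENNReal.ofReal (-energyIntegrand s p d u ψ z) ∂(volume.prod volume) ≤ L := by
  obtain ⟨ns, hns, hlim⟩ := (tendstoInMeasure_of_tendsto_eLpNorm (by simpa using hp)
    (fun i => (hφ i).aestronglyMeasurable) hψ.aestronglyMeasurable hφψ).exists_seq_tendsto_ae
  have tendsto_energy : ∀ᵐ z ∂((volume : Measure (Heis n)).prod volume), Tendsto
      (fun i => ENNReal.ofReal (-energyIntegrand s p d u (φ (ns i)) z)) atTop
      (𝓝 (ENNReal.ofReal (-energyIntegrand s p d u ψ z))) := by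
    filter_upwards [Measure.quasiMeasurePreserving_fst.ae hlim,
      Measure.quasiMeasurePreserving_snd.ae hlim] with z h₁ h₂
    exact ENNReal.tendsto_ofReal ((tendsto_const_nhds.mul (h₁.sub h₂)).div_const _).neg
  calc ∫⁻ z, ENNReal.ofReal (-energyIntegrand s p d u ψ z) ∂(volume.prod volume)
      = ∫⁻ z, liminf (fun i => ENNReal.ofReal (-energyIntegrand s p d u (φ (ns i)) z)) atTop
          ∂(volume.prod volume) :=
        lintegral_congr_ae (tendsto_energy.mono fun z hz => hz.liminf_eq.symm)
    _ ≤ liminf (fun i => ∫⁻ z, ENNReal.ofReal (-energyIntegrand s p d u (φ (ns i)) z)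
          ∂(volume.prod volume)) atTop :=
        lintegral_liminf_le fun i => (hd.measurable_energyIntegrand hu (hφ _)).neg.ennreal_ofReal
    _ ≤ liminf (fun i => G (ns i)) atTop :=
        liminf_le_liminf (hns.tendsto_atTop.eventually hG)
    _ = L := (hGL.comp hns.tendsto_atTop).liminf_eq

theorem IsWeakSupersolution.lintegral_neg_energy_le (hu : IsWeakSupersolution s p d f Ω u)
    (hs : 0 < s) (hs1 : s < 1) (hp : 1 < p) (hd : IsComparable d) (hum : Measurable u)
    (hU : IsOpen U) (hUc : IsCompact (closure U)) (hUΩ : closure U ⊆ Ω) (hK : IsCompact K)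
    (hKU : K ⊆ U) {F : ℝ} (hF : ∀ᵐ ξ ∂(volume.restrict U), |f ξ (u ξ)| ≤ F) (hψm : Measurable ψ)
    (hψ0 : ∀ ξ, 0 ≤ ψ ξ) (hψK : ∀ ξ, ξ ∉ K → ψ ξ = 0) (hψp : MemLp ψ (ENNReal.ofReal p))
    (hψs : MemLp (diffQuot (homDim n / p + s) ψ) (ENNReal.ofReal p) (volume.prod volume)) :
    ∫⁻ z, ENNReal.ofReal (-energyIntegrand s p d u ψ z) ∂(volume.prod volume) ≤
      ∫⁻ z, ENNReal.ofReal (energyIntegrand s p d u ψ z) ∂(volume.prod volume)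
        + ENNReal.ofReal F * ∫⁻ ξ, ENNReal.ofReal (ψ ξ) := by
  have hψi : Integrable ψ := integrable_of_memLp_of_isCompact hp.le hK hψK hψp
  obtain ⟨K', hK', hKK', hK'U, hmol⟩ := exists_compact_mollify_eq_zero hK hU hKU
  have hψK' : ∀ ξ, ξ ∉ K' → ψ ξ = 0 := fun ξ h => hψK ξ fun h' => h (interior_subset (hKK' h'))
  set φ : ℕ → Heis n → ℝ := fun i => mollify (mollifier n i) ψ
  have hφs i : ContDiff ℝ ∞ (φ i) :=
    contDiff_mollify (contDiff_mollifier i) (hasCompactSupport_mollifier i) hψi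
  have hφm i : Measurable (φ i) := (hφs i).continuous.measurable
  have hφ0 i : ∀ ξ, 0 ≤ φ i ξ := mollify_nonneg (mollifier_nonneg i) hψ0
  obtain ⟨A, hA, henergy⟩ := hd.exists_lintegral_energyIntegrand_le hs hs1 hp hum
    (hu.memLoc U hU hUc hUΩ) hu.negPart hU hUc hK' hK'U
  set Ep := ∫⁻ z, ENNReal.ofReal (energyIntegrand s p d u ψ z) ∂(volume.prod volume)
  set M := ∫⁻ ξ, ENNReal.ofReal (ψ ξ)
  set a : ℕ → ℝ≥0∞ := fun i => eLpNorm (φ i - ψ) (ENNReal.ofReal p) volume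
  set b : ℕ → ℝ≥0∞ := fun i => eLpNorm (diffQuot (homDim n / p + s) (φ i)
    - diffQuot (homDim n / p + s) ψ) (ENNReal.ofReal p) (volume.prod volume)
  have ha : Tendsto a atTop (𝓝 0) := tendsto_eLpNorm_mollify_sub hp.le hψm hψp
  have hb : Tendsto b atTop (𝓝 0) := tendsto_eLpNorm_diffQuot_mollify_sub hp.le hψm hψi hψs
  have hD : A + ENNReal.ofReal F * volume K' ^ (1 - 1 / p) ≠ ⊤ :=
    ENNReal.add_ne_top.2 ⟨hA, ENNReal.mul_ne_top ENNReal.ofReal_ne_top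
      (ENNReal.rpow_ne_top_of_nonneg (by rw [sub_nonneg, div_le_one] <;> linarith)
        hK'.measure_lt_top.ne)⟩
  refine hd.lintegral_neg_energyIntegrand_le_of_tendsto (by linarith) hum hφm hψm ha
    (G := fun i => Ep + ENNReal.ofReal F * M
      + (A + ENNReal.ofReal F * volume K' ^ (1 - 1 / p)) * (b i + a i)) ?_ ?_
  · filter_upwards [hmol ψ hψK] with i hi
    have hts : tsupport (φ i) ⊆ K' :=
      closure_minimal (fun ξ hξ => by_contra fun h => hξ (hi ξ h)) hK'.isClosed
    calc _ ≤ _ := hu.lintegral_neg_energy_le_of_contDiff hU.measurableSet hF (hφs i)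
          (HasCompactSupport.intro hK' hi) (hts.trans (hK'U.trans (subset_closure.trans hUΩ)))
          (hφ0 i) fun ξ hξ => hi ξ fun h => hξ (hK'U h)
      _ ≤ (Ep + A * (b i + a i))
          + ENNReal.ofReal F * (M + volume K' ^ (1 - 1 / p) * (b i + a i)) := by
          gcongr ?_ + _ * ?_
          · exact henergy ψ (φ i) hψm (hφm i) hψ0 (hφ0 i) hψK' hi
          · refine (lintegral_ofReal_le_add_eLpNorm_sub hp.le (hφm i) hψm hi hψK').trans ?_
            gcongr
            exact le_add_self
      _ = _ := by ring
  · simpa using tendsto_const_nhds.add (ENNReal.Tendsto.const_mul (hb.add ha) (Or.inr hD))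

end Heis

end

noncomputable section

theorem abs_rpow_sub_rpow_le {p a b : ℝ} (hp : 1 ≤ p) (ha : a ∈ Icc 0 1) (hb : b ∈ Icc 0 1) :
    |a ^ p - b ^ p| ≤ p * |a - b| := by
  wlog hab : b ≤ a generalizing a b
  · rw [abs_sub_comm, abs_sub_comm a]
    exact this hb ha (le_of_not_ge hab)
  have hpow : a ^ (p - 1) ≤ 1 := Real.rpow_le_one ha.1 ha.2 (by linarith)
  rw [abs_of_nonneg (sub_nonneg.2 (Real.rpow_le_rpow hb.1 hab (by linarith))),
    abs_of_nonneg (sub_nonneg.2 hab)]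
  calc a ^ p - b ^ p ≤ p * a ^ (p - 1) * (a - b) := rpow_sub_rpow_le_mul_sub hb.1 hab hp
    _ ≤ p * 1 * (a - b) := by gcongr
    _ = p * (a - b) := by rw [mul_one]

theorem abs_mul_rpow_sub_mul_rpow_le {p w₁ w₂ a₁ a₂ : ℝ} (hp : 1 ≤ p) (hw₂ : 0 ≤ w₂)
    (h₁ : a₁ ∈ Icc 0 1) (h₂ : a₂ ∈ Icc 0 1) :
    |w₁ * a₁ ^ p - w₂ * a₂ ^ p| ≤ |w₁ - w₂| + p * (w₂ * |a₁ - a₂|) := by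
  have hpow : a₁ ^ p ≤ 1 := Real.rpow_le_one h₁.1 h₁.2 (by linarith)
  have hpow₀ : 0 ≤ a₁ ^ p := Real.rpow_nonneg h₁.1 p
  calc |w₁ * a₁ ^ p - w₂ * a₂ ^ p| = |(w₁ - w₂) * a₁ ^ p + w₂ * (a₁ ^ p - a₂ ^ p)| := by ring_nf
    _ ≤ |w₁ - w₂| * a₁ ^ p + w₂ * |a₁ ^ p - a₂ ^ p| := by
        refine (abs_add_le _ _).trans_eq ?_
        rw [abs_mul, abs_mul, abs_of_nonneg hpow₀, abs_of_nonneg hw₂]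
    _ ≤ |w₁ - w₂| * 1 + w₂ * (p * |a₁ - a₂|) := by
        gcongr
        exact abs_rpow_sub_rpow_le hp h₁ h₂
    _ = |w₁ - w₂| + p * (w₂ * |a₁ - a₂|) := by ring

namespace Heis

variable {n : ℕ} {s p k R δ : ℝ} {u φ : Heis n → ℝ} {ξ₀ ξ η : Heis n}

/-! ### Cutoff functions -/

/-- The Lipschitz cutoff function equal to `1` on `B_R(ξ₀)` and to `0` off `B_{R+δ}(ξ₀)`. -/
def cutoff (ξ₀ : Heis n) (R δ : ℝ) (ξ : Heis n) : ℝ :=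
  max (min ((R + δ - hdist ξ₀ ξ) / δ) 1) 0

theorem cutoff_mem_Icc (ξ₀ : Heis n) (R δ : ℝ) (ξ : Heis n) : cutoff ξ₀ R δ ξ ∈ Icc 0 1 :=
  ⟨le_max_right _ _, max_le (min_le_right _ _) zero_le_one⟩

theorem cutoff_eq_one (hδ : 0 < δ) (h : ξ ∈ hball ξ₀ R) : cutoff ξ₀ R δ ξ = 1 := by
  have hξ := mem_hball.1 h
  rw [cutoff, min_eq_right ((le_div_iff₀ hδ).2 (by linarith)), max_eq_left zero_le_one]

theorem cutoff_eq_zero (hδ : 0 < δ) (h : ξ ∉ hball ξ₀ (R + δ)) : cutoff ξ₀ R δ ξ = 0 := by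
  have hξ := not_lt.1 (mt mem_hball.2 h)
  exact max_eq_right ((min_le_left _ _).trans
    (div_nonpos_of_nonpos_of_nonneg (by linarith) hδ.le))

theorem measurable_cutoff (ξ₀ : Heis n) (R δ : ℝ) : Measurable (cutoff ξ₀ R δ) := by
  unfold cutoff
  fun_prop

theorem abs_cutoff_sub_le (ξ₀ : Heis n) (R : ℝ) (hδ : 0 < δ) (ξ η : Heis n) :
    |cutoff ξ₀ R δ ξ - cutoff ξ₀ R δ η| ≤ min 1 (δ⁻¹ * hdist η ξ) := by
  have hξ := cutoff_mem_Icc ξ₀ R δ ξ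
  have hη := cutoff_mem_Icc ξ₀ R δ η
  refine le_min (abs_sub_le_of_nonneg_of_le hξ.1 hξ.2 hη.1 hη.2) ?_
  calc |cutoff ξ₀ R δ ξ - cutoff ξ₀ R δ η|
      ≤ |min ((R + δ - hdist ξ₀ ξ) / δ) 1 - min ((R + δ - hdist ξ₀ η) / δ) 1| :=
        abs_max_sub_max_le_abs _ _ _
    _ ≤ |(R + δ - hdist ξ₀ ξ) / δ - (R + δ - hdist ξ₀ η) / δ| := by
        refine (abs_min_sub_min_le_max _ _ _ _).trans_eq ?_
        rw [sub_self, abs_zero, max_eq_left (abs_nonneg _)]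
    _ = δ⁻¹ * |hdist ξ₀ η - hdist ξ₀ ξ| := by
        rw [← sub_div, abs_div, abs_of_pos hδ, div_eq_inv_mul]
        ring_nf
    _ ≤ δ⁻¹ * hdist η ξ := by
        have hηξ := hdist_triangle ξ₀ η ξ
        have hξη := hdist_triangle ξ₀ ξ η
        rw [hdist_comm ξ η] at hξη
        gcongr
        exact abs_le.2 ⟨by linarith, by linarith⟩

theorem cutKernel_inv_mul_comm (s p L : ℝ) (ξ η : Heis n) :
    cutKernel s p L (η⁻¹ * ξ) = cutKernel s p L (ξ⁻¹ * η) := by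
  rw [cutKernel, cutKernel, ← hdist, ← hdist, hdist_comm]

theorem measurable_cutKernel_inv_mul (s p L : ℝ) :
    Measurable fun z : Heis n × Heis n => cutKernel s p L (z.2⁻¹ * z.1) :=
  (measurable_cutKernel s p L).comp (measurable_snd.inv.mul measurable_fst)

theorem lintegral_fst_mul_cutKernel (s p : ℝ) {L : ℝ} (hL : 0 < L) {g : Heis n → ℝ≥0∞}
    (hg : Measurable g) :
    ∫⁻ z, g z.1 * cutKernel s p L (z.2⁻¹ * z.1) ∂((volume : Measure (Heis n)).prod volume)
      = (∫⁻ ξ, g ξ) * (ENNReal.ofReal (L ^ (s * p)) * ∫⁻ h : Heis n, cutKernel s p 1 h) := by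
  have hmeas : Measurable fun z : Heis n × Heis n => g z.1 * cutKernel s p L (z.2⁻¹ * z.1) :=
    (hg.comp measurable_fst).mul (measurable_cutKernel_inv_mul s p L)
  rw [lintegral_prod _ hmeas.aemeasurable, ← lintegral_mul_const _ hg]
  refine lintegral_congr fun ξ => ?_
  simp only [cutKernel_inv_mul_comm s p L ξ]
  rw [lintegral_const_mul _ (by fun_prop),
    lintegral_mul_left_eq_self (cutKernel s p L), lintegral_cutKernel s p hL]

theorem enorm_cutoff_sub_rpow_mul_kern_le (s : ℝ) (hp : 0 ≤ p) (ξ₀ : Heis n) (R : ℝ) (hδ : 0 < δ)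
    (ξ η : Heis n) :
    ‖cutoff ξ₀ R δ ξ - cutoff ξ₀ R δ η‖ₑ ^ p * kern (homDim n + s * p) ξ η
      ≤ cutKernel s p δ⁻¹ (η⁻¹ * ξ) := by
  rw [Real.enorm_eq_ofReal_abs, ENNReal.ofReal_rpow_of_nonneg (abs_nonneg _) hp, kern,
    ← ENNReal.ofReal_mul (by positivity), cutKernel]
  exact ENNReal.ofReal_le_ofReal (mul_le_mul_of_nonneg_right
    (Real.rpow_le_rpow (abs_nonneg _) (abs_cutoff_sub_le ξ₀ R hδ ξ η) hp)
    (Real.rpow_nonneg (hdist_nonneg η ξ) _))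

theorem enorm_diffQuot_cutoff_rpow_le (s : ℝ) (hp : 0 < p) (ξ₀ : Heis n) (R : ℝ) (hδ : 0 < δ)
    (z : Heis n × Heis n) :
    ‖diffQuot (homDim n / p + s) (cutoff ξ₀ R δ) z‖ₑ ^ p ≤ cutKernel s p δ⁻¹ (z.2⁻¹ * z.1) := by
  have hexp : (homDim n / p + s) * p = homDim n + s * p := by field_simp
  rw [enorm_diffQuot, ENNReal.mul_rpow_of_nonneg _ _ hp.le, kern_rpow hp.le, hexp]
  exact enorm_cutoff_sub_rpow_mul_kern_le s hp.le ξ₀ R hδ z.1 z.2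

theorem memLp_fst_mul_diffQuot_cutoff {w : Heis n → ℝ} (hs : 0 < s) (hs1 : s < 1) (hp : 0 < p)
    (hδ : 0 < δ) (hwm : Measurable w) (hw : MemLp w (ENNReal.ofReal p)) :
    MemLp (fun z : Heis n × Heis n => w z.1 * diffQuot (homDim n / p + s) (cutoff ξ₀ R δ) z)
      (ENNReal.ofReal p) (volume.prod volume) := by
  refine ⟨((hwm.comp measurable_fst).mul
    (measurable_diffQuot _ (measurable_cutoff ξ₀ R δ))).aestronglyMeasurable, ?_⟩
  rw [← ENNReal.rpow_lt_top_iff_of_pos hp, ← lintegral_enorm_rpow_eq_eLpNorm_rpow hp]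
  calc ∫⁻ z, ‖w z.1 * diffQuot (homDim n / p + s) (cutoff ξ₀ R δ) z‖ₑ ^ p ∂volume.prod volume
      ≤ ∫⁻ z, ‖w z.1‖ₑ ^ p * cutKernel s p δ⁻¹ (z.2⁻¹ * z.1) ∂volume.prod volume := by
        refine lintegral_mono fun z => ?_
        rw [enorm_mul, ENNReal.mul_rpow_of_nonneg _ _ hp.le]
        gcongr
        exact enorm_diffQuot_cutoff_rpow_le s hp ξ₀ R hδ z
    _ = (∫⁻ ξ, ‖w ξ‖ₑ ^ p)
        * (ENNReal.ofReal (δ⁻¹ ^ (s * p)) * ∫⁻ h : Heis n, cutKernel s p 1 h) :=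
        lintegral_fst_mul_cutKernel s p (inv_pos.2 hδ) (hwm.enorm.pow_const p)
    _ < ⊤ := by
        rw [lintegral_enorm_rpow_eq_eLpNorm_rpow hp]
        exact ENNReal.mul_lt_top (ENNReal.rpow_lt_top_of_nonneg hp.le hw.2.ne)
          (ENNReal.mul_lt_top ENNReal.ofReal_lt_top (lintegral_cutKernel_one_lt_top hs hs1 hp))

theorem norm_diffQuot (α : ℝ) (ψ : Heis n → ℝ) (z : Heis n × Heis n) :
    ‖diffQuot α ψ z‖ = |ψ z.1 - ψ z.2| * hdist z.2 z.1 ^ (-α) := by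
  rw [diffQuot, norm_mul, Real.norm_eq_abs,
    Real.norm_of_nonneg (Real.rpow_nonneg (hdist_nonneg _ _) _)]

theorem norm_diffQuot_swap (α : ℝ) (ψ : Heis n → ℝ) (z : Heis n × Heis n) :
    ‖diffQuot α ψ z.swap‖ = ‖diffQuot α ψ z‖ := by
  rw [norm_diffQuot, norm_diffQuot, Prod.fst_swap, Prod.snd_swap, hdist_comm, abs_sub_comm]

/-! ### The truncated test function -/

/-- The truncation `(k - u)_+`. -/
def deficit (k : ℝ) (u : Heis n → ℝ) (ξ : Heis n) : ℝ := max (k - u ξ) 0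

theorem deficit_nonneg (k : ℝ) (u : Heis n → ℝ) (ξ : Heis n) : 0 ≤ deficit k u ξ :=
  le_max_right _ _

theorem deficit_of_le (h : k ≤ u ξ) : deficit k u ξ = 0 := max_eq_right (sub_nonpos.2 h)

theorem ofReal_deficit (k : ℝ) (u : Heis n → ℝ) (ξ : Heis n) :
    ENNReal.ofReal (deficit k u ξ) = ENNReal.ofReal (k - u ξ) := by
  rw [deficit, ENNReal.ofReal_max, ENNReal.ofReal_zero, max_eq_left zero_le]

@[fun_prop]
theorem measurable_deficit (k : ℝ) (hu : Measurable u) : Measurable (deficit k u) := by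
  unfold deficit
  fun_prop

theorem abs_deficit_sub_le (k : ℝ) (u : Heis n → ℝ) (ξ η : Heis n) :
    |deficit k u ξ - deficit k u η| ≤ |u ξ - u η| := by
  refine (abs_max_sub_max_le_abs _ _ _).trans_eq ?_
  rw [sub_sub_sub_cancel_left, abs_sub_comm]

theorem memLp_deficit {B : Set (Heis n)} (hB : IsCompact (closure B)) (k : ℝ)
    (hu : MemLp u (ENNReal.ofReal p) (volume.restrict B)) :
    MemLp (deficit k u) (ENNReal.ofReal p) (volume.restrict B) := by
  have : IsFiniteMeasure (volume.restrict B) :=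
    ⟨by simpa using (measure_mono subset_closure).trans_lt hB.measure_lt_top⟩
  exact ((memLp_const k).sub hu).pos_part

/-- The test function `(k - u)_+ φ^p`. -/
def testFun (p k : ℝ) (u φ : Heis n → ℝ) (ξ : Heis n) : ℝ := deficit k u ξ * φ ξ ^ p

theorem measurable_testFun (p k : ℝ) (hu : Measurable u) (hφ : Measurable φ) :
    Measurable (testFun p k u φ) :=
  (measurable_deficit k hu).mul (hφ.pow_const p)

theorem testFun_nonneg (hφ : 0 ≤ φ ξ) : 0 ≤ testFun p k u φ ξ :=
  mul_nonneg (deficit_nonneg k u ξ) (Real.rpow_nonneg hφ p)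

theorem testFun_le_deficit (hp : 0 ≤ p) (hφ : φ ξ ∈ Icc 0 1) :
    testFun p k u φ ξ ≤ deficit k u ξ :=
  mul_le_of_le_one_right (deficit_nonneg k u ξ) (Real.rpow_le_one hφ.1 hφ.2 hp)

theorem testFun_eq_zero (hp : 0 < p) (hφ : φ ξ = 0) : testFun p k u φ ξ = 0 := by
  rw [testFun, hφ, Real.zero_rpow hp.ne', mul_zero]

theorem testFun_le_mul (hp : 1 ≤ p) (hφ : φ ξ ∈ Icc 0 1) :
    testFun p k u φ ξ ≤ deficit k u ξ * φ ξ := by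
  refine mul_le_mul_of_nonneg_left ?_ (deficit_nonneg k u ξ)
  simpa using Real.rpow_le_rpow_of_exponent_ge' hφ.1 hφ.2 zero_le_one hp

theorem memLp_testFun {B : Set (Heis n)} (hp : 0 < p) (hB : MeasurableSet B)
    (hum : Measurable u) (hφm : Measurable φ) (hφ : ∀ ξ, φ ξ ∈ Icc 0 1)
    (hφB : ∀ ξ, ξ ∉ B → φ ξ = 0)
    (hk : MemLp (deficit k u) (ENNReal.ofReal p) (volume.restrict B)) :
    MemLp (testFun p k u φ) (ENNReal.ofReal p) := by
  refine ((memLp_indicator_iff_restrict hB).2 hk).mono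
    (measurable_testFun p k hum hφm).aestronglyMeasurable (ae_of_all _ fun ξ => ?_)
  rw [Real.norm_of_nonneg (testFun_nonneg (hφ ξ).1)]
  by_cases hξ : ξ ∈ B
  · rw [indicator_of_mem hξ, Real.norm_of_nonneg (deficit_nonneg k u ξ)]
    exact testFun_le_deficit hp.le (hφ ξ)
  · rw [testFun_eq_zero hp (hφB ξ hξ)]
    exact norm_nonneg _

theorem abs_testFun_sub_le {B : Set (Heis n)} (hp : 1 ≤ p) (hφ : ∀ ξ, φ ξ ∈ Icc 0 1)
    (hφB : ∀ ξ, ξ ∉ B → φ ξ = 0) (z : Heis n × Heis n) :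
    |testFun p k u φ z.1 - testFun p k u φ z.2| ≤
      (B ×ˢ B).indicator (fun z => |u z.1 - u z.2|) z
        + p * ((B.indicator (deficit k u) z.1 + B.indicator (deficit k u) z.2)
          * |φ z.1 - φ z.2|) := by
  have hp₀ : 0 < p := by linarith
  have hw : ∀ ξ, 0 ≤ B.indicator (deficit k u) ξ :=
    indicator_nonneg fun ξ _ => deficit_nonneg k u ξ
  have one_outside : ∀ ξ η, ξ ∈ B → η ∉ B →
      |testFun p k u φ ξ - testFun p k u φ η| ≤
        p * ((B.indicator (deficit k u) ξ + B.indicator (deficit k u) η) * |φ ξ - φ η|) := by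
    intro ξ η hξ hη
    rw [testFun_eq_zero hp₀ (hφB η hη), hφB η hη, sub_zero, sub_zero, indicator_of_mem hξ,
      indicator_of_notMem hη, add_zero, abs_of_nonneg (testFun_nonneg (hφ ξ).1),
      abs_of_nonneg (hφ ξ).1]
    exact (testFun_le_mul hp (hφ ξ)).trans
      (le_mul_of_one_le_left (mul_nonneg (deficit_nonneg k u ξ) (hφ ξ).1) hp)
  obtain ⟨ξ, η⟩ := z
  by_cases hξ : ξ ∈ B <;> by_cases hη : η ∈ B
  · rw [indicator_of_mem (mk_mem_prod hξ hη)]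
    refine (abs_mul_rpow_sub_mul_rpow_le hp (deficit_nonneg k u η) (hφ ξ) (hφ η)).trans
      (add_le_add (abs_deficit_sub_le k u ξ η) ?_)
    rw [indicator_of_mem hη]
    gcongr
    exact le_add_of_nonneg_left (hw ξ)
  · simpa [hη] using one_outside ξ η hξ hη
  · simpa [hξ, abs_sub_comm, add_comm] using one_outside η ξ hη hξ
  · simp [hξ, hη, testFun_eq_zero hp₀ (hφB ξ hξ), testFun_eq_zero hp₀ (hφB η hη)]

theorem memLp_diffQuot_testFun (hs : 0 < s) (hs1 : s < 1) (hp : 1 < p) (hδ : 0 < δ) (k : ℝ)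
    (hum : Measurable u) (hu : MemFracSobolev s p (hball ξ₀ (R + δ)) u) :
    MemLp (diffQuot (homDim n / p + s) (testFun p k u (cutoff ξ₀ R δ))) (ENNReal.ofReal p)
      (volume.prod volume) := by
  set B := hball ξ₀ (R + δ)
  set α := homDim n / p + s
  set φ := cutoff ξ₀ R δ
  set w := B.indicator (deficit k u)
  have hBm : MeasurableSet B := measurableSet_hball ξ₀ _
  have hw : MemLp w (ENNReal.ofReal p) := (memLp_indicator_iff_restrict hBm).2
    (memLp_deficit (isCompact_closure_hball ξ₀ _) k hu.1)
  have hwm : Measurable w := (measurable_deficit k hum).indicator hBm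
  let g : Heis n × Heis n → ℝ := fun z => w z.1 * diffQuot α φ z
  have hg : MemLp g (ENNReal.ofReal p) (volume.prod volume) :=
    memLp_fst_mul_diffQuot_cutoff hs hs1 (by linarith) hδ hwm hw
  have hg_swap : MemLp (g ∘ Prod.swap) (ENNReal.ofReal p) (volume.prod volume) :=
    hg.comp_measurePreserving Measure.measurePreserving_swap
  have hBB : MemLp ((B ×ˢ B).indicator (diffQuot α u)) (ENNReal.ofReal p)
      (volume.prod volume) := by
    rw [memLp_indicator_iff_restrict (hBm.prod hBm), ← Measure.prod_restrict]
    exact hu.memLp_diffQuot hum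
  have hbound : MemLp (fun z : Heis n × Heis n => ‖(B ×ˢ B).indicator (diffQuot α u) z‖
      + p * (‖g z‖ + ‖(g ∘ Prod.swap) z‖)) (ENNReal.ofReal p)
      (volume.prod volume) := hBB.norm.add ((hg.norm.add hg_swap.norm).const_mul p)
  refine hbound.mono' (measurable_diffQuot α (measurable_testFun p k hum
    (measurable_cutoff ξ₀ R δ))).aestronglyMeasurable (ae_of_all _ fun z => ?_)
  have hφ₀ : ∀ ξ, ξ ∉ B → φ ξ = 0 := fun ξ => cutoff_eq_zero hδ
  have hw₀ : ∀ ξ, ‖w ξ‖ = w ξ := fun ξ =>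
    Real.norm_of_nonneg (indicator_nonneg (fun ξ _ => deficit_nonneg k u ξ) ξ)
  have hkern : 0 ≤ hdist z.2 z.1 ^ (-α) := Real.rpow_nonneg (hdist_nonneg _ _) _
  have hpt := mul_le_mul_of_nonneg_right
    (abs_testFun_sub_le (k := k) (u := u) hp.le (cutoff_mem_Icc ξ₀ R δ) hφ₀ z) hkern
  simp only [g, Function.comp_apply, Prod.fst_swap]
  rw [norm_indicator_eq_indicator_norm, norm_mul, norm_mul, hw₀, hw₀, norm_diffQuot,
    norm_diffQuot_swap, norm_diffQuot]
  refine hpt.trans_eq ?_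
  by_cases hz : z ∈ B ×ˢ B <;> simp only [hz, indicator_of_mem, indicator_of_notMem,
    not_false_eq_true, norm_diffQuot] <;> ring

end Heis

end

noncomputable section

namespace Heis

variable {n : ℕ} {s p k R δ : ℝ} {u φ d : Heis n → ℝ} {ξ₀ ξ η : Heis n}

/-! ### The Caccioppoli inequality -/

theorem flux_mul_sub_le (hp : 1 < p) (k a b : ℝ) {φ₁ φ₂ : ℝ} (h₁ : 0 ≤ φ₁) (h₂ : 0 ≤ φ₂) :
    flux p (a - b) * (max (k - a) 0 * φ₁ ^ p - max (k - b) 0 * φ₂ ^ p) ≤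
      p ^ p * ((max (k - a) 0 ^ p + max (k - b) 0 ^ p) * |φ₁ - φ₂| ^ p) := by
  wlog hab : a ≤ b generalizing a b φ₁ φ₂
  · have hswap := this b a h₂ h₁ (le_of_not_ge hab)
    rw [← neg_sub a b, flux_neg, neg_mul_comm, neg_sub, abs_sub_comm, add_comm] at hswap
    exact hswap
  have hb : 0 ≤ max (k - b) 0 := le_max_right _ _
  have hflux : flux p (a - b) = -(b - a) ^ (p - 1) := by
    rw [← neg_sub b a, flux_neg, flux_of_nonneg hp (sub_nonneg.2 hab)]
  have hJ : 0 ≤ (b - a) ^ (p - 1) := Real.rpow_nonneg (sub_nonneg.2 hab) _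
  rw [hflux, neg_mul_comm, neg_sub]
  rcases le_or_gt k b with hkb | hkb
  · rw [max_eq_right (sub_nonpos.2 hkb), zero_mul, zero_sub, mul_neg]
    exact (neg_nonpos.2 (mul_nonneg hJ (by positivity))).trans (by positivity)
  · have hba : b - a = max (k - a) 0 - max (k - b) 0 := by
      rw [max_eq_left (by linarith), max_eq_left (by linarith)]
      ring
    rw [hba, abs_sub_comm]
    refine (sub_rpow_mul_sub_le hp hb (max_le_max (by linarith) le_rfl) h₁ h₂).trans ?_
    gcongr
    exact le_add_of_nonneg_right (by positivity)

theorem ofReal_flux_mul_testFun_sub_le (hp : 1 < p) (k : ℝ) (u : Heis n → ℝ) (hξ : 0 ≤ φ ξ)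
    (hη : 0 ≤ φ η) :
    ENNReal.ofReal (flux p (u ξ - u η) * (testFun p k u φ ξ - testFun p k u φ η)) ≤
      ENNReal.ofReal (p ^ p) *
        ((ENNReal.ofReal (k - u ξ) ^ p + ENNReal.ofReal (k - u η) ^ p) * ‖φ ξ - φ η‖ₑ ^ p) := by
  have hp₀ : 0 ≤ p := by linarith
  have hξk := deficit_nonneg k u ξ
  have hηk := deficit_nonneg k u η
  rw [← ofReal_deficit k u ξ, ← ofReal_deficit k u η, Real.enorm_eq_ofReal_abs,
    ENNReal.ofReal_rpow_of_nonneg hξk hp₀, ENNReal.ofReal_rpow_of_nonneg hηk hp₀,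
    ENNReal.ofReal_rpow_of_nonneg (abs_nonneg _) hp₀, ← ENNReal.ofReal_add (by positivity)
    (by positivity), ← ENNReal.ofReal_mul (by positivity), ← ENNReal.ofReal_mul (by positivity)]
  exact ENNReal.ofReal_le_ofReal (flux_mul_sub_le hp k _ _ hξ hη)

theorem ofReal_flux_mul_testFun_le (hp : 1 < p) (k : ℝ) (u : Heis n → ℝ) (hφ : φ ξ ∈ Icc 0 1)
    (η : Heis n) :
    ENNReal.ofReal (flux p (u ξ - u η) * testFun p k u φ ξ) ≤
      ENNReal.ofReal (k - u ξ) * ENNReal.ofReal (k - u η) ^ (p - 1) := by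
  rw [ENNReal.ofReal_mul' (testFun_nonneg hφ.1), ofReal_flux hp, mul_comm]
  have htest : ENNReal.ofReal (testFun p k u φ ξ) ≤ ENNReal.ofReal (k - u ξ) :=
    (ENNReal.ofReal_le_ofReal (testFun_le_deficit (by linarith) hφ)).trans_eq
      (ofReal_deficit k u ξ)
  rcases le_or_gt k (u ξ) with hk | hk
  · rw [ENNReal.ofReal_of_nonpos (sub_nonpos.2 hk)] at htest ⊢
    simp [le_zero_iff.1 htest]
  · gcongr

theorem ofReal_rpow_le_neg_flux_mul (hp : 1 < p) {a b : ℝ} (hb : k ≤ b) :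
    ENNReal.ofReal (k - a) ^ p ≤ ENNReal.ofReal (-(flux p (a - b) * max (k - a) 0)) := by
  rw [← neg_mul, ← flux_neg, neg_sub, ENNReal.ofReal_mul' (le_max_right _ _), ofReal_flux hp,
    ENNReal.ofReal_max, ENNReal.ofReal_zero, max_eq_left zero_le]
  calc ENNReal.ofReal (k - a) ^ p
      = ENNReal.ofReal (k - a) ^ (p - 1) * ENNReal.ofReal (k - a) := by
        nth_rw 3 [← ENNReal.rpow_one (ENNReal.ofReal (k - a))]
        rw [← ENNReal.rpow_add_of_nonneg _ _ (by linarith) zero_le_one, sub_add_cancel]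
    _ ≤ _ := by gcongr

/-- The tail `∫_{ℍⁿ ∖ B_ρ(ξ₀)} (k - u(η))_+^(p-1) |η⁻¹ ∘ ξ₀|^(-Q-sp) dη` of `(k - u)_+`. -/
def tail (s p k : ℝ) (u : Heis n → ℝ) (ξ₀ : Heis n) (ρ : ℝ) : ℝ≥0∞ :=
  ∫⁻ η in (hball ξ₀ ρ)ᶜ, ENNReal.ofReal (k - u η) ^ (p - 1) * kern (homDim n + s * p) η ξ₀

theorem tail_mono (s : ℝ) (hp : 1 ≤ p) (u : Heis n → ℝ) (ξ₀ : Heis n) {k k' ρ ρ' : ℝ}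
    (hk : k ≤ k') (hρ : ρ' ≤ ρ) : tail s p k u ξ₀ ρ ≤ tail s p k' u ξ₀ ρ' := by
  refine lintegral_mono' (Measure.restrict_mono (compl_subset_compl.2 (hball_mono hρ)) le_rfl)
    fun η => ?_
  dsimp only
  gcongr

theorem kern_le_mul_kern_of_mem_hball {q : ℝ} (hq : 0 ≤ q) (hR : 0 < R) (hδ : 0 < δ)
    (hξ : ξ ∈ hball ξ₀ (R + δ)) (hη : η ∉ hball ξ₀ (R + 2 * δ)) :
    kern q ξ η ≤ ENNReal.ofReal (((R + 2 * δ) / δ) ^ q) * kern q η ξ₀ := by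
  have hξ' := mem_hball.1 hξ
  have hη' := not_lt.1 (mt mem_hball.2 hη)
  have htri := hdist_triangle ξ₀ ξ η
  rw [hdist_comm ξ η] at htri
  have hpos₀ : 0 < hdist ξ₀ η := by linarith
  have hpos : 0 < hdist η ξ := by linarith
  have hcomp : hdist ξ₀ η ≤ (R + 2 * δ) / δ * hdist η ξ := by
    rw [div_mul_eq_mul_div, le_div_iff₀ hδ]
    nlinarith
  rw [kern, kern, ← ENNReal.ofReal_mul (by positivity)]
  refine ENNReal.ofReal_le_ofReal ?_
  rw [Real.rpow_neg hpos.le, Real.rpow_neg hpos₀.le, ← div_eq_mul_inv,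
    le_div_iff₀ (by positivity), inv_mul_le_iff₀ (by positivity), mul_comm (hdist η ξ ^ q),
    ← Real.mul_rpow (by positivity) hpos.le]
  exact Real.rpow_le_rpow hpos₀.le hcomp hq

/-- The density whose integral over pairs of a point of a ball and a far point is controlled by the
tail of `(k - u)_+`. -/
def interaction (s p k : ℝ) (u : Heis n → ℝ) (z : Heis n × Heis n) : ℝ≥0∞ :=
  ENNReal.ofReal (k - u z.1) * ENNReal.ofReal (k - u z.2) ^ (p - 1)
    * kern (homDim n + s * p) z.1 z.2

theorem measurable_interaction (s p k : ℝ) (hu : Measurable u) :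
    Measurable (interaction s p k u) := by
  unfold interaction
  fun_prop

theorem setLIntegral_interaction_le_tail (hs : 0 ≤ s) (hp : 0 ≤ p) (k : ℝ) (hu : Measurable u)
    (hR : 0 < R) (hδ : 0 < δ) :
    ∫⁻ z in hball ξ₀ (R + δ) ×ˢ (hball ξ₀ (R + 2 * δ))ᶜ, interaction s p k u z
        ∂volume.prod volume ≤
      (∫⁻ ξ in hball ξ₀ (R + 2 * δ), ENNReal.ofReal (k - u ξ)) *
        (ENNReal.ofReal (((R + 2 * δ) / δ) ^ (homDim n + s * p)) *
          tail s p k u ξ₀ (R + 2 * δ)) := by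
  have hq : 0 ≤ homDim n + s * p := by have := homDim_pos (n := n); positivity
  set q := homDim n + s * p
  have tail_term_le : ∀ ξ ∈ hball ξ₀ (R + δ),
      ∫⁻ η in (hball ξ₀ (R + 2 * δ))ᶜ, ENNReal.ofReal (k - u η) ^ (p - 1) * kern q ξ η ≤
        ENNReal.ofReal (((R + 2 * δ) / δ) ^ q) * tail s p k u ξ₀ (R + 2 * δ) := by
    intro ξ hξ
    rw [tail, ← lintegral_const_mul _ (by fun_prop)]
    refine setLIntegral_mono' (measurableSet_hball _ _).compl fun η hη => ?_
    rw [mul_left_comm]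
    gcongr
    exact kern_le_mul_kern_of_mem_hball hq hR hδ hξ hη
  rw [← Measure.prod_restrict, lintegral_prod _ (measurable_interaction s p k hu).aemeasurable]
  simp only [interaction, mul_assoc]
  calc _ ≤ ∫⁻ ξ in hball ξ₀ (R + δ), ENNReal.ofReal (k - u ξ) *
        (ENNReal.ofReal (((R + 2 * δ) / δ) ^ q) * tail s p k u ξ₀ (R + 2 * δ)) := by
        refine setLIntegral_mono' (measurableSet_hball _ _) fun ξ hξ => ?_
        rw [lintegral_const_mul' _ _ ENNReal.ofReal_ne_top]
        gcongr
        exact tail_term_le ξ hξ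
    _ = _ := lintegral_mul_const _ (by fun_prop)
    _ ≤ _ := by
        gcongr
        exact hball_mono (by linarith)

theorem lintegral_add_mul_cutKernel (s p : ℝ) {L : ℝ} (hL : 0 < L) {g : Heis n → ℝ≥0∞}
    (hg : Measurable g) :
    ∫⁻ z, (g z.1 + g z.2) * cutKernel s p L (z.2⁻¹ * z.1) ∂(volume.prod volume)
      = 2 * ((∫⁻ ξ, g ξ) * (ENNReal.ofReal (L ^ (s * p)) * ∫⁻ h : Heis n, cutKernel s p 1 h)) := by
  have hfst := lintegral_fst_mul_cutKernel s p hL hg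
  have hsnd : ∫⁻ z, g z.2 * cutKernel s p L (z.2⁻¹ * z.1)
      ∂((volume : Measure (Heis n)).prod volume)
      = ∫⁻ z, g z.1 * cutKernel s p L (z.2⁻¹ * z.1) ∂(volume.prod volume) := by
    rw [← lintegral_prod_swap]
    simp only [Prod.fst_swap, Prod.snd_swap, cutKernel_inv_mul_comm s p L]
  have hmeas : Measurable fun z : Heis n × Heis n => g z.1 * cutKernel s p L (z.2⁻¹ * z.1) :=
    (hg.comp measurable_fst).mul (measurable_cutKernel_inv_mul s p L)
  simp only [add_mul]
  rw [lintegral_add_left hmeas, hsnd, hfst, two_mul]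

theorem IsComparable.ofReal_energyIntegrand_testFun_le_cutKernel (hd : IsComparable d)
    (hp : 1 < p) {C : ℝ≥0∞} (hC : ∀ ξ η, ENNReal.ofReal (dkern d (homDim n + s * p) ξ η)
      ≤ C * kern (homDim n + s * p) ξ η) (k : ℝ) (u : Heis n → ℝ) (ξ₀ : Heis n) (R : ℝ)
    (hδ : 0 < δ) (z : Heis n × Heis n) :
    ENNReal.ofReal (energyIntegrand s p d u (testFun p k u (cutoff ξ₀ R δ)) z) ≤
      C * (ENNReal.ofReal (p ^ p) *
        ((ENNReal.ofReal (k - u z.1) ^ p + ENNReal.ofReal (k - u z.2) ^ p)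
          * cutKernel s p δ⁻¹ (z.2⁻¹ * z.1))) := by
  rw [hd.ofReal_energyIntegrand]
  calc _ ≤ ENNReal.ofReal (p ^ p) *
        ((ENNReal.ofReal (k - u z.1) ^ p + ENNReal.ofReal (k - u z.2) ^ p) *
          ‖cutoff ξ₀ R δ z.1 - cutoff ξ₀ R δ z.2‖ₑ ^ p)
          * (C * kern (homDim n + s * p) z.1 z.2) := by
        gcongr
        · exact ofReal_flux_mul_testFun_sub_le hp k u (cutoff_mem_Icc ξ₀ R δ _).1
            (cutoff_mem_Icc ξ₀ R δ _).1
        · exact hC _ _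
    _ = C * (ENNReal.ofReal (p ^ p) *
        ((ENNReal.ofReal (k - u z.1) ^ p + ENNReal.ofReal (k - u z.2) ^ p) *
          (‖cutoff ξ₀ R δ z.1 - cutoff ξ₀ R δ z.2‖ₑ ^ p
            * kern (homDim n + s * p) z.1 z.2))) := by ring
    _ ≤ _ := by
        gcongr
        exact enorm_cutoff_sub_rpow_mul_kern_le s (by linarith) ξ₀ R hδ z.1 z.2

theorem IsComparable.ofReal_energyIntegrand_testFun_le_kern (hd : IsComparable d) (hp : 1 < p)
    {C : ℝ≥0∞} (hC : ∀ ξ η, ENNReal.ofReal (dkern d (homDim n + s * p) ξ η)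
      ≤ C * kern (homDim n + s * p) ξ η) (k : ℝ) (u : Heis n → ℝ) {z : Heis n × Heis n}
    (hφ : φ z.1 ∈ Icc 0 1) (hφ₀ : φ z.2 = 0) :
    ENNReal.ofReal (energyIntegrand s p d u (testFun p k u φ) z) ≤
      C * interaction s p k u z := by
  rw [hd.ofReal_energyIntegrand, testFun_eq_zero (by linarith) hφ₀, sub_zero, interaction,
    mul_left_comm]
  gcongr
  · exact ofReal_flux_mul_testFun_le hp k u hφ _
  · exact hC _ _

theorem IsComparable.ofReal_energyIntegrand_testFun_le_kern_swap (hd : IsComparable d)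
    (hp : 1 < p) {C : ℝ≥0∞} (hC : ∀ ξ η, ENNReal.ofReal (dkern d (homDim n + s * p) ξ η)
      ≤ C * kern (homDim n + s * p) ξ η) (k : ℝ) (u : Heis n → ℝ) {z : Heis n × Heis n}
    (hφ : φ z.2 ∈ Icc 0 1) (hφ₀ : φ z.1 = 0) :
    ENNReal.ofReal (energyIntegrand s p d u (testFun p k u φ) z) ≤
      C * interaction s p k u z.swap := by
  rw [hd.ofReal_energyIntegrand, testFun_eq_zero (by linarith) hφ₀, zero_sub, ← neg_mul_comm,
    ← flux_neg, neg_sub, interaction,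
    Prod.fst_swap, Prod.snd_swap, mul_left_comm, kern_comm]
  gcongr
  · exact ofReal_flux_mul_testFun_le hp k u hφ _
  · exact hC _ _

theorem IsComparable.ofReal_energyIntegrand_testFun_le (hd : IsComparable d) (hp : 1 < p)
    {C : ℝ≥0∞} (hC : ∀ ξ η, ENNReal.ofReal (dkern d (homDim n + s * p) ξ η)
      ≤ C * kern (homDim n + s * p) ξ η) (k : ℝ) (u : Heis n → ℝ) (hδ : 0 < δ) {B : Set (Heis n)}
    (hB : hball ξ₀ (R + δ) ⊆ B) (z : Heis n × Heis n) :
    ENNReal.ofReal (energyIntegrand s p d u (testFun p k u (cutoff ξ₀ R δ)) z) ≤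
      C * (ENNReal.ofReal (p ^ p) *
          ((B.indicator (fun ξ => ENNReal.ofReal (k - u ξ) ^ p) z.1
              + B.indicator (fun ξ => ENNReal.ofReal (k - u ξ) ^ p) z.2)
            * cutKernel s p δ⁻¹ (z.2⁻¹ * z.1))
        + ((hball ξ₀ (R + δ) ×ˢ Bᶜ).indicator (interaction s p k u) z
          + (hball ξ₀ (R + δ) ×ˢ Bᶜ).indicator (interaction s p k u) z.swap)) := by
  have energy_eq_zero (h₁ : z.1 ∉ hball ξ₀ (R + δ)) (h₂ : z.2 ∉ hball ξ₀ (R + δ)) :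
      energyIntegrand s p d u (testFun p k u (cutoff ξ₀ R δ)) z = 0 := by
    rw [energyIntegrand_eq, testFun_eq_zero (by linarith) (cutoff_eq_zero hδ h₁),
      testFun_eq_zero (by linarith) (cutoff_eq_zero hδ h₂), sub_zero, mul_zero, zero_mul]
  by_cases h₁ : z.1 ∈ B <;> by_cases h₂ : z.2 ∈ B
  · refine (hd.ofReal_energyIntegrand_testFun_le_cutKernel hp hC k u ξ₀ R hδ z).trans ?_
    rw [indicator_of_mem h₁, indicator_of_mem h₂]
    gcongr
    exact le_self_add
  · by_cases h₁R : z.1 ∈ hball ξ₀ (R + δ)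
    · refine (hd.ofReal_energyIntegrand_testFun_le_kern hp hC k u (cutoff_mem_Icc ξ₀ R δ _)
        (cutoff_eq_zero hδ fun h => h₂ (hB h))).trans ?_
      rw [indicator_of_mem (show z ∈ hball ξ₀ (R + δ) ×ˢ Bᶜ from ⟨h₁R, h₂⟩)]
      gcongr
      exact le_add_left le_self_add
    · simp [energy_eq_zero h₁R fun h => h₂ (hB h)]
  · by_cases h₂R : z.2 ∈ hball ξ₀ (R + δ)
    · refine (hd.ofReal_energyIntegrand_testFun_le_kern_swap hp hC k u (cutoff_mem_Icc ξ₀ R δ _)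
        (cutoff_eq_zero hδ fun h => h₁ (hB h))).trans ?_
      rw [indicator_of_mem (show z.swap ∈ hball ξ₀ (R + δ) ×ˢ Bᶜ from ⟨h₂R, h₁⟩)]
      gcongr
      exact le_add_left le_add_self
    · simp [energy_eq_zero (fun h => h₁ (hB h)) h₂R]
  · simp [energy_eq_zero (fun h => h₁ (hB h)) fun h => h₂ (hB h)]

theorem IsComparable.lintegral_energyIntegrand_testFun_le (hd : IsComparable d) (hs : 0 ≤ s)
    (hp : 1 < p) {C : ℝ≥0∞} (hC : ∀ ξ η, ENNReal.ofReal (dkern d (homDim n + s * p) ξ η)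
      ≤ C * kern (homDim n + s * p) ξ η) (hCtop : C ≠ ⊤) (k : ℝ) (hum : Measurable u)
    (hR : 0 < R) (hδ : 0 < δ) :
    ∫⁻ z, ENNReal.ofReal (energyIntegrand s p d u (testFun p k u (cutoff ξ₀ R δ)) z)
        ∂volume.prod volume ≤
      C * (ENNReal.ofReal (p ^ p) *
          (2 * ((∫⁻ ξ in hball ξ₀ (R + 2 * δ), ENNReal.ofReal (k - u ξ) ^ p) *
            (ENNReal.ofReal (δ⁻¹ ^ (s * p)) * ∫⁻ h : Heis n, cutKernel s p 1 h)))
        + 2 * ((∫⁻ ξ in hball ξ₀ (R + 2 * δ), ENNReal.ofReal (k - u ξ)) *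
          (ENNReal.ofReal (((R + 2 * δ) / δ) ^ (homDim n + s * p)) *
            tail s p k u ξ₀ (R + 2 * δ)))) := by
  set B := hball ξ₀ (R + 2 * δ)
  set g : Heis n → ℝ≥0∞ := B.indicator fun ξ => ENNReal.ofReal (k - u ξ) ^ p
  set S : Set (Heis n × Heis n) := hball ξ₀ (R + δ) ×ˢ Bᶜ
  have hBm : MeasurableSet B := measurableSet_hball _ _
  have hSm : MeasurableSet S := (measurableSet_hball _ _).prod hBm.compl
  have hgm : Measurable g := Measurable.indicator (by fun_prop) hBm
  have hHm : Measurable (S.indicator (interaction s p k u)) :=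
    (measurable_interaction s p k hum).indicator hSm
  have hHm_swap : Measurable fun z : Heis n × Heis n =>
      S.indicator (interaction s p k u) z + S.indicator (interaction s p k u) z.swap :=
    hHm.add (hHm.comp measurable_swap)
  calc _ ≤ ∫⁻ z : Heis n × Heis n, C * (ENNReal.ofReal (p ^ p) *
          ((g z.1 + g z.2) * cutKernel s p δ⁻¹ (z.2⁻¹ * z.1))
        + (S.indicator (interaction s p k u) z + S.indicator (interaction s p k u) z.swap))
          ∂volume.prod volume := lintegral_mono fun z =>
        hd.ofReal_energyIntegrand_testFun_le hp hC k u hδ (hball_mono (by linarith)) z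
    _ = C * (ENNReal.ofReal (p ^ p) *
          (2 * ((∫⁻ ξ in B, ENNReal.ofReal (k - u ξ) ^ p) *
            (ENNReal.ofReal (δ⁻¹ ^ (s * p)) * ∫⁻ h : Heis n, cutKernel s p 1 h)))
        + 2 * ∫⁻ z in S, interaction s p k u z ∂volume.prod volume) := by
        rw [lintegral_const_mul' _ _ hCtop, lintegral_add_right _ hHm_swap,
          lintegral_const_mul' _ _ ENNReal.ofReal_ne_top,
          lintegral_add_mul_cutKernel s p (inv_pos.2 hδ) hgm, lintegral_add_left hHm,
          lintegral_prod_swap, lintegral_indicator hBm, lintegral_indicator hSm, ← two_mul]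
    _ ≤ _ := by
        gcongr
        exact setLIntegral_interaction_le_tail hs (by linarith) k hum hR hδ

theorem volume_hball_sub_le (k : ℝ) (u : Heis n → ℝ) {ρ r : ℝ} (hξ : hdist ξ₀ ξ + ρ ≤ r) :
    volume (hball (1 : Heis n) ρ) - volume ({η | u η < k} ∩ hball ξ₀ r)
      ≤ volume (hball ξ ρ \ {η | u η < k}) := by
  rw [tsub_le_iff_right, ← volume_hball_eq_volume_hball_one ξ]
  refine (measure_mono fun η hη => ?_).trans (measure_union_le _ _)
  by_cases h : u η < k
  · exact Or.inr ⟨h, hball_subset_hball hξ hη⟩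
  · exact Or.inl ⟨hη, h⟩

/- The pairs `(ξ, η)` with `u ξ < k ≤ u η` already contribute as much as a Sobolev inequality
would yield. -/
theorem IsComparable.le_ofReal_neg_energyIntegrand_testFun (hd : IsComparable d) (hp : 1 < p)
    {c : ℝ≥0∞} (hc : ∀ ξ η, c * kern (homDim n + s * p) ξ η
      ≤ ENNReal.ofReal (dkern d (homDim n + s * p) ξ η)) {z : Heis n × Heis n}
    (hφ₁ : φ z.1 = 1) (hk : k ≤ u z.2) :
    c * (ENNReal.ofReal (k - u z.1) ^ p * kern (homDim n + s * p) z.1 z.2)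
      ≤ ENNReal.ofReal (-energyIntegrand s p d u (testFun p k u φ) z) := by
  have h₁ : testFun p k u φ z.1 = max (k - u z.1) 0 := by
    rw [testFun, hφ₁, Real.one_rpow, mul_one, deficit]
  have h₂ : testFun p k u φ z.2 = 0 := by rw [testFun, deficit_of_le hk, zero_mul]
  rw [hd.ofReal_neg_energyIntegrand, h₁, h₂, sub_zero, mul_left_comm]
  gcongr
  · exact ofReal_rpow_le_neg_flux_mul hp hk
  · exact hc _ _

theorem ofReal_rpow_neg_le_kern {q ρ : ℝ} (hq : 0 ≤ q) (hηξ : η ≠ ξ) (hη : η ∈ hball ξ ρ) :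
    ENNReal.ofReal (ρ ^ (-q)) ≤ kern q ξ η := by
  rw [kern_comm]
  exact ENNReal.ofReal_le_ofReal (Real.rpow_le_rpow_of_nonpos (hdist_pos hηξ.symm)
    (mem_hball.1 hη).le (neg_nonpos.2 hq))

theorem IsComparable.le_lintegral_neg_energyIntegrand_testFun (hd : IsComparable d)
    (hs : 0 ≤ s) (hp : 1 < p) {c : ℝ≥0∞} (hc : ∀ ξ η, c * kern (homDim n + s * p) ξ η
      ≤ ENNReal.ofReal (dkern d (homDim n + s * p) ξ η)) (k : ℝ) (hum : Measurable u)
    (hδ : 0 < δ) {ρ : ℝ} (hρ : ρ ≤ 2 * δ) :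
    c * ENNReal.ofReal (ρ ^ (-(homDim n + s * p))) *
        (volume (hball (1 : Heis n) ρ) - volume ({ξ | u ξ < k} ∩ hball ξ₀ (R + 2 * δ))) *
        ∫⁻ ξ in hball ξ₀ R, ENNReal.ofReal (k - u ξ) ^ p ≤
      ∫⁻ z, ENNReal.ofReal (-energyIntegrand s p d u (testFun p k u (cutoff ξ₀ R δ)) z)
        ∂volume.prod volume := by
  have hq : 0 ≤ homDim n + s * p := by have := homDim_pos (n := n); positivity
  have hE : Measurable fun z => ENNReal.ofReal
      (-energyIntegrand s p d u (testFun p k u (cutoff ξ₀ R δ)) z) :=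
    (hd.measurable_energyIntegrand hum
      (measurable_testFun p k hum (measurable_cutoff ξ₀ R δ))).neg.ennreal_ofReal
  rw [lintegral_prod _ hE.aemeasurable, ← lintegral_const_mul _ (by fun_prop)]
  refine (setLIntegral_mono' (measurableSet_hball ξ₀ R) fun ξ hξ => ?_).trans
    (setLIntegral_le_lintegral _ _)
  set S := hball ξ ρ \ {η | u η < k}
  have hS : MeasurableSet S :=
    (measurableSet_hball _ _).diff (measurableSet_lt hum measurable_const)
  calc _ ≤ c * ENNReal.ofReal (ρ ^ (-(homDim n + s * p))) * volume S
          * ENNReal.ofReal (k - u ξ) ^ p := by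
        gcongr
        exact volume_hball_sub_le k u (by linarith [mem_hball.1 hξ])
    _ = ∫⁻ _ in S, c * (ENNReal.ofReal (k - u ξ) ^ p
          * ENNReal.ofReal (ρ ^ (-(homDim n + s * p)))) := by
        rw [setLIntegral_const]
        ring
    _ ≤ ∫⁻ η in S, ENNReal.ofReal
          (-energyIntegrand s p d u (testFun p k u (cutoff ξ₀ R δ)) (ξ, η)) := by
        refine setLIntegral_mono' hS fun η hη => ?_
        have hkη : k ≤ u η := not_lt.1 hη.2
        rcases le_or_gt k (u ξ) with hkξ | hkξ
        · rw [ENNReal.ofReal_of_nonpos (sub_nonpos.2 hkξ), ENNReal.zero_rpow_of_pos (by linarith),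
            zero_mul, mul_zero]
          exact zero_le
        · have hηξ : η ≠ ξ := fun h => hkξ.not_ge (h ▸ hkη)
          refine le_trans ?_ (hd.le_ofReal_neg_energyIntegrand_testFun hp hc (z := (ξ, η))
            (cutoff_eq_one hδ hξ) hkη)
          gcongr
          exact ofReal_rpow_neg_le_kern hq hηξ hη.1
    _ ≤ _ := setLIntegral_le_lintegral _ _

end Heis

end

noncomputable section

theorem le_rpow_mul_max_of_forall_radius {Q a c m z B τ₀ y y' : ℝ} (hQ : 0 < Q) (ha : 0 ≤ a)
    (hc : 0 < c) (hm : 0 < m) (hz : 0 < z) (hτ₀ : 0 < τ₀) (hy' : 0 ≤ y') (hy : y' ≤ y)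
    (h : ∀ τ, 0 < τ → τ ≤ τ₀ → c * τ ^ (-(Q + a)) * (m * τ ^ Q - z) * y' ≤ B) :
    y' ≤ (2 * z / m) ^ (a / Q) * max (2 / (c * m) * B) (τ₀ ^ (-a) * y) := by
  have hbase : 0 < 2 * z / m := by positivity
  -- at this radius `z` is half of `m * τ ^ Q`
  set τ := (2 * z / m) ^ (1 / Q)
  have hτ : 0 < τ := Real.rpow_pos_of_pos hbase _
  have hτQ : m * τ ^ Q = 2 * z := by
    rw [← Real.rpow_mul hbase.le, one_div_mul_cancel hQ.ne', Real.rpow_one]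
    field_simp
  have hτa : τ ^ a = (2 * z / m) ^ (a / Q) := by
    rw [← Real.rpow_mul hbase.le, one_div_mul_eq_div]
  rw [← hτa]
  rcases le_or_gt τ τ₀ with hle | hgt
  · have hpow : τ ^ a * (τ ^ (-(Q + a)) * τ ^ Q) = 1 := by
      rw [← Real.rpow_add hτ, ← Real.rpow_add hτ, neg_add_rev, neg_add_cancel_right,
        add_neg_cancel, Real.rpow_zero]
    calc y' = τ ^ a * (2 / (c * m) * (c * τ ^ (-(Q + a)) * (m * τ ^ Q - z) * y')) := by
          rw [show m * τ ^ Q - z = m * τ ^ Q / 2 by linarith]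
          field_simp
          linear_combination (-y') * hpow
      _ ≤ τ ^ a * (2 / (c * m) * B) := by gcongr; exact h τ hτ hle
      _ ≤ _ := by gcongr; exact le_max_left _ _
  · have hone : 1 ≤ τ ^ a * τ₀ ^ (-a) := by
      rw [Real.rpow_neg hτ₀.le, ← div_eq_mul_inv, one_le_div (by positivity)]
      exact Real.rpow_le_rpow hτ₀.le hgt.le ha
    calc y' ≤ y := hy
      _ ≤ τ ^ a * τ₀ ^ (-a) * y := le_mul_of_one_le_left (hy'.trans hy) hone
      _ = τ ^ a * (τ₀ ^ (-a) * y) := mul_assoc _ _ _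
      _ ≤ _ := by gcongr; exact le_max_right _ _

theorem exists_forall_tendsto_zero_of_superlinear {N B σ : ℝ} (hN : 0 < N) (hB : 1 < B)
    (hσ : 0 < σ) :
    ∃ ν : ℝ, 0 < ν ∧ ∀ y : ℕ → ℝ, (∀ j, 0 ≤ y j) → (∀ j, y (j + 1) ≤ N * B ^ j * (y j ^ σ * y j)) →
      y 0 ≤ ν → Tendsto y atTop (𝓝 0) := by
  have hB₀ : 0 < B := one_pos.trans hB
  set θ := B ^ (-σ⁻¹)
  have hθ : 0 < θ := Real.rpow_pos_of_pos hB₀ _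
  have hθ₁ : θ < 1 := Real.rpow_lt_one_of_one_lt_of_neg hB (neg_lt_zero.2 (inv_pos.2 hσ))
  have hθσ : θ ^ σ = B⁻¹ := by
    rw [← Real.rpow_mul hB₀.le, neg_mul, inv_mul_cancel₀ hσ.ne', Real.rpow_neg_one]
  set ν := (θ / N) ^ σ⁻¹
  have hν : 0 < ν := by positivity
  have hνσ : ν ^ σ = θ / N := Real.rpow_inv_rpow (by positivity) hσ.ne'
  refine ⟨ν, hν, fun y hy hrec h₀ => ?_⟩
  have geometric : ∀ j, y j ≤ ν * θ ^ j := by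
    intro j
    induction j with
    | zero => simpa using h₀
    | succ j ih =>
      have hpow : (ν * θ ^ j) ^ σ = θ / N * B⁻¹ ^ j := by
        rw [Real.mul_rpow hν.le (by positivity), hνσ, ← Real.rpow_pow_comm hθ.le, hθσ]
      calc y (j + 1) ≤ N * B ^ j * (y j ^ σ * y j) := hrec j
        _ ≤ N * B ^ j * ((ν * θ ^ j) ^ σ * (ν * θ ^ j)) := by
            have := hy j
            gcongr
        _ = ν * θ ^ (j + 1) := by
            rw [hpow, inv_pow]
            field_simp
            ring
  refine squeeze_zero hy geometric ?_
  simpa using (tendsto_pow_atTop_nhds_zero_of_lt_one hθ.le hθ₁).const_mul ν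

namespace Heis

variable {n : ℕ} {s p k R δ : ℝ} {u d : Heis n → ℝ} {Ω : Set (Heis n)} {f : Heis n → ℝ → ℝ}
  {ξ₀ : Heis n}

/-! ### The De Giorgi iteration -/

/-- The `p`-th power of the `L^p` norm of `(k - u)_+` on the ball `B_r(ξ₀)`: the quantity which
the De Giorgi iteration drives to zero. -/
def deficitMass (p k : ℝ) (u : Heis n → ℝ) (ξ₀ : Heis n) (r : ℝ) : ℝ≥0∞ :=
  ∫⁻ ξ in hball ξ₀ r, ENNReal.ofReal (k - u ξ) ^ p

theorem deficitMass_mono (hp : 0 ≤ p) (u : Heis n → ℝ) (ξ₀ : Heis n) {k k' r r' : ℝ}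
    (hk : k ≤ k') (hr : r ≤ r') : deficitMass p k u ξ₀ r ≤ deficitMass p k' u ξ₀ r' := by
  refine lintegral_mono' (Measure.restrict_mono (hball_mono hr) le_rfl) fun ξ => ?_
  dsimp only
  gcongr

theorem deficitMass_lt_top (hp : 0 < p) (k : ℝ) {r : ℝ}
    (hu : MemLp u (ENNReal.ofReal p) (volume.restrict (hball ξ₀ r))) :
    deficitMass p k u ξ₀ r < ⊤ := by
  have h := (memLp_deficit (isCompact_closure_hball ξ₀ r) k hu).eLpNorm_lt_top
  rw [deficitMass]
  calc ∫⁻ ξ in hball ξ₀ r, ENNReal.ofReal (k - u ξ) ^ p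
      = eLpNorm (deficit k u) (ENNReal.ofReal p) (volume.restrict (hball ξ₀ r)) ^ p := by
        rw [← lintegral_enorm_rpow_eq_eLpNorm_rpow hp]
        simp only [Real.enorm_of_nonneg (deficit_nonneg k u _), ofReal_deficit]
    _ < ⊤ := ENNReal.rpow_lt_top_of_nonneg hp.le h.ne

theorem one_le_rpow_neg_mul_rpow {t a q : ℝ} (ht : 0 < t) (hq : 0 ≤ q) (h : t ≤ a) :
    1 ≤ t ^ (-q) * a ^ q := by
  rw [Real.rpow_neg ht.le, ← div_eq_inv_mul, one_le_div (by positivity)]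
  exact Real.rpow_le_rpow ht.le h hq

theorem one_le_ofReal_rpow_neg_mul {t a q : ℝ} (ht : 0 < t) (hq : 0 ≤ q) (h : t ≤ a) :
    1 ≤ ENNReal.ofReal (t ^ (-q)) * ENNReal.ofReal a ^ q := by
  rw [ENNReal.ofReal_rpow_of_nonneg (ht.le.trans h) hq, ← ENNReal.ofReal_mul (by positivity),
    ENNReal.one_le_ofReal]
  exact one_le_rpow_neg_mul_rpow ht hq h

theorem volume_lt_inter_hball_le (hp : 0 ≤ p) (hum : Measurable u) (k : ℝ) {t : ℝ} (ht : 0 < t)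
    (ξ₀ : Heis n) (r : ℝ) :
    volume ({ξ | u ξ < k - t} ∩ hball ξ₀ r) ≤
      ENNReal.ofReal (t ^ (-p)) * deficitMass p k u ξ₀ r := by
  have hm : MeasurableSet {ξ | u ξ < k - t} := measurableSet_lt hum measurable_const
  rw [deficitMass, ← lintegral_const_mul' _ _ ENNReal.ofReal_ne_top, ← Measure.restrict_apply hm,
    ← lintegral_indicator_one hm]
  refine lintegral_mono fun ξ => ?_
  by_cases h : ξ ∈ {ξ | u ξ < k - t}
  · rw [indicator_of_mem h]
    exact one_le_ofReal_rpow_neg_mul ht hp (by linarith [show u ξ < k - t from h])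
  · rw [indicator_of_notMem h]
    exact zero_le

theorem setLIntegral_ofReal_sub_le (hp : 1 ≤ p) (u : Heis n → ℝ) (k : ℝ) {t : ℝ} (ht : 0 < t)
    (ξ₀ : Heis n) (r : ℝ) :
    ∫⁻ ξ in hball ξ₀ r, ENNReal.ofReal (k - t - u ξ) ≤
      ENNReal.ofReal (t ^ (-(p - 1))) * deficitMass p k u ξ₀ r := by
  rw [deficitMass, ← lintegral_const_mul' _ _ ENNReal.ofReal_ne_top]
  refine lintegral_mono fun ξ => ?_
  rcases lt_or_ge (u ξ) (k - t) with h | h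
  · calc ENNReal.ofReal (k - t - u ξ) ≤ 1 * ENNReal.ofReal (k - u ξ) := by
          rw [one_mul]
          gcongr
          linarith
      _ ≤ ENNReal.ofReal (t ^ (-(p - 1))) * ENNReal.ofReal (k - u ξ) ^ (p - 1)
            * ENNReal.ofReal (k - u ξ) := by
          gcongr
          exact one_le_ofReal_rpow_neg_mul ht (sub_nonneg.2 hp) (by linarith)
      _ = ENNReal.ofReal (t ^ (-(p - 1))) * ENNReal.ofReal (k - u ξ) ^ p := by
          rw [mul_assoc]
          congr 1
          nth_rw 2 [← ENNReal.rpow_one (ENNReal.ofReal (k - u ξ))]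
          rw [← ENNReal.rpow_add _ _ (by simpa using by linarith) ENNReal.ofReal_ne_top,
            sub_add_cancel]
  · rw [ENNReal.ofReal_of_nonpos (by linarith)]
    exact zero_le

theorem lintegral_ofReal_testFun_le (hp : 0 < p) (k : ℝ) (u : Heis n → ℝ) (hδ : 0 < δ) :
    ∫⁻ ξ, ENNReal.ofReal (testFun p k u (cutoff ξ₀ R δ) ξ) ≤
      ∫⁻ ξ in hball ξ₀ (R + δ), ENNReal.ofReal (k - u ξ) := by
  rw [← lintegral_indicator (measurableSet_hball _ _)]
  refine lintegral_mono fun ξ => ?_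
  by_cases h : ξ ∈ hball ξ₀ (R + δ)
  · rw [indicator_of_mem h, ← ofReal_deficit]
    exact ENNReal.ofReal_le_ofReal (testFun_le_deficit hp.le (cutoff_mem_Icc ξ₀ R δ ξ))
  · rw [testFun_eq_zero hp (cutoff_eq_zero hδ h), ENNReal.ofReal_zero]
    exact zero_le

theorem IsWeakSupersolution.lintegral_neg_energy_testFun_le
    (hu : IsWeakSupersolution s p d f Ω u) (hs : 0 < s) (hs1 : s < 1) (hp : 1 < p)
    (hd : IsComparable d) (hum : Measurable u) (k : ℝ) (hδ : 0 < δ)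
    (hΩ : closedHball ξ₀ (R + 2 * δ) ⊆ Ω) {H : ℝ}
    (hf : ∀ᵐ ξ ∂(volume.restrict (hball ξ₀ (R + 2 * δ))), |f ξ (u ξ)| ≤ H) :
    ∫⁻ z, ENNReal.ofReal (-energyIntegrand s p d u (testFun p k u (cutoff ξ₀ R δ)) z)
        ∂volume.prod volume ≤
      ∫⁻ z, ENNReal.ofReal (energyIntegrand s p d u (testFun p k u (cutoff ξ₀ R δ)) z)
          ∂volume.prod volume
        + ENNReal.ofReal H * ∫⁻ ξ in hball ξ₀ (R + 2 * δ), ENNReal.ofReal (k - u ξ) := by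
  have hp0 : 0 < p := one_pos.trans hp
  have hclosure : closure (hball ξ₀ (R + 2 * δ)) ⊆ Ω := (closure_hball_subset _ _).trans hΩ
  have hfrac : MemFracSobolev s p (hball ξ₀ (R + δ)) u :=
    hu.memLoc _ (isOpen_hball _ _) (isCompact_closure_hball _ _)
      ((closure_mono (hball_mono (by linarith))).trans hclosure)
  have hφm := measurable_cutoff ξ₀ R δ
  have hφ := cutoff_mem_Icc ξ₀ R δ
  have hφ0 : ∀ ξ, ξ ∉ hball ξ₀ (R + δ) → cutoff ξ₀ R δ ξ = 0 := fun ξ => cutoff_eq_zero hδ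
  refine (hu.lintegral_neg_energy_le hs hs1 hp hd hum (isOpen_hball ξ₀ (R + 2 * δ))
    (isCompact_closure_hball ξ₀ _) hclosure (isCompact_closedHball ξ₀ (R + δ))
    (fun ξ hξ => mem_hball.2 ((mem_closedHball.1 hξ).trans_lt (by linarith))) hf
    (measurable_testFun p k hum hφm) (fun ξ => testFun_nonneg (hφ ξ).1)
    (fun ξ hξ => testFun_eq_zero hp0 (hφ0 ξ fun h => hξ (hball_subset_closedHball _ _ h)))
    (memLp_testFun hp0 (measurableSet_hball _ _) hum hφm hφ hφ0
      (memLp_deficit (isCompact_closure_hball _ _) _ hfrac.1))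
    (memLp_diffQuot_testFun hs hs1 hp hδ k hum hfrac)).trans ?_
  gcongr _ + _ * ?_
  exact (lintegral_ofReal_testFun_le hp0 k u hδ).trans
    (lintegral_mono_set (hball_mono (by linarith)))

theorem IsWeakSupersolution.mul_deficitMass_le (hu : IsWeakSupersolution s p d f Ω u)
    (hs : 0 < s) (hs1 : s < 1) (hp : 1 < p) (hd : IsComparable d) (hum : Measurable u)
    {c C : ℝ≥0∞} (hc : ∀ ξ η, c * kern (homDim n + s * p) ξ η
      ≤ ENNReal.ofReal (dkern d (homDim n + s * p) ξ η))
    (hC : ∀ ξ η, ENNReal.ofReal (dkern d (homDim n + s * p) ξ η)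
      ≤ C * kern (homDim n + s * p) ξ η) (hCtop : C ≠ ⊤) {t H ρ : ℝ} (hR : 0 < R) (hδ : 0 < δ)
    (ht : 0 < t) (hΩ : closedHball ξ₀ (R + 2 * δ) ⊆ Ω)
    (hf : ∀ᵐ ξ ∂(volume.restrict (hball ξ₀ (R + 2 * δ))), |f ξ (u ξ)| ≤ H)
    (htail : tail s p (k - t) u ξ₀ (R + 2 * δ) ≤ ENNReal.ofReal H) (hρ : ρ ≤ 2 * δ) :
    c * ENNReal.ofReal (ρ ^ (-(homDim n + s * p))) *
        (volume (hball (1 : Heis n) ρ)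
          - ENNReal.ofReal (t ^ (-p)) * deficitMass p k u ξ₀ (R + 2 * δ)) *
        deficitMass p (k - t) u ξ₀ R ≤
      (C * (ENNReal.ofReal (p ^ p) *
            (2 * (ENNReal.ofReal (δ⁻¹ ^ (s * p)) * ∫⁻ h : Heis n, cutKernel s p 1 h))
          + 2 * (ENNReal.ofReal (t ^ (-(p - 1))) *
            (ENNReal.ofReal (((R + 2 * δ) / δ) ^ (homDim n + s * p)) * ENNReal.ofReal H)))
        + ENNReal.ofReal H * ENNReal.ofReal (t ^ (-(p - 1)))) *
        deficitMass p k u ξ₀ (R + 2 * δ) := by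
  have hp0 : 0 < p := one_pos.trans hp
  have mean := setLIntegral_ofReal_sub_le hp.le u k ht ξ₀ (R + 2 * δ)
  have mass : ∫⁻ ξ in hball ξ₀ (R + 2 * δ), ENNReal.ofReal (k - t - u ξ) ^ p ≤
      deficitMass p k u ξ₀ (R + 2 * δ) :=
    deficitMass_mono hp0.le u ξ₀ (sub_le_self k ht.le) le_rfl
  calc _ ≤ c * ENNReal.ofReal (ρ ^ (-(homDim n + s * p))) *
          (volume (hball (1 : Heis n) ρ)
            - volume ({ξ | u ξ < k - t} ∩ hball ξ₀ (R + 2 * δ))) *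
          deficitMass p (k - t) u ξ₀ R := by
        gcongr
        exact volume_lt_inter_hball_le hp0.le hum k ht ξ₀ _
    _ ≤ _ := hd.le_lintegral_neg_energyIntegrand_testFun hs.le hp hc (k - t) hum hδ hρ
    _ ≤ _ := hu.lintegral_neg_energy_testFun_le hs hs1 hp hd hum (k - t) hδ hΩ hf
    _ ≤ _ := add_le_add
        (hd.lintegral_energyIntegrand_testFun_le hs.le hp hC hCtop (k - t) hum hR hδ) le_rfl
    _ ≤ C * (ENNReal.ofReal (p ^ p) * (2 * (deficitMass p k u ξ₀ (R + 2 * δ) *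
            (ENNReal.ofReal (δ⁻¹ ^ (s * p)) * ∫⁻ h : Heis n, cutKernel s p 1 h)))
          + 2 * ((ENNReal.ofReal (t ^ (-(p - 1))) * deficitMass p k u ξ₀ (R + 2 * δ)) *
            (ENNReal.ofReal (((R + 2 * δ) / δ) ^ (homDim n + s * p)) * ENNReal.ofReal H)))
        + ENNReal.ofReal H *
          (ENNReal.ofReal (t ^ (-(p - 1))) * deficitMass p k u ξ₀ (R + 2 * δ)) := by
        gcongr
    _ = _ := by ring

end Heis

end

noncomputable section

namespace Heis

variable {n : ℕ} {s p k R δ : ℝ} {u d : Heis n → ℝ} {Ω : Set (Heis n)} {f : Heis n → ℝ → ℝ}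
  {ξ₀ : Heis n}

theorem div_rpow_neg_le {a b X q κ : ℝ} (ha : 0 < a) (hab : a ≤ b) (hX : 1 ≤ X) (hq : 0 ≤ q)
    (hqκ : q ≤ κ) : (b / X) ^ (-q) ≤ a ^ (-q) * X ^ κ := by
  have hX0 : 0 < X := one_pos.trans_le hX
  rw [Real.div_rpow (ha.le.trans hab) hX0.le, Real.rpow_neg hX0.le, div_inv_eq_mul]
  exact mul_le_mul (Real.rpow_le_rpow_of_nonpos ha hab (neg_nonpos.2 hq))
    (Real.rpow_le_rpow_of_exponent_le hX hqκ) (by positivity) (by positivity)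

theorem deGiorgi_source_le {r ε X Λ : ℝ} (hp : 1 < p) (hr : 0 < r) (hε : 0 < ε) (hX : 1 ≤ X)
    (hΛ : 0 ≤ Λ) :
    ENNReal.ofReal (Λ * ε ^ (p - 1) * r ^ (-(s * p))) * ENNReal.ofReal ((4 * ε / X) ^ (-(p - 1))) ≤
      ENNReal.ofReal Λ * ENNReal.ofReal (r ^ (-(s * p)) * X ^ p) := by
  have hlevel : (4 * ε / X) ^ (-(p - 1)) ≤ ε ^ (-(p - 1)) * X ^ p :=
    div_rpow_neg_le hε (by linarith) hX (by linarith) (by linarith)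
  rw [← ENNReal.ofReal_mul (by positivity), ← ENNReal.ofReal_mul hΛ]
  refine ENNReal.ofReal_le_ofReal ?_
  calc _ ≤ Λ * ε ^ (p - 1) * r ^ (-(s * p)) * (ε ^ (-(p - 1)) * X ^ p) := by gcongr
    _ = Λ * (r ^ (-(s * p)) * X ^ p) * (ε ^ (p - 1) * ε ^ (-(p - 1))) := by ring
    _ = _ := by rw [← Real.rpow_add hε, add_neg_cancel, Real.rpow_zero, mul_one]

theorem deGiorgi_coefficient_le {C I : ℝ≥0∞} {Q r ε X Λ : ℝ} (hQ : 0 ≤ Q)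
    (hs : 0 ≤ s) (hp : 1 < p) (hr : 0 < r) (hε : 0 < ε) (hX : 1 ≤ X) (hR : 0 < R)
    (hRr : R + 2 * (r / X) ≤ r) (hΛ : 0 ≤ Λ) :
    C * (ENNReal.ofReal (p ^ p) * (2 * (ENNReal.ofReal ((r / X)⁻¹ ^ (s * p)) * I))
        + 2 * (ENNReal.ofReal ((4 * ε / X) ^ (-(p - 1))) *
          (ENNReal.ofReal (((R + 2 * (r / X)) / (r / X)) ^ (Q + s * p)) *
            ENNReal.ofReal (Λ * ε ^ (p - 1) * r ^ (-(s * p))))))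
      + ENNReal.ofReal (Λ * ε ^ (p - 1) * r ^ (-(s * p))) *
        ENNReal.ofReal ((4 * ε / X) ^ (-(p - 1))) ≤
    (C * (ENNReal.ofReal (p ^ p) * (2 * I) + 2 * ENNReal.ofReal Λ) + ENNReal.ofReal Λ) *
      ENNReal.ofReal (r ^ (-(s * p)) * X ^ (Q + s * p + p)) := by
  have hX0 : 0 < X := one_pos.trans_le hX
  have hsp : 0 ≤ s * p := mul_nonneg hs (zero_le_one.trans hp.le)
  have hradius : ENNReal.ofReal ((r / X)⁻¹ ^ (s * p)) ≤
      ENNReal.ofReal (r ^ (-(s * p)) * X ^ (Q + s * p + p)) := by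
    refine ENNReal.ofReal_le_ofReal ?_
    rw [Real.inv_rpow (by positivity), ← Real.rpow_neg (by positivity)]
    exact div_rpow_neg_le hr le_rfl hX hsp (by linarith)
  have hratio : ((R + 2 * (r / X)) / (r / X)) ^ (Q + s * p) ≤ X ^ (Q + s * p) := by
    refine Real.rpow_le_rpow (by positivity) ?_ (by positivity)
    rw [div_le_iff₀ (by positivity), mul_div_cancel₀ _ hX0.ne']
    exact hRr
  have hsource : ENNReal.ofReal (Λ * ε ^ (p - 1) * r ^ (-(s * p))) *
      ENNReal.ofReal ((4 * ε / X) ^ (-(p - 1))) ≤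
      ENNReal.ofReal Λ * ENNReal.ofReal (r ^ (-(s * p)) * X ^ p) :=
    deGiorgi_source_le hp hr hε hX hΛ
  have hpow : ENNReal.ofReal (r ^ (-(s * p)) * X ^ p) * ENNReal.ofReal (X ^ (Q + s * p)) =
      ENNReal.ofReal (r ^ (-(s * p)) * X ^ (Q + s * p + p)) := by
    rw [← ENNReal.ofReal_mul (by positivity), mul_assoc, ← Real.rpow_add hX0, add_comm p]
  have hpow' : ENNReal.ofReal (r ^ (-(s * p)) * X ^ p) ≤
      ENNReal.ofReal (r ^ (-(s * p)) * X ^ (Q + s * p + p)) :=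
    ENNReal.ofReal_le_ofReal (mul_le_mul_of_nonneg_left
      (Real.rpow_le_rpow_of_exponent_le hX (by linarith)) (by positivity))
  set W := ENNReal.ofReal (r ^ (-(s * p)) * X ^ (Q + s * p + p))
  set H := Λ * ε ^ (p - 1) * r ^ (-(s * p))
  set t' := ENNReal.ofReal ((4 * ε / X) ^ (-(p - 1)))
  calc _ = C * (ENNReal.ofReal (p ^ p) * (2 * (ENNReal.ofReal ((r / X)⁻¹ ^ (s * p)) * I))
        + 2 * (ENNReal.ofReal H * t' *
          ENNReal.ofReal (((R + 2 * (r / X)) / (r / X)) ^ (Q + s * p))))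
      + ENNReal.ofReal H * t' := by ring
    _ ≤ C * (ENNReal.ofReal (p ^ p) * (2 * (W * I))
        + 2 * (ENNReal.ofReal Λ * ENNReal.ofReal (r ^ (-(s * p)) * X ^ p) *
          ENNReal.ofReal (X ^ (Q + s * p)))) + ENNReal.ofReal Λ * W := by
        refine add_le_add ?_ (hsource.trans (by gcongr))
        gcongr
    _ = _ := by
        rw [mul_assoc (ENNReal.ofReal Λ), hpow]
        ring

theorem deGiorgi_recursion_le {Q a c m M r ε X y : ℝ} (hQ : 0 < Q) (ha : 0 ≤ a) (hp : 0 ≤ p)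
    (hc : 0 < c) (hm : 0 < m) (hM : 0 ≤ M) (hr : 0 < r) (hε : 0 < ε) (hX : 1 ≤ X) (hy : 0 ≤ y) :
    (2 * ((4 * ε / X) ^ (-p) * y) / m) ^ (a / Q) *
        max (2 / (c * m) * (M * (r ^ (-a) * X ^ (Q + a + p)) * y))
          ((2 * (r / X)) ^ (-a) * y) ≤
      max (2 / (c * m) * M) 1 * (2 / m) ^ (a / Q) * X ^ (Q + a + p + p * (a / Q)) *
        ((y / (ε ^ p * r ^ Q)) ^ (a / Q) * y) := by
  have hX0 : 0 < X := one_pos.trans_le hX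
  set σ := a / Q
  have hσ : 0 ≤ σ := by positivity
  set W := r ^ (-a) * X ^ (Q + a + p)
  have hmax : max (2 / (c * m) * (M * W * y)) ((2 * (r / X)) ^ (-a) * y) ≤
      max (2 / (c * m) * M) 1 * (W * y) := by
    refine max_le ?_ ?_
    · calc 2 / (c * m) * (M * W * y) = 2 / (c * m) * M * (W * y) := by ring
        _ ≤ _ := by gcongr; exact le_max_left _ _
    · calc (2 * (r / X)) ^ (-a) * y ≤ 1 * (W * y) := by
            rw [one_mul, ← mul_div_assoc]
            gcongr
            exact div_rpow_neg_le hr (by linarith) hX ha (by linarith)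
        _ ≤ _ := by gcongr; exact le_max_right _ _
  have hbase : (2 * ((4 * ε / X) ^ (-p) * y) / m) ^ σ ≤
      (2 / m) ^ σ * X ^ (p * σ) * (y / ε ^ p) ^ σ := by
    rw [Real.rpow_mul hX0.le, ← Real.mul_rpow (by positivity) (by positivity),
      ← Real.mul_rpow (by positivity) (by positivity)]
    refine Real.rpow_le_rpow (by positivity) ?_ hσ
    calc 2 * ((4 * ε / X) ^ (-p) * y) / m ≤ 2 * (ε ^ (-p) * X ^ p * y) / m := by
          gcongr
          exact div_rpow_neg_le hε (by linarith) hX hp le_rfl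
      _ = _ := by
          rw [Real.rpow_neg hε.le]
          ring
  have hscale : (y / ε ^ p) ^ σ * r ^ (-a) = (y / (ε ^ p * r ^ Q)) ^ σ := by
    rw [← div_div, Real.div_rpow (y := r ^ Q) (by positivity) (by positivity),
      ← Real.rpow_mul hr.le, mul_div_cancel₀ a hQ.ne', Real.rpow_neg hr.le,
      ← div_eq_mul_inv (_ ^ σ)]
  calc _ ≤ (2 / m) ^ σ * X ^ (p * σ) * (y / ε ^ p) ^ σ *
        (max (2 / (c * m) * M) 1 * (W * y)) := by gcongr
    _ = _ := by
        rw [← hscale, Real.rpow_add hX0 (Q + a + p)]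
        ring

theorem IsWeakSupersolution.deficitMass_lt_top (hu : IsWeakSupersolution s p d f Ω u) (hp : 0 < p)
    (k : ℝ) (hΩ : closedHball ξ₀ R ⊆ Ω) : deficitMass p k u ξ₀ R < ⊤ :=
  Heis.deficitMass_lt_top hp k (hu.memLoc _ (isOpen_hball _ _) (isCompact_closure_hball _ _)
    ((closure_hball_subset _ _).trans hΩ)).1

theorem IsWeakSupersolution.toReal_deficitMass_le (hu : IsWeakSupersolution s p d f Ω u)
    (hs : 0 < s) (hs1 : s < 1) (hp : 1 < p) (hd : IsComparable d) (hum : Measurable u)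
    {c C M Λ r ε X : ℝ} (hc₀ : 0 < c)
    (hc : ∀ ξ η, ENNReal.ofReal c * kern (homDim n + s * p) ξ η
      ≤ ENNReal.ofReal (dkern d (homDim n + s * p) ξ η))
    (hC : ∀ ξ η, ENNReal.ofReal (dkern d (homDim n + s * p) ξ η)
      ≤ ENNReal.ofReal C * kern (homDim n + s * p) ξ η) (hM : 0 ≤ M)
    (hCM : ENNReal.ofReal C * (ENNReal.ofReal (p ^ p) * (2 * ∫⁻ h : Heis n, cutKernel s p 1 h)
      + 2 * ENNReal.ofReal Λ) + ENNReal.ofReal Λ ≤ ENNReal.ofReal M) (hΛ : 0 ≤ Λ) (hr : 0 < r)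
    (hε : 0 < ε) (hX : 1 ≤ X) (hR : 0 < R) (hRr : R + 2 * (r / X) ≤ r) (hΩ : closedHball ξ₀ r ⊆ Ω)
    (hf : ∀ᵐ ξ ∂(volume.restrict (hball ξ₀ r)), |f ξ (u ξ)| ≤ Λ * ε ^ (p - 1) * r ^ (-(s * p)))
    (htail : tail s p k u ξ₀ R ≤ ENNReal.ofReal (Λ * ε ^ (p - 1) * r ^ (-(s * p)))) :
    (deficitMass p (k - 4 * ε / X) u ξ₀ R).toReal ≤
      max (2 / (c * (volume (hball (1 : Heis n) 1)).toReal) * M) 1 *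
        (2 / (volume (hball (1 : Heis n) 1)).toReal) ^ (s * p / homDim n) *
        X ^ (homDim n + s * p + p + p * (s * p / homDim n)) *
        (((deficitMass p k u ξ₀ (R + 2 * (r / X))).toReal / (ε ^ p * r ^ homDim n))
            ^ (s * p / homDim n) *
          (deficitMass p k u ξ₀ (R + 2 * (r / X))).toReal) := by
  have hp0 : 0 < p := one_pos.trans hp
  have : 0 < X := one_pos.trans_le hX
  have hQ := homDim_pos (n := n)
  have hδ : 0 < r / X := by positivity
  have hm : 0 < (volume (hball (1 : Heis n) 1)).toReal :=
    ENNReal.toReal_pos (volume_hball_pos _ one_pos).ne' (volume_hball_lt_top _ _).ne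
  have hYtop : deficitMass p k u ξ₀ (R + 2 * (r / X)) < ⊤ :=
    hu.deficitMass_lt_top hp0 k ((closedHball_mono hRr).trans hΩ)
  have hYmono : deficitMass p (k - 4 * ε / X) u ξ₀ R ≤ deficitMass p k u ξ₀ (R + 2 * (r / X)) :=
    deficitMass_mono hp0.le u ξ₀ (sub_le_self _ (by positivity)) (by linarith)
  have hstep τ (hτ : τ ≤ 2 * (r / X)) := hu.mul_deficitMass_le (k := k) (t := 4 * ε / X) hs hs1 hp
    hd hum hc hC ENNReal.ofReal_ne_top hR hδ (by positivity) ((closedHball_mono hRr).trans hΩ)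
    (ae_mono (Measure.restrict_mono (hball_mono hRr) le_rfl) hf)
    ((tail_mono s hp.le u ξ₀ (sub_le_self k (by positivity)) (by linarith)).trans htail) hτ
  set Y := deficitMass p k u ξ₀ (R + 2 * (r / X))
  set Y' := deficitMass p (k - 4 * ε / X) u ξ₀ R
  have hY : ENNReal.ofReal Y.toReal = Y := ENNReal.ofReal_toReal hYtop.ne
  have hY' : ENNReal.ofReal Y'.toReal = Y' := ENNReal.ofReal_toReal (hYmono.trans_lt hYtop).ne
  rcases (ENNReal.toReal_nonneg (a := Y)).eq_or_lt with hzero | hpos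
  · simpa only [← hzero, mul_zero] using ENNReal.toReal_mono hYtop.ne hYmono
  refine (le_rpow_mul_max_of_forall_radius hQ (mul_pos hs hp0).le hc₀ hm (by positivity)
    (by positivity : 0 < 2 * (r / X)) ENNReal.toReal_nonneg
    (ENNReal.toReal_mono hYtop.ne hYmono) fun τ hτ0 hτ => ?_).trans
    (deGiorgi_recursion_le hQ (mul_pos hs hp0).le hp0.le hc₀ hm hM hr hε hX hpos.le)
  rw [← ENNReal.ofReal_le_ofReal_iff (by positivity), ENNReal.ofReal_mul' ENNReal.toReal_nonneg,
    ENNReal.ofReal_mul (by positivity), ENNReal.ofReal_mul hc₀.le,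
    ENNReal.ofReal_sub _ (by positivity), ENNReal.ofReal_mul ENNReal.toReal_nonneg,
    ENNReal.ofReal_mul (p := _ ^ (-p)) (by positivity), ENNReal.ofReal_mul' hpos.le,
    ENNReal.ofReal_mul hM, hY, hY', ENNReal.ofReal_toReal (volume_hball_lt_top _ _).ne,
    mul_comm (volume _), ← volume_hball _ hτ0]
  refine (hstep τ hτ).trans ?_
  gcongr
  exact (deGiorgi_coefficient_le hQ.le hs.le hp hr hε hX hR hRr hΛ).trans (by gcongr)

end Heis

end

noncomputable section

theorem exists_forall_tendsto_zero_of_scaled_superlinear {N κ σ : ℝ} (hN : 0 < N) (hκ : 0 < κ)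
    (hσ : 0 < σ) :
    ∃ ν : ℝ, 0 < ν ∧ ∀ (E : ℝ) (Y : ℕ → ℝ≥0∞), 0 < E → (∀ j, Y j ≠ ⊤) →
      (∀ j, (Y (j + 1)).toReal ≤ N * (8 * 2 ^ j) ^ κ * (((Y j).toReal / E) ^ σ * (Y j).toReal)) →
      Y 0 ≤ ENNReal.ofReal (ν * E) → Tendsto Y atTop (𝓝 0) := by
  obtain ⟨ν, hν, hconv⟩ := exists_forall_tendsto_zero_of_superlinear (N := N * 8 ^ κ) (B := 2 ^ κ)
    (by positivity) (Real.one_lt_rpow one_lt_two hκ) hσ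
  refine ⟨ν, hν, fun E Y hE hY hrec h₀ => ?_⟩
  have hpow (j : ℕ) : (8 * 2 ^ j : ℝ) ^ κ = 8 ^ κ * (2 ^ κ) ^ j := by
    rw [Real.mul_rpow (by norm_num) (by positivity), Real.rpow_pow_comm zero_le_two]
  have hlim : Tendsto (fun j => (Y j).toReal / E) atTop (𝓝 0) := by
    refine hconv _ (fun j => by positivity) (fun j => ?_) ?_
    · calc (Y (j + 1)).toReal / E ≤
            N * (8 * 2 ^ j) ^ κ * (((Y j).toReal / E) ^ σ * (Y j).toReal) / E := by
            gcongr
            exact hrec j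
        _ = _ := by
            rw [hpow]
            ring
    · rw [div_le_iff₀ hE]
      exact ENNReal.toReal_le_of_le_ofReal (by positivity) h₀
  refine (ENNReal.tendsto_toReal_iff hY ENNReal.zero_ne_top).1 ?_
  simpa only [div_mul_cancel₀ _ hE.ne', zero_mul, ENNReal.toReal_zero] using hlim.mul_const E

namespace Heis

variable {n : ℕ} {s p k r ε : ℝ} {u d : Heis n → ℝ} {ξ₀ : Heis n}

theorem IsComparable.exists_toReal_deficitMass_le (hd : IsComparable d) (hs : 0 < s) (hs1 : s < 1)
    (hp : 1 < p) {Λ : ℝ} (hΛ : 0 ≤ Λ) :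
    ∃ N : ℝ, 0 < N ∧ ∀ (Ω : Set (Heis n)) (f : Heis n → ℝ → ℝ) (u : Heis n → ℝ) (ξ₀ : Heis n)
      (k r ε X R : ℝ), IsWeakSupersolution s p d f Ω u → Measurable u → 0 < r → 0 < ε → 1 ≤ X →
      0 < R → R + 2 * (r / X) ≤ r → closedHball ξ₀ r ⊆ Ω →
      (∀ᵐ ξ ∂(volume.restrict (hball ξ₀ r)), |f ξ (u ξ)| ≤ Λ * ε ^ (p - 1) * r ^ (-(s * p))) →
      tail s p k u ξ₀ R ≤ ENNReal.ofReal (Λ * ε ^ (p - 1) * r ^ (-(s * p))) →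
      (deficitMass p (k - 4 * ε / X) u ξ₀ R).toReal ≤
        N * X ^ (homDim n + s * p + p + p * (s * p / homDim n)) *
          (((deficitMass p k u ξ₀ (R + 2 * (r / X))).toReal / (ε ^ p * r ^ homDim n))
              ^ (s * p / homDim n) *
            (deficitMass p k u ξ₀ (R + 2 * (r / X))).toReal) := by
  have hp0 : 0 < p := one_pos.trans hp
  have hq : 0 < homDim n + s * p := add_pos homDim_pos (mul_pos hs hp0)
  obtain ⟨c, hc₀, hc⟩ := hd.exists_le_ofReal_dkern hq
  obtain ⟨C, -, hC⟩ := hd.exists_ofReal_dkern_le hq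
  have hI := (lintegral_cutKernel_one_lt_top (n := n) hs hs1 hp0).ne
  have hMtop : ENNReal.ofReal C * (ENNReal.ofReal (p ^ p) *
      (2 * ∫⁻ h : Heis n, cutKernel s p 1 h) + 2 * ENNReal.ofReal Λ) + ENNReal.ofReal Λ ≠ ⊤ := by
    finiteness
  have hm : 0 < (volume (hball (1 : Heis n) 1)).toReal :=
    ENNReal.toReal_pos (volume_hball_pos _ one_pos).ne' (volume_hball_lt_top _ _).ne
  exact ⟨_, by positivity, fun Ω f u ξ₀ k r ε X R hu hum hr hε hX hR hRr hΩ hf htail =>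
    hu.toReal_deficitMass_le hs hs1 hp hd hum hc₀ hc hC ENNReal.toReal_nonneg
      (ENNReal.ofReal_toReal hMtop).ge hΛ hr hε hX hR hRr hΩ hf htail⟩

/-- The radii of the De Giorgi iteration, decreasing from `r` to `r / 2`. -/
def iterRadius (r : ℝ) (j : ℕ) : ℝ :=
  r / 2 * (1 + 2⁻¹ ^ j)

/-- The levels of the De Giorgi iteration, decreasing from `k` to `k - ε`. -/
def iterLevel (k ε : ℝ) (j : ℕ) : ℝ :=
  k - ε * (1 - 2⁻¹ ^ j)

@[simp]
theorem iterRadius_zero (r : ℝ) : iterRadius r 0 = r := by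
  simp only [iterRadius, pow_zero]
  ring

@[simp]
theorem iterLevel_zero (k ε : ℝ) : iterLevel k ε 0 = k := by
  simp only [iterLevel, pow_zero, sub_self, mul_zero, sub_zero]

theorem iterRadius_succ_add (r : ℝ) (j : ℕ) :
    iterRadius r (j + 1) + 2 * (r / (8 * 2 ^ j)) = iterRadius r j := by
  simp only [iterRadius, pow_succ, inv_pow]
  field_simp
  ring

theorem iterLevel_succ (k ε : ℝ) (j : ℕ) :
    iterLevel k ε (j + 1) = iterLevel k ε j - 4 * ε / (8 * 2 ^ j) := by
  simp only [iterLevel, pow_succ, inv_pow]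
  field_simp
  ring

theorem half_le_iterRadius (hr : 0 ≤ r) (j : ℕ) : r / 2 ≤ iterRadius r j :=
  le_mul_of_one_le_right (by positivity) (le_add_of_nonneg_right (by positivity))

theorem iterRadius_le (hr : 0 ≤ r) (j : ℕ) : iterRadius r j ≤ r := by
  have : (2⁻¹ : ℝ) ^ j ≤ 1 := pow_le_one₀ (by norm_num) (by norm_num)
  calc r / 2 * (1 + 2⁻¹ ^ j) ≤ r / 2 * (1 + 1) := by gcongr
    _ = r := by ring

theorem iterLevel_le (k : ℝ) (hε : 0 ≤ ε) (j : ℕ) : iterLevel k ε j ≤ k :=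
  sub_le_self k (mul_nonneg hε (sub_nonneg.2 (pow_le_one₀ (by norm_num) (by norm_num))))

theorem sub_le_iterLevel (k : ℝ) (hε : 0 ≤ ε) (j : ℕ) : k - ε ≤ iterLevel k ε j :=
  sub_le_sub_left (mul_le_of_le_one_right hε (sub_le_self 1 (by positivity))) k

theorem ae_le_of_deficitMass_eq_zero (hp : 0 < p) (hum : Measurable u)
    (h : deficitMass p k u ξ₀ r = 0) : ∀ᵐ ξ ∂(volume.restrict (hball ξ₀ r)), k ≤ u ξ := by
  filter_upwards [(lintegral_eq_zero_iff (by fun_prop)).1 h] with ξ hξ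
  rw [Pi.zero_apply, ENNReal.rpow_eq_zero_iff_of_pos hp, ENNReal.ofReal_eq_zero] at hξ
  linarith

theorem IsComparable.exists_deGiorgi (hd : IsComparable d) (hs : 0 < s) (hs1 : s < 1) (hp : 1 < p)
    {Λ : ℝ} (hΛ : 0 ≤ Λ) :
    ∃ ν : ℝ, 0 < ν ∧ ∀ (Ω : Set (Heis n)) (f : Heis n → ℝ → ℝ) (u : Heis n → ℝ) (ξ₀ : Heis n)
      (k r ε : ℝ), IsWeakSupersolution s p d f Ω u → Measurable u → 0 < r → 0 < ε →
      closedHball ξ₀ r ⊆ Ω →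
      (∀ᵐ ξ ∂(volume.restrict (hball ξ₀ r)), |f ξ (u ξ)| ≤ Λ * ε ^ (p - 1) * r ^ (-(s * p))) →
      tail s p k u ξ₀ (r / 2) ≤ ENNReal.ofReal (Λ * ε ^ (p - 1) * r ^ (-(s * p))) →
      deficitMass p k u ξ₀ r ≤ ENNReal.ofReal (ν * (ε ^ p * r ^ homDim n)) →
      ∀ᵐ ξ ∂(volume.restrict (hball ξ₀ (r / 2))), k - ε ≤ u ξ := by
  have hsp : 0 < s * p := mul_pos hs (one_pos.trans hp)
  have hQ := homDim_pos (n := n)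
  obtain ⟨N, hN, hstep⟩ := hd.exists_toReal_deficitMass_le hs hs1 hp hΛ
  obtain ⟨ν, hν, hconv⟩ := exists_forall_tendsto_zero_of_scaled_superlinear hN
    (by positivity : 0 < homDim n + s * p + p + p * (s * p / homDim n)) (div_pos hsp hQ)
  refine ⟨ν, hν, fun Ω f u ξ₀ k r ε hu hum hr hε hΩ hf htail hmass => ?_⟩
  have hhalf j := half_le_iterRadius hr.le j
  have hlim : Tendsto (fun j => deficitMass p (iterLevel k ε j) u ξ₀ (iterRadius r j))
      atTop (𝓝 0) := by
    refine hconv (ε ^ p * r ^ homDim n) _ (by positivity) (fun j => ?_) (fun j => ?_)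
      (by simpa only [iterLevel_zero, iterRadius_zero] using hmass)
    · exact (hu.deficitMass_lt_top (one_pos.trans hp) _
        ((closedHball_mono (iterRadius_le hr.le j)).trans hΩ)).ne
    · rw [← iterRadius_succ_add r j, iterLevel_succ]
      refine hstep Ω f u ξ₀ _ r ε _ _ hu hum hr hε ?_ (by linarith [hhalf (j + 1)]) ?_ hΩ hf ?_
      · exact one_le_mul_of_one_le_of_one_le (by norm_num) (one_le_pow₀ one_le_two)
      · exact (iterRadius_succ_add r j).trans_le (iterRadius_le hr.le j)
      · exact (tail_mono s hp.le u ξ₀ (iterLevel_le k hε.le j) (hhalf (j + 1))).trans htail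
  refine ae_le_of_deficitMass_eq_zero (one_pos.trans hp) hum (le_antisymm ?_ zero_le)
  exact ge_of_tendsto' hlim fun j =>
    deficitMass_mono (by linarith) u ξ₀ (sub_le_iterLevel k hε.le j) (hhalf j)

end Heis

end

noncomputable section

theorem exists_ae_abs_le_of_memLp_top {X : Type*} [MeasurableSpace X] {μ : Measure X} {g : X → ℝ}
    (hg : MemLp g ⊤ μ) : ∃ C : ℝ, ∀ᵐ x ∂μ, |g x| ≤ C := by
  have hfin : eLpNormEssSup g μ ≠ ⊤ := by simpa using hg.eLpNorm_ne_top
  refine ⟨(eLpNormEssSup g μ).toReal, ?_⟩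
  filter_upwards [enorm_ae_le_eLpNormEssSup g μ] with x hx
  rw [← Real.norm_eq_abs, ← toReal_enorm]
  exact ENNReal.toReal_mono hfin hx

theorem ae_prod_of_ae_and {X : Type*} [MeasurableSpace X] {μ : Measure X} {P : X → Prop}
    (hP : ∀ᵐ x ∂μ, P x) : ∀ᵐ z ∂μ.prod μ, P z.1 ∧ P z.2 :=
  (Measure.quasiMeasurePreserving_fst.ae hP).and (Measure.quasiMeasurePreserving_snd.ae hP)

namespace Heis

variable {n : ℕ} {s p k r R ε M : ℝ} {d u v : Heis n → ℝ} {f : Heis n → ℝ → ℝ} {Ω : Set (Heis n)}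
  {ξ₀ : Heis n}

/-! ### Lower bounds at interior points -/

theorem MemFracSobolevLoc.congr_ae (hu : MemFracSobolevLoc s p Ω u) (h : u =ᵐ[volume] v) :
    MemFracSobolevLoc s p Ω v := by
  intro D hD hDc hDΩ
  obtain ⟨memLp, memLp_quotient⟩ := hu D hD hDc hDΩ
  refine ⟨memLp.ae_eq (ae_restrict_of_ae h), memLp_quotient.ae_eq ?_⟩
  filter_upwards [ae_prod_of_ae_and (ae_restrict_of_ae h)] with z hz
  rw [hz.1, hz.2]

theorem MemTailSpace.congr_ae (hu : MemTailSpace s p u) (h : u =ᵐ[volume] v) :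
    MemTailSpace s p v := by
  refine ⟨fun K hK => (hu.1 K hK).ae_eq (ae_restrict_of_ae h), hu.2.congr ?_⟩
  filter_upwards [h] with ξ hξ
  rw [hξ]

theorem IsWeakSupersolution.congr_ae (hu : IsWeakSupersolution s p d f Ω u) (h : u =ᵐ[volume] v) :
    IsWeakSupersolution s p d f Ω v where
  measurable := hu.measurable.congr h
  memLoc := hu.memLoc.congr_ae h
  negPart := hu.negPart.congr_ae (h.fun_comp fun x => max (-x) 0)
  weak ψ smooth hasCompactSupport tsupport_subset nonneg := by
    obtain ⟨integrable, le⟩ := hu.weak ψ smooth hasCompactSupport tsupport_subset nonneg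
    have energy_eq : energyIntegrand s p d u ψ =ᵐ[volume.prod volume]
        energyIntegrand s p d v ψ := by
      filter_upwards [ae_prod_of_ae_and h] with z hz
      simp only [energyIntegrand, hz.1, hz.2]
    have source_eq : (fun ξ => f ξ (u ξ) * ψ ξ) =ᵐ[volume] fun ξ => f ξ (v ξ) * ψ ξ := by
      filter_upwards [h] with ξ hξ
      rw [hξ]
    exact ⟨integrable.congr energy_eq,
      integral_congr_ae energy_eq ▸ integral_congr_ae source_eq ▸ le⟩

theorem essLiminf_congr_ae (h : u =ᵐ[volume] v) : essLiminf u = essLiminf v :=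
  funext fun _ => iSup_congr fun _ => iSup_congr fun _ =>
    essInf_congr_ae <|
      EventuallyEq.fun_comp (ae_restrict_of_ae h) fun x : ℝ => (x : EReal)

theorem IsWeakSupersolution.tail_lt_top (hu : IsWeakSupersolution s p d f Ω u) (hs : 0 < s)
    (hs1 : s < 1) (hp : 1 < p) (k : ℝ) (ξ₀ : Heis n) (hR : 0 < R) :
    tail s p k u ξ₀ R < ⊤ := by
  have hq : 0 ≤ homDim n + s * p := by
    have := homDim_pos (n := n)
    positivity
  obtain ⟨C, hC, kern_le⟩ := exists_kern_le_tailWeight hq (isCompact_singleton (x := ξ₀))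
    (isOpen_hball ξ₀ R) (singleton_subset_iff.2 (mem_hball_self hR))
  have trunc_le (η : Heis n) :
      ENNReal.ofReal (k - u η) ≤ ENNReal.ofReal k + ‖max (-u η) 0‖ₑ := by
    rw [Real.enorm_of_nonneg (le_max_right _ _), sub_eq_add_neg]
    exact ENNReal.ofReal_add_le.trans (by gcongr; exact le_max_left _ _)
  calc tail s p k u ξ₀ R
      ≤ ∫⁻ η in (hball ξ₀ R)ᶜ, C * ((ENNReal.ofReal k + ‖max (-u η) 0‖ₑ) ^ (p - 1) *
          tailWeight (homDim n + s * p) η) := by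
        refine setLIntegral_mono_ae' (measurableSet_hball _ _).compl (ae_of_all _ fun η hη => ?_)
        rw [kern_comm, mul_left_comm]
        gcongr
        · exact trunc_le η
        · exact kern_le ξ₀ rfl η hη
    _ ≤ ∫⁻ η, C * ((ENNReal.ofReal k + ‖max (-u η) 0‖ₑ) ^ (p - 1) *
          tailWeight (homDim n + s * p) η) := setLIntegral_le_lintegral _ _
    _ < ⊤ := by
        rw [lintegral_const_mul' _ _ hC]
        exact ENNReal.mul_lt_top hC.lt_top (hu.negPart.lintegral_rpow_mul_tailWeight_lt_top hs hs1
          hp ENNReal.ofReal_ne_top)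

theorem IsWeakSupersolution.exists_lower_bound (hu : IsWeakSupersolution s p d f Ω u)
    (hs : 0 < s) (hs1 : s < 1) (hp : 1 < p) (hd : IsComparable d) (hum : Measurable u)
    (hΩ : Ω ∈ 𝓝 ξ₀)
    (hfu : ∀ K, IsCompact K → K ⊆ Ω → MemLp (fun ξ => f ξ (u ξ)) ⊤ (volume.restrict K)) :
    ∃ R M : ℝ, 0 < R ∧ closedHball ξ₀ R ⊆ Ω ∧
      ∀ᵐ ξ ∂(volume.restrict (hball ξ₀ R)), -M ≤ u ξ := by
  have hp0 : 0 < p := by linarith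
  obtain ⟨r, hr, hrΩ⟩ := exists_closedHball_subset hΩ
  obtain ⟨F, hF⟩ := exists_ae_abs_le_of_memLp_top (hfu _ (isCompact_closedHball ξ₀ r) hrΩ)
  obtain ⟨ν, hν, lower_bound⟩ := hd.exists_deGiorgi (n := n) hs hs1 hp (zero_le_one' ℝ)
  have tail_fin := hu.tail_lt_top hs hs1 hp 0 ξ₀ (half_pos hr)
  have mass_fin := hu.deficitMass_lt_top hp0 0 hrΩ
  have threshold_atTop : Tendsto (fun ε : ℝ => 1 * ε ^ (p - 1) * r ^ (-(s * p))) atTop atTop :=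
    ((tendsto_rpow_atTop (by linarith)).const_mul_atTop one_pos).atTop_mul_const (by positivity)
  have mass_threshold_atTop : Tendsto (fun ε : ℝ => ν * (ε ^ p * r ^ homDim n)) atTop atTop :=
    ((tendsto_rpow_atTop hp0).atTop_mul_const (by positivity)).const_mul_atTop hν
  -- With level `0`, all smallness conditions hold once the allowed error `ε` is large.
  obtain ⟨ε, ⟨source_le, tail_le⟩, mass_le, hε⟩ :=
    (((threshold_atTop.eventually_ge_atTop F).and
      (threshold_atTop.eventually_ge_atTop (tail s p 0 u ξ₀ (r / 2)).toReal)).and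
    ((mass_threshold_atTop.eventually_ge_atTop (deficitMass p 0 u ξ₀ r).toReal).and
      (eventually_gt_atTop 0))).exists
  refine ⟨r / 2, ε, half_pos hr, (closedHball_mono (half_le_self hr.le)).trans hrΩ, ?_⟩
  have source_le' : ∀ᵐ ξ ∂(volume.restrict (hball ξ₀ r)),
      |f ξ (u ξ)| ≤ 1 * ε ^ (p - 1) * r ^ (-(s * p)) :=
    (ae_restrict_of_ae_restrict_of_subset (hball_subset_closedHball ξ₀ r) hF).mono
      fun _ h => h.trans source_le
  simpa only [zero_sub] using lower_bound Ω f u ξ₀ 0 r ε hu hum hr hε hrΩ source_le'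
    ((ENNReal.le_ofReal_iff_toReal_le tail_fin.ne (by positivity)).2 tail_le)
    ((ENNReal.le_ofReal_iff_toReal_le mass_fin.ne (by positivity)).2 mass_le)

theorem tail_le_of_lower_bound (s : ℝ) (hp : 1 ≤ p) (k : ℝ) (hr : 0 < r)
    (hM : ∀ᵐ ξ ∂(volume.restrict (hball ξ₀ R)), -M ≤ u ξ) :
    tail s p k u ξ₀ r ≤ ENNReal.ofReal (k + M) ^ (p - 1) *
      (ENNReal.ofReal (r ^ (-(s * p))) * ∫⁻ h : Heis n, cutKernel s p 1 h)
      + tail s p k u ξ₀ R := by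
  have cover : (hball ξ₀ r)ᶜ ⊆ (hball ξ₀ r)ᶜ ∩ hball ξ₀ R ∪ (hball ξ₀ R)ᶜ := fun ξ hξ =>
    (em (ξ ∈ hball ξ₀ R)).imp (And.intro hξ) id
  refine (lintegral_mono_set cover).trans ((lintegral_union_le _ _ _).trans (add_le_add ?_ le_rfl))
  rw [ae_restrict_iff' (measurableSet_hball _ _)] at hM
  calc ∫⁻ η in (hball ξ₀ r)ᶜ ∩ hball ξ₀ R,
        ENNReal.ofReal (k - u η) ^ (p - 1) * kern (homDim n + s * p) η ξ₀
      ≤ ∫⁻ η in (hball ξ₀ r)ᶜ ∩ hball ξ₀ R,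
        ENNReal.ofReal (k + M) ^ (p - 1) * kern (homDim n + s * p) η ξ₀ := by
        refine setLIntegral_mono_ae'
          ((measurableSet_hball _ _).compl.inter (measurableSet_hball _ _)) ?_
        filter_upwards [hM] with η hη hmem
        gcongr
        linarith [hη hmem.2]
    _ ≤ ∫⁻ η in (hball ξ₀ r)ᶜ,
        ENNReal.ofReal (k + M) ^ (p - 1) * kern (homDim n + s * p) η ξ₀ :=
        lintegral_mono_set inter_subset_left
    _ ≤ _ := by
        rw [lintegral_const_mul' _ _ (ENNReal.rpow_ne_top_of_nonneg (by linarith)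
          ENNReal.ofReal_ne_top)]
        gcongr
        exact lintegral_kern_compl_hball_le s p ξ₀ hr

theorem IsWeakSupersolution.exists_tail_half_le (hu : IsWeakSupersolution s p d f Ω u)
    (hs : 0 < s) (hs1 : s < 1) (hp : 1 < p) (k : ℝ) (hR : 0 < R)
    (hM : ∀ᵐ ξ ∂(volume.restrict (hball ξ₀ R)), -M ≤ u ξ) :
    ∃ L : ℝ, 0 ≤ L ∧ ∀ r, 0 < r → r ≤ R →
      tail s p k u ξ₀ (r / 2) ≤ ENNReal.ofReal (L * r ^ (-(s * p))) := by
  have hp0 : 0 < p := by linarith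
  have hsp : 0 ≤ s * p := by positivity
  set I := ∫⁻ h : Heis n, cutKernel s p 1 h
  set T := tail s p k u ξ₀ R
  set m := ENNReal.ofReal (k + M) ^ (p - 1)
  set L := m * (ENNReal.ofReal (2 ^ (s * p)) * I) + ENNReal.ofReal R ^ (s * p) * T
  have hm : m ≠ ⊤ := ENNReal.rpow_ne_top_of_nonneg (by linarith) ENNReal.ofReal_ne_top
  have hI : I ≠ ⊤ := (lintegral_cutKernel_one_lt_top hs hs1 hp0).ne
  have hT : T ≠ ⊤ := (hu.tail_lt_top hs hs1 hp k ξ₀ hR).ne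
  have hL : L ≠ ⊤ := by finiteness
  refine ⟨L.toReal, ENNReal.toReal_nonneg, fun r hr hrR => ?_⟩
  have half_rpow : ENNReal.ofReal ((r / 2) ^ (-(s * p))) =
      ENNReal.ofReal (2 ^ (s * p)) * ENNReal.ofReal (r ^ (-(s * p))) := by
    rw [← ENNReal.ofReal_mul (by positivity), Real.div_rpow hr.le zero_le_two,
      Real.rpow_neg zero_le_two, div_inv_eq_mul, mul_comm]
  rw [ENNReal.ofReal_mul ENNReal.toReal_nonneg, ENNReal.ofReal_toReal hL]
  calc tail s p k u ξ₀ (r / 2)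
      ≤ m * (ENNReal.ofReal ((r / 2) ^ (-(s * p))) * I) + 1 * T := by
        rw [one_mul]
        exact tail_le_of_lower_bound s hp.le k (half_pos hr) hM
    _ ≤ m * (ENNReal.ofReal (2 ^ (s * p)) * ENNReal.ofReal (r ^ (-(s * p))) * I) +
          ENNReal.ofReal (r ^ (-(s * p))) * ENNReal.ofReal R ^ (s * p) * T := by
        rw [half_rpow]
        gcongr
        exact one_le_ofReal_rpow_neg_mul hr hsp hrR
    _ = L * ENNReal.ofReal (r ^ (-(s * p))) := by ring

theorem IsWeakSupersolution.exists_threshold (hu : IsWeakSupersolution s p d f Ω u)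
    (hs : 0 < s) (hs1 : s < 1) (hp : 1 < p) (hd : IsComparable d) (hum : Measurable u)
    (hΩ : Ω ∈ 𝓝 ξ₀)
    (hfu : ∀ K, IsCompact K → K ⊆ Ω → MemLp (fun ξ => f ξ (u ξ)) ⊤ (volume.restrict K))
    (k : ℝ) (hε : 0 < ε) :
    ∃ ν R : ℝ, 0 < ν ∧ 0 < R ∧ ∀ r, 0 < r → r ≤ R →
      deficitMass p k u ξ₀ r ≤ ENNReal.ofReal (ν * r ^ homDim n) →
      ∀ᵐ ξ ∂(volume.restrict (hball ξ₀ (r / 2))), k - ε ≤ u ξ := by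
  have hsp : 0 ≤ s * p := mul_nonneg hs.le (by linarith)
  obtain ⟨R, M, hR, hRΩ, hM⟩ := hu.exists_lower_bound hs hs1 hp hd hum hΩ hfu
  obtain ⟨F, hF⟩ := exists_ae_abs_le_of_memLp_top (hfu _ (isCompact_closedHball ξ₀ R) hRΩ)
  obtain ⟨L, hL, tail_le⟩ := hu.exists_tail_half_le hs hs1 hp k hR hM
  set Λ := (L + |F| * R ^ (s * p)) / ε ^ (p - 1)
  obtain ⟨ν, hν, lower_bound⟩ := hd.exists_deGiorgi (n := n) (Λ := Λ) hs hs1 hp (by positivity)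
  refine ⟨ν * ε ^ p, R, by positivity, hR, fun r hr hrR small => ?_⟩
  have bound_eq : Λ * ε ^ (p - 1) * r ^ (-(s * p)) =
      L * r ^ (-(s * p)) + |F| * (r ^ (-(s * p)) * R ^ (s * p)) := by
    rw [div_mul_cancel₀ _ (by positivity)]
    ring
  have one_le : 1 ≤ r ^ (-(s * p)) * R ^ (s * p) := one_le_rpow_neg_mul_rpow hr hsp hrR
  refine lower_bound Ω f u ξ₀ k r ε hu hum hr hε ((closedHball_mono hrR).trans hRΩ) ?_ ?_ ?_
  · have hsub : hball ξ₀ r ⊆ closedHball ξ₀ R :=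
      (hball_mono hrR).trans (hball_subset_closedHball ξ₀ R)
    filter_upwards [ae_restrict_of_ae_restrict_of_subset hsub hF] with ξ hξ
    calc |f ξ (u ξ)| ≤ |F| := hξ.trans (le_abs_self F)
      _ ≤ |F| * (r ^ (-(s * p)) * R ^ (s * p)) := le_mul_of_one_le_right (abs_nonneg F) one_le
      _ ≤ Λ * ε ^ (p - 1) * r ^ (-(s * p)) := by
          rw [bound_eq]
          exact le_add_of_nonneg_left (by positivity)
  · refine (tail_le r hr hrR).trans (ENNReal.ofReal_le_ofReal ?_)
    rw [bound_eq]
    exact le_add_of_nonneg_right (by positivity)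
  · rwa [← mul_assoc]

end Heis

end

noncomputable section

theorem ae_restrict_of_forall_mem_exists_nhds {X : Type*} [TopologicalSpace X]
    [SecondCountableTopology X] [MeasurableSpace X] {μ : Measure X} {S : Set X} {P : X → Prop}
    (h : ∀ a ∈ S, ∃ t ∈ 𝓝 a, ∀ᵐ x ∂μ.restrict t, P x) : ∀ᵐ x ∂μ.restrict S, P x := by
  choose! t ht hP using h
  obtain ⟨T, hTS, hT, hcover⟩ := TopologicalSpace.countable_cover_nhdsWithin
    fun a ha => mem_nhdsWithin_of_mem_nhds (ht a ha)
  refine ae_restrict_of_ae_restrict_of_subset hcover ?_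
  rw [ae_restrict_biUnion_iff _ hT]
  exact fun a ha => hP a (hTS ha)

theorem exists_seq_ae_tendsto_average {X G : Type*} [TopologicalSpace X] [MeasurableSpace X]
    [BorelSpace X] [R1Space X] [TopologicalSpace G] [MeasurableSpace G] {μ : Measure X}
    [μ.InnerRegularCompactLTTop] [IsLocallyFiniteMeasure μ] [SFinite μ] {τ : G → X → X}
    (hτ : Continuous (Function.uncurry τ)) (hτm : Measurable (Function.uncurry τ))
    (hmp : ∀ g, MeasurePreserving (τ g) μ μ) {g₀ : G} (h₀ : ∀ x, τ g₀ x = x) {F : X → ℝ}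
    (hFm : StronglyMeasurable F) (hF : Integrable F μ) {ν : ℕ → Measure G}
    [∀ i, IsProbabilityMeasure (ν i)] (hν : ∀ N ∈ 𝓝 g₀, ∀ᶠ i in atTop, ∀ᵐ g ∂(ν i), g ∈ N) :
    ∃ φ : ℕ → ℕ, StrictMono φ ∧
      ∀ᵐ x ∂μ, Tendsto (fun i => ∫ g, F (τ g x) ∂(ν (φ i))) atTop (𝓝 (F x)) := by
  have lim := tendsto_eLpNorm_average_sub hτ hτm hmp h₀ le_rfl hFm
    (by rwa [ENNReal.ofReal_one, memLp_one_iff_integrable]) hν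
  have measurable_average (i : ℕ) : StronglyMeasurable fun x => ∫ g, F (τ g x) ∂(ν i) :=
    (hFm.comp_measurable (hτm.comp measurable_swap)).integral_prod_right'
  exact (tendstoInMeasure_of_tendsto_eLpNorm (by simp)
    (fun i => (measurable_average i).aestronglyMeasurable) hFm.aestronglyMeasurable
    lim).exists_seq_tendsto_ae

theorem aestronglyMeasurable_comp_of_caratheodory {X Y Z : Type*} [MeasurableSpace X]
    [TopologicalSpace Y] [TopologicalSpace Z] [TopologicalSpace.PseudoMetrizableSpace Z]
    {μ : Measure X} {f : X → Y → Z} (hf : ∀ y, AEStronglyMeasurable (fun x => f x y) μ)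
    (hcont : ∀ᵐ x ∂μ, Continuous (f x)) {u : X → Y} (hu : AEStronglyMeasurable u μ) :
    AEStronglyMeasurable (fun x => f x (u x)) μ := by
  have comp_simpleFunc (φ : SimpleFunc X Y) : AEStronglyMeasurable (fun x => f x (φ x)) μ := by
    have cover : ⋃ y : φ.range, φ ⁻¹' {(y : Y)} = univ :=
      eq_univ_of_forall fun x => mem_iUnion.2 ⟨⟨φ x, φ.mem_range_self x⟩, rfl⟩
    rw [← Measure.restrict_univ (μ := μ), ← cover, aestronglyMeasurable_iUnion_iff]
    refine fun y => (hf y).restrict.congr ?_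
    filter_upwards [ae_restrict_mem (φ.measurableSet_fiber y)] with x hx
    rw [show φ x = y from hx]
  refine aestronglyMeasurable_of_tendsto_ae atTop
    (fun i => comp_simpleFunc (hu.stronglyMeasurable_mk.approx i)) ?_
  filter_upwards [hcont, hu.ae_eq_mk] with x hx hux
  rw [hux]
  exact (hx.tendsto _).comp (hu.stronglyMeasurable_mk.tendsto_approx x)

namespace Heis

variable {n : ℕ} {s p k r R ρ ε : ℝ} {d u : Heis n → ℝ} {f : Heis n → ℝ → ℝ} {Ω : Set (Heis n)}
  {ξ a : Heis n}

/-! ### The essential lower limit -/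

theorem integral_cond_hball_one (F : Heis n → ℝ) (ξ : Heis n) (hr : 0 < r) :
    ∫ h, F (ξ * h) ∂(ProbabilityTheory.cond volume (hball 1 r)) =
      (r ^ homDim n * volume.real (hball (1 : Heis n) 1))⁻¹ * ∫ η in hball ξ r, F η := by
  have volume_eq :
      volume.real (hball (1 : Heis n) r) = r ^ homDim n * volume.real (hball (1 : Heis n) 1) := by
    rw [Measure.real, volume_hball _ hr, ENNReal.toReal_mul, ENNReal.toReal_ofReal (by positivity),
      Measure.real]
  rw [ProbabilityTheory.cond, integral_smul_measure, ENNReal.toReal_inv, ← Measure.real, volume_eq,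
    smul_eq_mul, ← (measurePreserving_mul_left volume ξ).setIntegral_preimage_emb
      (measurableEmbedding_mulLeft ξ) F, ← preimage_mul_left_hball ξ 1 r, mul_one]

theorem ae_exists_setIntegral_hball_le {F : Heis n → ℝ} (hFm : StronglyMeasurable F)
    (hF : Integrable F) :
    ∀ᵐ ξ : Heis n, F ξ = 0 → ∀ c R : ℝ, 0 < c → 0 < R → ∃ r, 0 < r ∧ r ≤ R ∧
      ∫ η in hball ξ r, F η ≤ c * r ^ homDim n := by
  set ρ : ℕ → ℝ := fun i => 1 / ((i : ℝ) + 1)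
  have ρ_pos (i : ℕ) : 0 < ρ i := Nat.one_div_pos_of_nat
  have ρ_lim : Tendsto ρ atTop (𝓝 0) := tendsto_one_div_add_atTop_nhds_zero_nat
  set ν : ℕ → Measure (Heis n) := fun i => ProbabilityTheory.cond volume (hball 1 (ρ i))
  have hνp (i : ℕ) : IsProbabilityMeasure (ν i) :=
    ProbabilityTheory.cond_isProbabilityMeasure_of_finite (volume_hball_pos 1 (ρ_pos i)).ne'
      (volume_hball_lt_top _ _).ne
  have ν_concentrates : ∀ N ∈ 𝓝 (1 : Heis n), ∀ᶠ i in atTop, ∀ᵐ h ∂(ν i), h ∈ N := by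
    intro N hN
    obtain ⟨δ, hδ, hδN⟩ := exists_closedHball_subset hN
    filter_upwards [ρ_lim.eventually_lt_const hδ] with i hi
    filter_upwards [ProbabilityTheory.ae_cond_mem (measurableSet_hball 1 (ρ i))] with h hh
    exact hδN (hball_subset_closedHball _ _ (hball_mono hi.le hh))
  obtain ⟨φ, hφ, hae⟩ := exists_seq_ae_tendsto_average (τ := fun h ξ : Heis n => ξ * h)
    (by unfold Function.uncurry; fun_prop) (by unfold Function.uncurry; fun_prop)
    (measurePreserving_mul_right volume) mul_one hFm hF ν_concentrates
  filter_upwards [hae] with ξ hξ h₀ c R hc hR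
  rw [h₀] at hξ
  set b := volume.real (hball (1 : Heis n) 1)
  have hb : 0 < b :=
    ENNReal.toReal_pos (volume_hball_pos _ one_pos).ne' (volume_hball_lt_top _ _).ne
  obtain ⟨i, average_lt, radius_lt⟩ := ((hξ.eventually_lt_const (div_pos hc hb)).and
    ((ρ_lim.comp hφ.tendsto_atTop).eventually_lt_const hR)).exists
  have hr := ρ_pos (φ i)
  refine ⟨ρ (φ i), hr, radius_lt.le, ?_⟩
  rw [integral_cond_hball_one F ξ hr, inv_mul_lt_iff₀ (by positivity)] at average_lt
  exact average_lt.le.trans_eq (by rw [mul_assoc, mul_div_cancel₀ _ hb.ne', mul_comm])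

theorem ae_exists_deficitMass_le (hp : 0 < p) (hum : Measurable u)
    (hfin : deficitMass p k u a ρ < ⊤) :
    ∀ᵐ ξ ∂(volume.restrict (hball a ρ)), k ≤ u ξ → ∀ c R : ℝ, 0 < c → 0 < R →
      ∃ r, 0 < r ∧ r ≤ R ∧ deficitMass p k u ξ r ≤ ENNReal.ofReal (c * r ^ homDim n) := by
  set F : Heis n → ℝ := (hball a ρ).indicator fun ξ => deficit k u ξ ^ p with F_def
  have hdm : Measurable fun ξ => deficit k u ξ ^ p := (measurable_deficit k hum).pow_const p
  have hd0 (ξ : Heis n) : 0 ≤ deficit k u ξ ^ p := Real.rpow_nonneg (deficit_nonneg k u ξ) p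
  have ofReal_deficit_rpow (ξ : Heis n) :
      ENNReal.ofReal (deficit k u ξ ^ p) = ENNReal.ofReal (k - u ξ) ^ p := by
    rw [← ENNReal.ofReal_rpow_of_nonneg (deficit_nonneg k u ξ) hp.le, ofReal_deficit]
  have hF : Integrable F := by
    refine (integrable_indicator_iff (measurableSet_hball _ _)).2 ⟨hdm.aestronglyMeasurable, ?_⟩
    rw [hasFiniteIntegral_iff_ofReal (ae_of_all _ hd0)]
    simpa only [ofReal_deficit_rpow, deficitMass] using hfin
  have hFm : StronglyMeasurable F := (hdm.indicator (measurableSet_hball a ρ)).stronglyMeasurable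
  rw [ae_restrict_iff' (measurableSet_hball _ _)]
  filter_upwards [ae_exists_setIntegral_hball_le hFm hF] with ξ good hξ hk c R
    hc hR
  have hFξ : F ξ = 0 := by
    rw [F_def, indicator_of_mem hξ, deficit_of_le hk, Real.zero_rpow hp.ne']
  obtain ⟨r, hr, hrR, integral_le⟩ := good hFξ c (min R (ρ - hdist a ξ)) hc
    (lt_min hR (sub_pos.2 hξ))
  have hsub : hball ξ r ⊆ hball a ρ :=
    hball_subset_hball (by linarith [hrR.trans (min_le_right _ _)])
  refine ⟨r, hr, hrR.trans (min_le_left _ _), ?_⟩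
  calc deficitMass p k u ξ r = ∫⁻ η in hball ξ r, ENNReal.ofReal (F η) :=
        setLIntegral_congr_fun (measurableSet_hball _ _) fun η hη => by
          simp only [F_def, indicator_of_mem (hsub hη), ofReal_deficit_rpow]
    _ = ENNReal.ofReal (∫ η in hball ξ r, F η) :=
        (ofReal_integral_eq_lintegral_ofReal hF.integrableOn
          (ae_of_all _ (indicator_nonneg fun ξ _ => hd0 ξ))).symm
    _ ≤ ENNReal.ofReal (c * r ^ homDim n) := ENNReal.ofReal_le_ofReal integral_le

theorem le_essLiminf_of_ae_le (hr : 0 < r) (h : ∀ᵐ η ∂(volume.restrict (hball ξ r)), k ≤ u η) :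
    (k : EReal) ≤ essLiminf u ξ :=
  le_iSup₂_of_le r hr (le_essInf_of_ae_le _ (h.mono fun _ => EReal.coe_le_coe))

theorem exists_lt_essInf_of_lt_essLiminf {y : EReal} (h : y < essLiminf u ξ) :
    ∃ r, 0 < r ∧ y < essInf (fun η => (u η : EReal)) (volume.restrict (hball ξ r)) := by
  obtain ⟨r, hr⟩ := lt_iSup_iff.1 h
  obtain ⟨hr₀, hr⟩ := lt_iSup_iff.1 hr
  exact ⟨r, hr₀, hr⟩

theorem lowerSemicontinuous_essLiminf (u : Heis n → ℝ) : LowerSemicontinuous (essLiminf u) := by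
  intro ξ y hy
  obtain ⟨r, hr, hlt⟩ := exists_lt_essInf_of_lt_essLiminf hy
  filter_upwards [hball_mem_nhds hr] with η hη
  refine hlt.trans_le (le_iSup₂_of_le (r - hdist ξ η) (sub_pos.2 hη) (essInf_antitone_measure ?_))
  exact (Measure.restrict_mono (hball_subset_hball (by linarith)) le_rfl).absolutelyContinuous

theorem ae_essLiminf_le (u : Heis n → ℝ) : ∀ᵐ ξ : Heis n, essLiminf u ξ ≤ u ξ := by
  have at_level (q : ℚ) : ∀ᵐ ξ : Heis n, ((q : ℝ) : EReal) < essLiminf u ξ → q ≤ u ξ := by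
    have isOpen_superlevel : IsOpen {ξ : Heis n | ((q : ℝ) : EReal) < essLiminf u ξ} :=
      (lowerSemicontinuous_essLiminf u).isOpen_preimage _
    refine (ae_restrict_iff' isOpen_superlevel.measurableSet).1
      (ae_restrict_of_forall_mem_exists_nhds fun a ha => ?_)
    obtain ⟨r, hr, hlt⟩ := exists_lt_essInf_of_lt_essLiminf ha
    exact ⟨_, hball_mem_nhds hr,
      (ae_lt_of_lt_essInf hlt).mono fun _ h => EReal.coe_le_coe_iff.1 h.le⟩
  filter_upwards [ae_all_iff.2 at_level] with ξ hξ
  refine EReal.ge_of_forall_gt_iff_ge.1 fun x hx => ?_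
  obtain ⟨q, hxq, hq⟩ := EReal.lt_iff_exists_rat_btwn.1 hx
  exact hxq.le.trans (EReal.coe_le_coe (hξ q hq))

theorem IsWeakSupersolution.ae_le_essLiminf (hu : IsWeakSupersolution s p d f Ω u)
    (hs : 0 < s) (hs1 : s < 1) (hp : 1 < p) (hd : IsComparable d) (hum : Measurable u)
    (hΩ : IsOpen Ω)
    (hfu : ∀ K, IsCompact K → K ⊆ Ω → MemLp (fun ξ => f ξ (u ξ)) ⊤ (volume.restrict K)) :
    ∀ᵐ ξ ∂(volume.restrict Ω), (u ξ : EReal) ≤ essLiminf u ξ := by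
  have hp0 : 0 < p := by linarith
  have at_level (k : ℝ) : ∀ᵐ ξ ∂(volume.restrict Ω), k ≤ u ξ → (k : EReal) ≤ essLiminf u ξ := by
    refine ae_restrict_of_forall_mem_exists_nhds fun a ha => ?_
    obtain ⟨ρ, hρ, hρΩ⟩ := exists_closedHball_subset (hΩ.mem_nhds ha)
    refine ⟨hball a ρ, hball_mem_nhds hρ, ?_⟩
    filter_upwards [ae_exists_deficitMass_le hp0 hum (hu.deficitMass_lt_top hp0 k hρΩ),
      ae_restrict_mem (measurableSet_hball a ρ)] with ξ exists_small hξ hk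
    refine EReal.ge_of_forall_gt_iff_ge.1 fun x hx => ?_
    have hξΩ : Ω ∈ 𝓝 ξ := hΩ.mem_nhds (hρΩ (hball_subset_closedHball a ρ hξ))
    obtain ⟨ν, R, hν, hR, lower_bound⟩ := hu.exists_threshold hs hs1 hp hd hum hξΩ hfu k
      (sub_pos.2 (EReal.coe_lt_coe_iff.1 hx))
    obtain ⟨r, hr, hrR, small⟩ := exists_small hk ν R hν hR
    refine le_essLiminf_of_ae_le (half_pos hr) ?_
    simpa only [sub_sub_cancel] using lower_bound r hr hrR small
  filter_upwards [ae_all_iff.2 fun q : ℚ => at_level q] with ξ hξ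
  refine EReal.ge_of_forall_gt_iff_ge.1 fun x hx => ?_
  obtain ⟨q, hxq, hq⟩ := EReal.lt_iff_exists_rat_btwn.1 hx
  exact hxq.le.trans (hξ q (EReal.coe_lt_coe_iff.1 hq).le)

theorem IsWeakSupersolution.essLiminf_ne_bot (hu : IsWeakSupersolution s p d f Ω u)
    (hs : 0 < s) (hs1 : s < 1) (hp : 1 < p) (hd : IsComparable d) (hum : Measurable u)
    (hΩ : Ω ∈ 𝓝 ξ)
    (hfu : ∀ K, IsCompact K → K ⊆ Ω → MemLp (fun ξ => f ξ (u ξ)) ⊤ (volume.restrict K)) :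
    essLiminf u ξ ≠ ⊥ := by
  obtain ⟨R, M, hR, -, hM⟩ := hu.exists_lower_bound hs hs1 hp hd hum hΩ hfu
  exact ne_bot_of_le_ne_bot (EReal.coe_ne_bot (-M)) (le_essLiminf_of_ae_le hR hM)

theorem IsDatum.memLp_top_comp (hf : IsDatum Ω f) (hu : AEStronglyMeasurable u volume)
    {K : Set (Heis n)} (hK : IsCompact K) (hKΩ : K ⊆ Ω) :
    MemLp (fun ξ => f ξ (u ξ)) ⊤ (volume.restrict K) := by
  obtain ⟨C, hC⟩ := hf.uniform K hK hKΩ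
  refine memLp_top_of_bound
    (aestronglyMeasurable_comp_of_caratheodory hf.measurable hf.continuous hu).restrict C ?_
  have at_rat : ∀ᵐ ξ ∂(volume.restrict K), ∀ q : ℚ, |f ξ q| ≤ C := ae_all_iff.2 fun q => hC q
  filter_upwards [at_rat, ae_restrict_of_ae hf.continuous] with ξ hq hcont
  exact Rat.denseRange_cast.induction_on (p := fun x : ℝ => |f ξ x| ≤ C) (u ξ)
    (isClosed_le hcont.abs continuous_const) hq

end Heis

theorem mainTheorem6_general {n : ℕ} {s p : ℝ} (hs : 0 < s) (hs1 : s < 1) (hp : 1 < p)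
    {d : Heis n → ℝ} (hd : Heis.IsComparable d) {Ω : Set (Heis n)} (hΩ : IsOpen Ω)
    {f : Heis n → ℝ → ℝ} {u : Heis n → ℝ} (hu : Heis.IsWeakSupersolution s p d f Ω u)
    (hfu : ∀ K, IsCompact K → K ⊆ Ω → MemLp (fun ξ => f ξ (u ξ)) ⊤ (volume.restrict K)) :
    (∀ᵐ ξ ∂(volume.restrict Ω), (u ξ : EReal) = Heis.essLiminf u ξ) ∧
    ∃ v : Heis n → EReal,
      LowerSemicontinuousOn v Ω ∧ (∀ ξ ∈ Ω, v ξ ≠ ⊥) ∧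
        ∀ᵐ ξ ∂(volume.restrict Ω), (u ξ : EReal) = v ξ := by
  have u_eq := hu.measurable.ae_eq_mk
  set w := hu.measurable.mk u
  have hw := hu.congr_ae u_eq
  have hwm : Measurable w := hu.measurable.stronglyMeasurable_mk.measurable
  have hfw : ∀ K, IsCompact K → K ⊆ Ω → MemLp (fun ξ => f ξ (w ξ)) ⊤ (volume.restrict K) :=
    fun K hK hKΩ => (hfu K hK hKΩ).ae_eq
      ((ae_restrict_of_ae u_eq).mono fun ξ hξ => congrArg (f ξ) hξ)
  have ae_eq : ∀ᵐ ξ ∂(volume.restrict Ω), (u ξ : EReal) = Heis.essLiminf u ξ := by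
    rw [Heis.essLiminf_congr_ae u_eq]
    filter_upwards [hw.ae_le_essLiminf hs hs1 hp hd hwm hΩ hfw,
      ae_restrict_of_ae (Heis.ae_essLiminf_le w), ae_restrict_of_ae u_eq] with ξ hle hge hξ
    rw [hξ]
    exact le_antisymm hle hge
  refine ⟨ae_eq, Heis.essLiminf u,
    (Heis.lowerSemicontinuous_essLiminf u).lowerSemicontinuousOn Ω, fun ξ hξ => ?_, ae_eq⟩
  rw [Heis.essLiminf_congr_ae u_eq]
  exact hw.essLiminf_ne_bot hs hs1 hp hd hwm (hΩ.mem_nhds hξ) hfw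

end

theorem mainTheorem6 (n : ℕ) (hn : 1 ≤ n) (s p : ℝ) (hs : 0 < s) (hs1 : s < 1) (hp : 1 < p)
    (d : Heis n → ℝ) (hd : Heis.IsHomogeneousNorm d)
    (Ω : Set (Heis n)) (hΩ : IsOpen Ω)
    (f : Heis n → ℝ → ℝ) (hf : Heis.IsDatum Ω f)
    (u : Heis n → ℝ) (hu : Heis.IsWeakSupersolution s p d f Ω u) :
    (∀ᵐ ξ ∂(volume.restrict Ω), (u ξ : EReal) = Heis.essLiminf u ξ) ∧
    ∃ v : Heis n → EReal,
      LowerSemicontinuousOn v Ω ∧ (∀ ξ ∈ Ω, v ξ ≠ ⊥) ∧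
        ∀ᵐ ξ ∂(volume.restrict Ω), (u ξ : EReal) = v ξ :=
  mainTheorem6_general hs hs1 hp hd.isComparable hΩ hu fun _ => hf.memLp_top_comp hu.measurable
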